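/- **Setting.** Fix the word RAM in which a memory cell holds a $w(n)$-bit word or a real coordinate, the usual word operations cost one step, and coordinates can only be moved, negated and compared (one step each); $\lg=\log_2$. A data structure is a read-only memory image, relocatable to any place in memory; its space is its number of cells. It is queried by a fixed program that may use work space of free cells. A statement that a structure exists or works within given bounds is understood on machines whose $2^{w(n)}$ cells are at least a constant times the sum of its space and time bounds, and the work space is of the order of this sum. A canonical box is a nonempty box $[x_1,\infty)\times[y_1,y_2)\times[z_1,z_2)$ with $x_1,y_1,z_1\in\mathbb R$, $y_2,z_2\in\mathbb R\cup\{+\infty\}$. Let $\delta,h,\varphi,\tau,f,g$ be functions with values $\ge 1$ for $n\ge 2$, and suppose that two structures are given. *Stabbing structure.* For every set of $N$ canonical boxes, $1\le N\le 2n$, it occupies $O(N\,h(n))$ words. Each of its bottom-layer nodes, which are identified by the position of their records in the structure, is assigned a list of distinct boxes, its bottom list. Each box is in $O(\delta(n))$ bottom lists (duplication factor). Given $q\in\mathbb R^3$, it locates in $O(\varphi(n))$ time $O(\varphi(n))$ nonempty prefixes of bottom lists that are pairwise disjoint and whose union is the set of boxes containing $q$. Once a prefix is located, its length can be computed in $O(1)$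 time and, for any $j$ up to this length, its $j$-th box can be reported in $O(\tau(n))$ time. *Emptiness structure.* For $m$ points in rank space, $1\le m\le n$, colored in $\{0,\dots,n-1\}$, it occupies $O(m f(n))$ words and decides in $O(g(n))$ time whether a given orthogonal rectangle contains a point of a given color. **Framework.** Let $P$ be a set of $n\ge2$ points in $\mathbb R^2$ with distinct $x$-coordinates and distinct $y$-coordinates, colored in $\{0,\dots,n-1\}$, and let $X\in[1,n]$ be an integer. Let $T$ be the balanced binary range tree over the $y$-coordinates of $P$, and let $P(v)$ be the set of points at the leaf descendants of $v$. For each internal node $v$ with children $v_l,v_r$, the framework stores $P(v)$ sorted by $x$; the sorted $y$-coordinates of $P(v)$; stabbing structures $S(v_l),S(v_r)$ with the color of each box; emptiness structures for $P(v_l)$ and $P(v_r)$ in rank space; and a matrix $M(v)$; besides, it stores tree links and tables of offsets. Here $S(v_l)$ is built over at most $2|P(v_l)|$ colored canonical boxes such that, for each color $c$, the boxes of color $c$ partition the region of all points of $\mathbb R^3$ that dominate $(-p_x,p_x,-p_y)$ for some $p\in P(v_l)$ of color $c$; $S(v_r)$ is defined likewise with $P(v_r)$ and $(-p_x,p_x,p_y)$.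 Divide each bottom list into consecutive blocks of $X$ boxes, the last one possibly shorter; a block of exactly $X$ boxes is full. Each row of $M(v)$ corresponds to a prefix of a bottom list of $S(v_l)$ that ends with a full block, each column to such a prefix for $S(v_r)$, and the entry is the number of colors that occur in both prefixes. **Claim.** There are one query program and one constant in the $O$-bounds, independent of $n$, $X$ and $P$, such that the framework (for suitable choices of the boxes, the links and the tables) occupies $$O\bigl((n\,\delta(n)/X)^2+n\lg n\,(f(n)+h(n))\bigr)$$ words, and for every rectangle $[a,b]\times[c,d]$ the program computes the number of distinct colors of the points of $P$ in it in $$O\bigl(\varphi(n)^2+X\varphi(n)(\lg\lg n+g(n)+\tau(n))+\lg n\bigr)$$ time. -/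

import Mathlib

namespace ColoredRange

/-! ### The word RAM

A machine with `w`-bit words.  Coordinates are real numbers; like a word, a coordinate fills one
memory cell, and coordinates can only be moved, negated and compared. -/

/-- The content of a memory cell: a `w`-bit word or a coordinate. -/
inductive Cell (w : ℕ) where
  | word (v : BitVec w)
  | coord (x : ℝ)

/-- The word operations, as usual modulo `2 ^ w`. -/
inductive Op where
  | add | sub | mul | div | mod | and | or | xor | shl | shr | lt | eq

def Op.eval {w : ℕ} : Op → BitVec w → BitVec w → BitVec w
  | .add, a, b => a + b
  | .sub, a, b => a - b
  | .mul, a, b => a * b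
  | .div, a, b => a / b
  | .mod, a, b => a % b
  | .and, a, b => a &&& b
  | .or, a, b => a ||| b
  | .xor, a, b => a ^^^ b
  | .shl, a, b => a <<< b.toNat
  | .shr, a, b => a >>> b.toNat
  | .lt, a, b => if a.toNat < b.toNat then 1#w else 0#w
  | .eq, a, b => if a = b then 1#w else 0#w

/-- A machine state: word registers, coordinate registers, and the memory.  Addresses are words,
so only the cells `0, …, 2 ^ w - 1` of `mem` can be reached. -/
structure State (w : ℕ) where
  reg : ℕ → BitVec w
  creg : ℕ → ℝ
  mem : ℕ → Cell w

/-- The instructions, each of unit cost. -/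
inductive Instr where
  | const (d k : ℕ)
  | op (o : Op) (d a b : ℕ)
  | load (d a : ℕ)
  | store (a s : ℕ)
  | cload (d a : ℕ)
  | cstore (a s : ℕ)
  | cmove (d s : ℕ)
  | cneg (d s : ℕ)
  | cle (d a b : ℕ)

/-- The word in a cell (zero if it holds a coordinate). -/
def Cell.toWord {w : ℕ} : Cell w → BitVec w
  | .word v => v
  | .coord _ => 0#w

/-- The coordinate in a cell (zero if it holds a word). -/
noncomputable def Cell.toCoord {w : ℕ} : Cell w → ℝ
  | .word _ => 0
  | .coord x => x

namespace State

variable {w : ℕ} (σ : State w)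

def setReg (d : ℕ) (v : BitVec w) : State w := { σ with reg := Function.update σ.reg d v }

def setCreg (d : ℕ) (x : ℝ) : State w := { σ with creg := Function.update σ.creg d x }

def setMem (a : ℕ) (u : Cell w) : State w := { σ with mem := Function.update σ.mem a u }

end State

/-- The effect of an instruction. -/
noncomputable def Instr.step {w : ℕ} (i : Instr) (σ : State w) : State w :=
  match i with
  | .const d k => σ.setReg d (BitVec.ofNat w k)
  | .op o d a b => σ.setReg d (o.eval (σ.reg a) (σ.reg b))
  | .load d a => σ.setReg d (σ.mem (σ.reg a).toNat).toWord
  | .store a s => σ.setMem (σ.reg a).toNat (.word (σ.reg s))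
  | .cload d a => σ.setCreg d (σ.mem (σ.reg a).toNat).toCoord
  | .cstore a s => σ.setMem (σ.reg a).toNat (.coord (σ.creg s))
  | .cmove d s => σ.setCreg d (σ.creg s)
  | .cneg d s => σ.setCreg d (-σ.creg s)
  | .cle d a b => σ.setReg d (if σ.creg a ≤ σ.creg b then 1#w else 0#w)

/-- Programs: finite texts, independent of the word size and of the input. -/
inductive Cmd where
  | instr (i : Instr)
  | seq (c d : Cmd)
  | cond (r : ℕ) (c d : Cmd)
  | loop (r : ℕ) (c : Cmd)

/-- `Runs c σ σ' t`: started in `σ`, the program `c` halts in `σ'` after `t` steps.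
`cond r c d` runs `c` if register `r` is nonzero and `d` otherwise; `loop r c` repeats `c` while
register `r` is nonzero; every test costs one step. -/
inductive Runs {w : ℕ} : Cmd → State w → State w → ℕ → Prop where
  | instr (i : Instr) (σ : State w) : Runs (.instr i) σ (i.step σ) 1
  | seq {c d : Cmd} {σ σ' σ'' : State w} {s t : ℕ} :
      Runs c σ σ' s → Runs d σ' σ'' t → Runs (.seq c d) σ σ'' (s + t)
  | cond_true {r : ℕ} {c d : Cmd} {σ σ' : State w} {t : ℕ} :
      σ.reg r ≠ 0#w → Runs c σ σ' t → Runs (.cond r c d) σ σ' (t + 1)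
  | cond_false {r : ℕ} {c d : Cmd} {σ σ' : State w} {t : ℕ} :
      σ.reg r = 0#w → Runs d σ σ' t → Runs (.cond r c d) σ σ' (t + 1)
  | loop_done {r : ℕ} {c : Cmd} {σ : State w} :
      σ.reg r = 0#w → Runs (.loop r c) σ σ 1
  | loop_step {r : ℕ} {c : Cmd} {σ σ' σ'' : State w} {s t : ℕ} :
      σ.reg r ≠ 0#w → Runs c σ σ' s → Runs (.loop r c) σ' σ'' t →
      Runs (.loop r c) σ σ'' (s + t + 1)

/-- The list `L` is stored in consecutive cells from address `a` on. -/
def StoredAt {w : ℕ} (mem : ℕ → Cell w) (a : ℕ) (L : List (Cell w)) : Prop :=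
  ∀ (i : ℕ) (hi : i < L.length), mem (a + i) = L[i]

/-- The calling convention.  The static structure `img` lies at address `base` (register `0`),
below the address `fp` (register `1`) from which on `scratch` cells of work space with arbitrary
content are free; word arguments are in registers `2, 3, …`, coordinate arguments in coordinate
registers `0, 1, …`; everything fits into the `2 ^ w` cells of the machine. -/
structure Ready {w : ℕ} (σ : State w) (base fp : ℕ) (img : List (Cell w))
    (wargs : List (BitVec w)) (cargs : List ℝ) (scratch : ℝ) : Prop where
  base_reg : (σ.reg 0).toNat = base
  fp_reg : (σ.reg 1).toNat = fp
  wargs_reg : ∀ (i : ℕ) (hi : i < wargs.length), σ.reg (2 + i) = wargs[i]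
  cargs_reg : ∀ (i : ℕ) (hi : i < cargs.length), σ.creg i = cargs[i]
  img_stored : StoredAt σ.mem base img
  img_below : base + img.length ≤ fp
  scratch_fits : (fp : ℝ) + scratch ≤ 2 ^ w

/-- Wherever the structure `img` is placed in memory, `c` halts on the given arguments within
`time` steps, changes no cell outside its work space (in particular not the structure), and
achieves `post`, a condition on the address of the work space and the final state. -/
def Answers {w : ℕ} (c : Cmd) (img : List (Cell w)) (wargs : List (BitVec w)) (cargs : List ℝ)
    (scratch time : ℝ) (post : ℕ → State w → Prop) : Prop :=
  ∀ (σ : State w) (base fp : ℕ), Ready σ base fp img wargs cargs scratch →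
    ∃ (σ' : State w) (t : ℕ), Runs c σ σ' t ∧ (t : ℝ) ≤ time ∧
      (∀ a : ℕ, a < fp ∨ (fp : ℝ) + scratch ≤ a → σ'.mem a = σ.mem a) ∧ post fp σ'

/-! ### Stabbing queries over canonical boxes -/

/-- A (nonempty) canonical box `[x₁, ∞) × [y₁, y₂) × [z₁, z₂)`. -/
structure CanonicalBox where
  x₁ : ℝ
  y₁ : ℝ
  z₁ : ℝ
  y₂ : WithTop ℝ
  z₂ : WithTop ℝ
  hy : (y₁ : WithTop ℝ) < y₂
  hz : (z₁ : WithTop ℝ) < z₂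

def CanonicalBox.toSet (b : CanonicalBox) : Set (ℝ × ℝ × ℝ) :=
  {q | b.x₁ ≤ q.1 ∧ (b.y₁ ≤ q.2.1 ∧ (q.2.1 : WithTop ℝ) < b.y₂) ∧
    (b.z₁ ≤ q.2.2 ∧ (q.2.2 : WithTop ℝ) < b.z₂)}

/-- The carrier of a 3D stabbing query structure on machines with `w n`-bit words, where `n` is
the size of the point set of the whole problem: for a family `B` of boxes, `image n B` is the
memory image of the structure and `bottom n B v` is the bottom list (as a list of indices of
boxes) of the bottom-layer node whose record has offset `v` in this image (empty if there is no
such node).  The programs locate prefixes of bottom lists, compute the length of a located prefix,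
and report a box of a located prefix; a located prefix is described by `width + 1` words. -/
structure StabbingStructure (w : ℕ → ℕ) where
  width : ℕ
  locate : Cmd
  length : Cmd
  report : Cmd
  image : (n : ℕ) → {N : ℕ} → (Fin N → CanonicalBox) → List (Cell (w n))
  bottom : (n : ℕ) → {N : ℕ} → (Fin N → CanonicalBox) → ℕ → List (Fin N)

/-- A located prefix: the first `len` entries of the bottom list of `node`, together with the
words `aux` that describe it besides the pointer to the node. -/
structure LocatedPrefix (w : ℕ) where
  node : ℕ
  len : ℕ
  aux : List (BitVec w)

def LocatedPrefix.words {w : ℕ} (p : LocatedPrefix w) : List (BitVec w) :=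
  BitVec.ofNat w p.node :: p.aux

namespace StabbingStructure

variable {w : ℕ → ℕ} (S : StabbingStructure w) (n : ℕ) {N : ℕ} (B : Fin N → CanonicalBox)

/-- The boxes of a located prefix. -/
def boxes (p : LocatedPrefix (w n)) : List (Fin N) :=
  (S.bottom n B p.node).take p.len

/-- The prefixes in `D` are nonempty prefixes of bottom lists, pairwise disjoint, and their union
is the set of boxes that contain `q`. -/
structure IsAnswer (q : ℝ × ℝ × ℝ) (D : List (LocatedPrefix (w n))) : Prop where
  aux_length : ∀ p ∈ D, p.aux.length = S.width
  nonempty : ∀ p ∈ D, 1 ≤ p.len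
  is_prefix : ∀ p ∈ D, p.len ≤ (S.bottom n B p.node).length
  disjoint : D.Pairwise fun p p' => List.Disjoint (S.boxes n B p) (S.boxes n B p')
  union : ∀ i, (∃ p ∈ D, i ∈ S.boxes n B p) ↔ q ∈ (B i).toSet

/-- The structure for `B` is correct, with bounds `δ` on the duplication factor, `space` on the
number of words, `φ` on the number of prefixes and the time to locate them, `cst` on the time to
compute a length, `τ` on the time to report a box, and `scratch` on the work space. -/
structure Correct (δ space φ cst τ scratch : ℝ) : Prop where
  space_le : ((S.image n B).length : ℝ) ≤ space
  nodup : ∀ v, (S.bottom n B v).Nodup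
  node_lt : ∀ v, S.bottom n B v ≠ [] → v < (S.image n B).length
  duplication_le : ∀ i : Fin N,
    ((((Finset.range (S.image n B).length).filter fun v => i ∈ S.bottom n B v).card : ℕ) : ℝ) ≤ δ
  query : ∀ q : ℝ × ℝ × ℝ, ∃ D : List (LocatedPrefix (w n)),
    S.IsAnswer n B q D ∧ (D.length : ℝ) ≤ φ ∧
    Answers S.locate (S.image n B) [] [q.1, q.2.1, q.2.2] scratch φ
      (fun fp σ => (σ.reg 0).toNat = D.length ∧
        StoredAt σ.mem fp (D.flatMap fun p => p.words.map Cell.word)) ∧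
    ∀ p ∈ D,
      Answers S.length (S.image n B) p.words [] scratch cst
        (fun _ σ => (σ.reg 0).toNat = p.len) ∧
      ∀ (j : ℕ) (i : Fin N), (S.boxes n B p)[j]? = some i →
        Answers S.report (S.image n B) (p.words ++ [BitVec.ofNat (w n) j]) [] scratch τ
          (fun _ σ => (σ.reg 0).toNat = i)

/-- The structure has duplication factor `O(δ(n))`, space `O(N h(n))`, locates `O(φ(n))` prefixes
in `O(φ(n))` time, computes their lengths in `O(1)` time and reports a box in `O(τ(n))` time, for
all sets of `N ≤ 2 n` boxes, provided that the machine has enough memory.  (For `m` points, the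
region `U(A)` is a disjoint union of at most `2 m` canonical boxes.) -/
def HasBounds (δ h φ τ : ℕ → ℝ) : Prop :=
  ∃ K : ℝ, 0 < K ∧ ∀ n : ℕ, 2 ≤ n → ∀ N : ℕ, 1 ≤ N → N ≤ 2 * n →
    ∀ B : Fin N → CanonicalBox, Function.Injective B →
      K * (N * h n + φ n + τ n) ≤ 2 ^ w n →
        S.Correct n B (K * δ n) (K * (N * h n)) (K * φ n) K (K * τ n)
          (K * (N * h n + φ n + τ n))

end StabbingStructure

/-! ### Colored range emptiness in rank space -/

/-- The carrier of a 2D orthogonal colored range emptiness structure in rank space.  The input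
`L` lists, by increasing `x`-rank, the `y`-ranks and the colors of the points. -/
structure EmptinessStructure (w : ℕ → ℕ) where
  query : Cmd
  image : (n : ℕ) → List (ℕ × Fin n) → List (Cell (w n))

/-- Some point of color `c` lies in the rank-space rectangle `[x₁, x₂] × [y₁, y₂]`. -/
def HasColorIn {n : ℕ} (L : List (ℕ × Fin n)) (c : Fin n) (x₁ x₂ y₁ y₂ : ℕ) : Prop :=
  ∃ i y : ℕ, L[i]? = some (y, c) ∧ (x₁ ≤ i ∧ i ≤ x₂) ∧ (y₁ ≤ y ∧ y ≤ y₂)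

/-- For `1 ≤ m ≤ n` points in rank space, colored in `{0, …, n - 1}`, the structure has
`O(m f(n))` words and answers emptiness queries in `O(g(n))` time. -/
def EmptinessStructure.HasBounds {w : ℕ → ℕ} (E : EmptinessStructure w) (f g : ℕ → ℝ) : Prop :=
  ∃ K : ℝ, 0 < K ∧ ∀ n : ℕ, 2 ≤ n → ∀ L : List (ℕ × Fin n), 1 ≤ L.length → L.length ≤ n →
    (L.map Prod.fst).Perm (List.range L.length) →
      K * (L.length * f n + g n) ≤ 2 ^ w n →
        ((E.image n L).length : ℝ) ≤ K * (L.length * f n) ∧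
        ∀ (c : Fin n) (x₁ x₂ y₁ y₂ : Fin L.length),
          Answers E.query (E.image n L)
            [BitVec.ofNat (w n) c, BitVec.ofNat (w n) x₁, BitVec.ofNat (w n) x₂,
              BitVec.ofNat (w n) y₁, BitVec.ofNat (w n) y₂] []
            (K * (L.length * f n + g n)) (K * g n)
            (fun _ σ => (HasColorIn L c x₁ x₂ y₁ y₂ → σ.reg 0 = 1#(w n)) ∧
              (¬ HasColorIn L c x₁ x₂ y₁ y₂ → σ.reg 0 = 0#(w n)))

/-! ### The range-tree framework -/

/-- The internal nodes of the balanced binary tree whose leaves are `lo, …, hi - 1`; a node is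
given by the interval `[lo, hi)` of its leaf descendants. -/
def internalNodes (lo hi : ℕ) : List (ℕ × ℕ) :=
  if 2 ≤ hi - lo then
    (lo, hi) :: (internalNodes lo ((lo + hi) / 2) ++ internalNodes ((lo + hi) / 2) hi)
  else []
termination_by hi - lo
decreasing_by all_goals omega

section Framework

variable {n : ℕ} (P : Fin n → ℝ × ℝ) (col : Fin n → Fin n)

/-- The number of points below point `i`. -/
noncomputable def yRank (i : Fin n) : ℕ :=
  (Finset.univ.filter fun j => (P j).2 < (P i).2).card

/-- The points stored at the leaves `lo, …, hi - 1` of the range tree over the `y`-coordinates. -/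
noncomputable def nodePoints (lo hi : ℕ) : Finset (Fin n) :=
  Finset.univ.filter fun i => lo ≤ yRank P i ∧ yRank P i < hi

/-- The elements of `s` by increasing `key`. -/
noncomputable def sortBy (key : Fin n → ℝ) (s : Finset (Fin n)) : List (Fin n) :=
  s.toList.mergeSort fun i j => decide (key i ≤ key j)

/-- The point set of a node, converted to rank space. -/
noncomputable def rankSpace (lo hi : ℕ) : List (ℕ × Fin n) :=
  (sortBy (fun i => (P i).1) (nodePoints P lo hi)).map fun i => (yRank P i - lo, col i)

/-- A family of colored boxes. -/
structure ColoredBoxes (n : ℕ) where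
  N : ℕ
  box : Fin N → CanonicalBox
  color : Fin N → Fin n

/-- The lifting that turns 3-sided ranges `[a, b] × [c, ∞)` into dominance ranges. -/
def liftTop (p : ℝ × ℝ) : ℝ × ℝ × ℝ := (-p.1, p.1, -p.2)

/-- The lifting that turns 3-sided ranges `[a, b] × (-∞, d]` into dominance ranges. -/
def liftBot (p : ℝ × ℝ) : ℝ × ℝ × ℝ := (-p.1, p.1, p.2)

/-- For each color `c`, the boxes of color `c` partition the region `U(A)` of the points that
dominate a point of `A`, where `A` is the set of lifted points of color `c` with index in `s`.
There are at most two boxes per point. -/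
structure ColoredBoxes.Decomposes (D : ColoredBoxes n) (lift : ℝ × ℝ → ℝ × ℝ × ℝ)
    (s : Finset (Fin n)) : Prop where
  card_le : D.N ≤ 2 * s.card
  injective : Function.Injective D.box
  disjoint : ∀ i j, i ≠ j → D.color i = D.color j → Disjoint (D.box i).toSet (D.box j).toSet
  union : ∀ c, (⋃ i ∈ {i | D.color i = c}, (D.box i).toSet) =
    ⋃ p ∈ {p | p ∈ s ∧ col p = c}, Set.Ici (lift (P p))

/-- The prefixes of the bottom lists that end with the last entry of a full block (a block of
length `X`), over all nodes of a structure with `size` words. -/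
def fullPrefixes {N : ℕ} (X size : ℕ) (bottom : ℕ → List (Fin N)) : List (List (Fin N)) :=
  (List.range size).flatMap fun v =>
    (List.range ((bottom v).length / X)).map fun k => (bottom v).take ((k + 1) * X)

/-- The number of colors that occur both in `s` and in `t`. -/
def commonColors (D D' : ColoredBoxes n) (s : List (Fin D.N)) (t : List (Fin D'.N)) : ℕ :=
  ((s.map D.color).toFinset ∩ (t.map D'.color).toFinset).card

variable {w : ℕ → ℕ} (S : StabbingStructure w) (E : EmptinessStructure w) (X : ℕ)

/-- The matrix of a node, row by row: rows are the full-block prefixes of the left stabbing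
structure, columns those of the right one. -/
def matrixCells (D D' : ColoredBoxes n) : List (Cell (w n)) :=
  (fullPrefixes X (S.image n D.box).length (S.bottom n D.box)).flatMap fun s =>
    (fullPrefixes X (S.image n D'.box).length (S.bottom n D'.box)).map fun t =>
      Cell.word (BitVec.ofNat (w n) (commonColors D D' s t))

/-- What is stored for the internal node `v = [lo, hi)`, with children `[lo, mid)` and
`[mid, hi)`: the points sorted by `x`, the sorted `y`-coordinates, the stabbing structures of the
two children with the colors of their boxes, the emptiness structures of the two children, and the
matrix. -/
noncomputable def nodeCells (D D' : ColoredBoxes n) (lo hi : ℕ) : List (Cell (w n)) :=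
  ((sortBy (fun i => (P i).1) (nodePoints P lo hi)).flatMap fun i =>
    [Cell.coord (P i).1, Cell.coord (P i).2, Cell.word (BitVec.ofNat (w n) (col i))]) ++
  ((sortBy (fun i => (P i).2) (nodePoints P lo hi)).map fun i => Cell.coord (P i).2) ++
  S.image n D.box ++ (List.ofFn fun i => Cell.word (BitVec.ofNat (w n) (D.color i))) ++
  S.image n D'.box ++ (List.ofFn fun i => Cell.word (BitVec.ofNat (w n) (D'.color i))) ++
  E.image n (rankSpace P col lo ((lo + hi) / 2)) ++
  E.image n (rankSpace P col ((lo + hi) / 2) hi) ++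
  matrixCells S X D D'

/-- `img` is a memory image of the framework: a part `aux` for the tree links and tables of
offsets, followed by the data of all internal nodes of the range tree. -/
def IsFramework (img : List (Cell (w n))) : Prop :=
  ∃ (aux : List (Cell (w n))) (D D' : ℕ × ℕ → ColoredBoxes n),
    (∀ v ∈ internalNodes 0 n,
      (D v).Decomposes P col liftTop (nodePoints P v.1 ((v.1 + v.2) / 2)) ∧
      (D' v).Decomposes P col liftBot (nodePoints P ((v.1 + v.2) / 2) v.2)) ∧
    img = aux ++ (internalNodes 0 n).flatMap fun v =>
      nodeCells P col S E X (D v) (D' v) v.1 v.2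

/-- The number of distinct colors of the points in `[a, b] × [c, d]`. -/
noncomputable def colorCount (a b c d : ℝ) : ℕ :=
  ((Finset.univ.filter fun i =>
    (a ≤ (P i).1 ∧ (P i).1 ≤ b) ∧ (c ≤ (P i).2 ∧ (P i).2 ≤ d)).image col).card

end Framework

/-- `(n δ(n) / X)² + n lg n (f(n) + h(n))` -/
noncomputable def spaceBound (δ h f : ℕ → ℝ) (n X : ℕ) : ℝ :=
  (n * δ n / X) ^ 2 + n * Real.logb 2 n * (f n + h n)

/-- `φ(n)² + X φ(n) (lg lg n + g(n) + τ(n)) + lg n` -/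
noncomputable def timeBound (φ τ g : ℕ → ℝ) (n X : ℕ) : ℝ :=
  φ n ^ 2 + X * φ n * (Real.logb 2 (Real.logb 2 n) + g n + τ n) + Real.logb 2 n

end ColoredRange

/-!
The query program searches the ranks of `c` and `d` in the sorted list of all `y`-coordinates and
descends in the range tree to the node that separates them (`exec_descend`).  All points of its left
child are below `d` and all points of its right child are above `c`, so on each side the rectangle
`[a, b] × [c, d]` acts as a three-sided range, that is, as the dominance range of
`q = (-a, b, -c)` or `q = (-a, b, d)` among the lifted points.  The boxes of one color partition the
region that the lifted points of this color dominate; hence each color in the range contributes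
exactly one box that contains `q`, and the prefixes located by the stabbing structure list the
colors in the range without repetition (`sideSpec_of_correct`).

Let `L` and `O` be the sets of colors obtained from the two children.  The answer is
`|L| + |O| - |L ∩ O|`, and `|L|` and `|O|` are sums of lengths of prefixes.  Every located prefix
consists of full blocks and of a residual of less than `X` boxes, and `L ∩ O` splits accordingly
(`count_common`):

* colors in full blocks on both sides: the sum, over the pairs of prefixes, of the entries of the
  matrix, which needs `O(φ ^ 2)` accesses;
* colors in a left residual: each of these `O(X φ)` boxes is reported, and its color is counted if
  the emptiness structure of the right child finds it in the rectangle;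
* colors in a right residual that are not in a left residual: likewise with the emptiness structure
  of the left child.  The colors in left residuals are marked in an array that cannot be initialized
  within the time bound, so every mark is verified by a pointer into the list of the marked colors
  (`exec_leftHook`, `exec_rightHook`).

The ranks of `a` and `b` that the emptiness structures need are searched once for each child.

The program is written with named variables and verified with triples `Exec` that also count steps.
It is compiled to registers from `R` on, where `R` bounds the registers that the given programs
write; so a call of a given program changes no variable (`Exec.call`, `Runs.reg_eq`).

For the space, the boxes of a color come from a sweep over its points by increasing first
coordinate: a new point adds the part of its quadrant above the staircase of the earlier ones, one
box for each step that it removes and one more.  As a point creates one step, there are at most two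
boxes for each point (`exists_boxes_of_points`).  Every box is in `O(δ)` bottom lists, so a node
with `m` points has `O(m δ / X)` full blocks on each side (`firstBlock_le`), and its matrix has
`O((m δ / X) ^ 2)` entries.  Since the product of the sizes of the two children, summed over the
tree, is at most `n ^ 2`, and the sizes on each level add up to at most `n`
(`sum_internalNodes_le`), the image has the claimed length (`length_frameworkImage_le`).
-/

namespace ColoredRange

/-! ### Registers a program cannot change -/

/-- A bound, strict, on the word registers an instruction writes. -/
def Instr.regBound : Instr → ℕ
  | .const d _ => d + 1
  | .op _ d _ _ => d + 1
  | .load d _ => d + 1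
  | .cle d _ _ => d + 1
  | _ => 0

/-- A bound, strict, on the coordinate registers an instruction writes. -/
def Instr.cregBound : Instr → ℕ
  | .cload d _ => d + 1
  | .cmove d _ => d + 1
  | .cneg d _ => d + 1
  | _ => 0

/-- A bound, strict, on all registers a program writes. -/
def Cmd.bound : Cmd → ℕ
  | .instr i => max i.regBound i.cregBound
  | .seq c d => max c.bound d.bound
  | .cond _ c d => max c.bound d.bound
  | .loop _ c => c.bound

/-- A program does not change the registers from its bound on; there a caller can keep its
variables. -/
theorem Runs.reg_eq {w : ℕ} {c : Cmd} {σ σ' : State w} {t : ℕ} (h : Runs c σ σ' t) {r : ℕ}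
    (hr : c.bound ≤ r) : σ'.reg r = σ.reg r := by
  induction h with
  | instr i σ =>
    cases i <;>
      simp_all [Cmd.bound, Instr.regBound, Instr.cregBound, Instr.step, State.setReg,
        State.setCreg, State.setMem, Function.update_apply] <;> omega
  | seq _ _ ih1 ih2 =>
    rw [ih2 (le_trans (le_max_right _ _) hr), ih1 (le_trans (le_max_left _ _) hr)]
  | cond_true _ _ ih => exact ih (le_trans (le_max_left _ _) hr)
  | cond_false _ _ ih => exact ih (le_trans (le_max_right _ _) hr)
  | loop_done _ => rfl
  | loop_step _ _ _ ih1 ih2 => rw [ih2 hr, ih1 hr]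

theorem Runs.creg_eq {w : ℕ} {c : Cmd} {σ σ' : State w} {t : ℕ} (h : Runs c σ σ' t) {r : ℕ}
    (hr : c.bound ≤ r) : σ'.creg r = σ.creg r := by
  induction h with
  | instr i σ =>
    cases i <;>
      simp_all [Cmd.bound, Instr.regBound, Instr.cregBound, Instr.step, State.setReg,
        State.setCreg, State.setMem, Function.update_apply] <;> omega
  | seq _ _ ih1 ih2 =>
    rw [ih2 (le_trans (le_max_right _ _) hr), ih1 (le_trans (le_max_left _ _) hr)]
  | cond_true _ _ ih => exact ih (le_trans (le_max_left _ _) hr)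
  | cond_false _ _ ih => exact ih (le_trans (le_max_right _ _) hr)
  | loop_done _ => rfl
  | loop_step _ _ _ ih1 ih2 => rw [ih2 hr, ih1 hr]

/-! ### Programs with named variables -/

/-- The word variables of the query program. -/
inductive Var
  | base | fp | num | blk
  | tab | len | low | high | mid
  | yl | yr | left | right | half | node | entry
  | area | nl | nr | rows | sub
  | simg | cols | eimg | x1 | x2 | y1 | y2
  | count | cur | i | plen | k | j | box | color | res
  | table | matrix | ncols
  | total | common | marked | nrows | t
  deriving DecidableEq

/-- The coordinate variables of the query program. -/
inductive CVar
  | xmin | xmax | ymin | ymax | nxmin | nymin | key | tmp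
  deriving DecidableEq

theorem Var.ctorIdx_injective : Function.Injective Var.ctorIdx :=
  Function.LeftInverse.injective (g := Var.ofNat) Var.ofNat_ctorIdx

theorem CVar.ctorIdx_injective : Function.Injective CVar.ctorIdx :=
  Function.LeftInverse.injective (g := CVar.ofNat) CVar.ofNat_ctorIdx

/-- The binary operations on numbers; `wadd` is addition modulo `2 ^ w`. -/
inductive Bin
  | add | wadd | sub | mul | div | lt | eq

/-- The word operation that implements a binary operation. -/
def Bin.op : Bin → Op
  | .add => .add
  | .wadd => .add
  | .sub => .sub
  | .mul => .mul
  | .div => .div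
  | .lt => .lt
  | .eq => .eq

/-- The values of the operations on numbers. Subtraction is truncated; `Bin.Ok` excludes the case in
which it differs from subtraction of words. -/
def Bin.eval (w : ℕ) : Bin → ℕ → ℕ → ℕ
  | .add, a, b => a + b
  | .wadd, a, b => (a + b) % 2 ^ w
  | .sub, a, b => a - b
  | .mul, a, b => a * b
  | .div, a, b => a / b
  | .lt, a, b => if a < b then 1 else 0
  | .eq, a, b => if a = b then 1 else 0

/-- The operation on words agrees with the operation on numbers. -/
def Bin.Ok (w : ℕ) : Bin → ℕ → ℕ → Prop
  | .add, a, b => a + b < 2 ^ w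
  | .sub, a, b => b ≤ a
  | .mul, a, b => a * b < 2 ^ w
  | _, _, _ => True

theorem Bin.toNat_eval {w : ℕ} [NeZero w] (o : Bin) {a b : BitVec w}
    (h : o.Ok w a.toNat b.toNat) : (o.op.eval a b).toNat = o.eval w a.toNat b.toNat := by
  have h1 : 1 % 2 ^ w = 1 := Nat.one_mod_two_pow (Nat.pos_of_ne_zero (NeZero.ne w))
  have hb := b.isLt
  cases o <;> simp only [Bin.op, Op.eval, Bin.eval, Bin.Ok] at h ⊢
  · rw [BitVec.toNat_add, Nat.mod_eq_of_lt h]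
  · rw [BitVec.toNat_add]
  · rw [BitVec.toNat_sub_of_le (by simpa [BitVec.le_def] using h)]
  · rw [BitVec.toNat_mul, Nat.mod_eq_of_lt h]
  · rw [BitVec.toNat_udiv]
  · split <;> simp [h1]
  · simp only [← BitVec.toNat_inj]; split <;> simp [h1]

/-- Expressions with numerical values: variables, constants, operations, the word in the cell of
a given address, and comparisons of coordinates. -/
inductive Expr
  | var (x : Var)
  | lit (k : ℕ)
  | bin (o : Bin) (e e' : Expr)
  | load (e : Expr)
  | cle (x y : CVar)

namespace Expr

instance : Coe Var Expr := ⟨Expr.var⟩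
instance (k : ℕ) : OfNat Expr k := ⟨Expr.lit k⟩
instance : Add Expr := ⟨Expr.bin .add⟩
instance : Sub Expr := ⟨Expr.bin .sub⟩
instance : Mul Expr := ⟨Expr.bin .mul⟩
instance : Div Expr := ⟨Expr.bin .div⟩

end Expr

/-- The values of the variables, and the memory. -/
structure Env (w : ℕ) where
  v : Var → ℕ
  c : CVar → ℝ
  m : ℕ → Cell w

namespace Expr

variable {w : ℕ}

/-- The value of an expression. -/
noncomputable def ev (s : Env w) : Expr → ℕ
  | .var x => s.v x
  | .lit k => k
  | .bin o e e' => o.eval w (e.ev s) (e'.ev s)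
  | .load e => (s.m (e.ev s)).toWord.toNat
  | .cle x y => if s.c x ≤ s.c y then 1 else 0

/-- No operation of the expression overflows. -/
def Ok (s : Env w) : Expr → Prop
  | .var _ => True
  | .lit k => k < 2 ^ w
  | .bin o e e' => e.Ok s ∧ e'.Ok s ∧ o.Ok w (e.ev s) (e'.ev s)
  | .load e => e.Ok s
  | .cle _ _ => True

/-- The number of instructions that evaluate the expression. -/
def cost : Expr → ℕ
  | .var _ => 1
  | .lit _ => 1
  | .bin _ e e' => e.cost + e'.cost + 1
  | .load e => e.cost + 1
  | .cle _ _ => 1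

variable (s : Env w) (e e' : Expr)

@[simp] theorem ev_var (x : Var) : (Expr.var x).ev s = s.v x := rfl
@[simp] theorem ev_lit (k : ℕ) : (no_index (OfNat.ofNat k) : Expr).ev s = OfNat.ofNat k := rfl
@[simp] theorem ev_zero : (0 : Expr).ev s = 0 := rfl
@[simp] theorem ev_one : (1 : Expr).ev s = 1 := rfl
@[simp] theorem ev_lit' (k : ℕ) : (Expr.lit k).ev s = k := rfl
@[simp] theorem ev_add : (e + e').ev s = e.ev s + e'.ev s := rfl
@[simp] theorem ev_sub : (e - e').ev s = e.ev s - e'.ev s := rfl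
@[simp] theorem ev_mul : (e * e').ev s = e.ev s * e'.ev s := rfl
@[simp] theorem ev_div : (e / e').ev s = e.ev s / e'.ev s := rfl
@[simp] theorem ev_wadd : (bin .wadd e e').ev s = (e.ev s + e'.ev s) % 2 ^ w := rfl
@[simp] theorem ev_lt : (bin .lt e e').ev s = if e.ev s < e'.ev s then 1 else 0 := rfl
@[simp] theorem ev_eq : (bin .eq e e').ev s = if e.ev s = e'.ev s then 1 else 0 := rfl
@[simp] theorem ev_load : (load e).ev s = (s.m (e.ev s)).toWord.toNat := rfl
@[simp] theorem ev_cle (x y : CVar) : (cle x y).ev s = if s.c x ≤ s.c y then 1 else 0 := rfl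

@[simp] theorem ok_var (x : Var) : (Expr.var x).Ok s := trivial
@[simp] theorem ok_lit (k : ℕ) :
    (no_index (OfNat.ofNat k) : Expr).Ok s ↔ OfNat.ofNat k < 2 ^ w := Iff.rfl
@[simp] theorem ok_zero : (0 : Expr).Ok s := Nat.two_pow_pos w
@[simp] theorem ok_one [NeZero w] : (1 : Expr).Ok s :=
  Nat.one_lt_two_pow (NeZero.ne w)
@[simp] theorem ok_lit' (k : ℕ) : (Expr.lit k).Ok s ↔ k < 2 ^ w := Iff.rfl
@[simp] theorem ok_add : (e + e').Ok s ↔ e.Ok s ∧ e'.Ok s ∧ e.ev s + e'.ev s < 2 ^ w := Iff.rfl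
@[simp] theorem ok_sub : (e - e').Ok s ↔ e.Ok s ∧ e'.Ok s ∧ e'.ev s ≤ e.ev s := Iff.rfl
@[simp] theorem ok_mul : (e * e').Ok s ↔ e.Ok s ∧ e'.Ok s ∧ e.ev s * e'.ev s < 2 ^ w := Iff.rfl
@[simp] theorem ok_div : (e / e').Ok s ↔ e.Ok s ∧ e'.Ok s := by
  change _ ∧ _ ∧ True ↔ _; simp
@[simp] theorem ok_wadd : (bin .wadd e e').Ok s ↔ e.Ok s ∧ e'.Ok s := by
  change _ ∧ _ ∧ True ↔ _; simp
@[simp] theorem ok_lt : (bin .lt e e').Ok s ↔ e.Ok s ∧ e'.Ok s := by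
  change _ ∧ _ ∧ True ↔ _; simp
@[simp] theorem ok_eq : (bin .eq e e').Ok s ↔ e.Ok s ∧ e'.Ok s := by
  change _ ∧ _ ∧ True ↔ _; simp
@[simp] theorem ok_load : (load e).Ok s ↔ e.Ok s := Iff.rfl
@[simp] theorem ok_cle (x y : CVar) : (cle x y).Ok s := trivial

@[simp] theorem cost_var (x : Var) : (Expr.var x).cost = 1 := rfl
@[simp] theorem cost_lit (k : ℕ) : (no_index (OfNat.ofNat k) : Expr).cost = 1 := rfl
@[simp] theorem cost_zero : (0 : Expr).cost = 1 := rfl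
@[simp] theorem cost_one : (1 : Expr).cost = 1 := rfl
@[simp] theorem cost_lit' (k : ℕ) : (Expr.lit k).cost = 1 := rfl
@[simp] theorem cost_add : (e + e').cost = e.cost + e'.cost + 1 := rfl
@[simp] theorem cost_sub : (e - e').cost = e.cost + e'.cost + 1 := rfl
@[simp] theorem cost_mul : (e * e').cost = e.cost + e'.cost + 1 := rfl
@[simp] theorem cost_div : (e / e').cost = e.cost + e'.cost + 1 := rfl
@[simp] theorem cost_bin (o : Bin) : (bin o e e').cost = e.cost + e'.cost + 1 := rfl
@[simp] theorem cost_load : (load e).cost = e.cost + 1 := rfl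
@[simp] theorem cost_cle (x y : CVar) : (cle x y).cost = 1 := rfl

end Expr

/-! ### Compilation

Variables live in registers from `R` on.  If no register from `R` on is written by a program,
then a call of this program leaves all variables unchanged. -/

/-- The register of a word variable. -/
def vreg (R : ℕ) (x : Var) : ℕ := R + 2 * x.ctorIdx

/-- The registers for intermediate results. -/
def tmpReg (R k : ℕ) : ℕ := R + 2 * k + 1

/-- The register of a coordinate variable. -/
def cvreg (R : ℕ) (x : CVar) : ℕ := R + x.ctorIdx

/-- Code that leaves the value of the expression in `tmpReg R k`, and uses only the registers
`tmpReg R k'`, `k ≤ k'`. -/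
def Expr.code (R : ℕ) : Expr → ℕ → Cmd
  | .var x, k => .instr (.op .or (tmpReg R k) (vreg R x) (vreg R x))
  | .lit v, k => .instr (.const (tmpReg R k) v)
  | .bin o e e', k => .seq (e.code R k) (.seq (e'.code R (k + 1))
      (.instr (.op o.op (tmpReg R k) (tmpReg R k) (tmpReg R (k + 1)))))
  | .load e, k => .seq (e.code R k) (.instr (.load (tmpReg R k) (tmpReg R k)))
  | .cle x y, k => .instr (.cle (tmpReg R k) (cvreg R x) (cvreg R y))

/-- The machine state `σ` holds the values given by `s`. -/
structure Rep {w : ℕ} (R : ℕ) (σ : State w) (s : Env w) : Prop where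
  v : ∀ x, (σ.reg (vreg R x)).toNat = s.v x
  c : ∀ x, σ.creg (cvreg R x) = s.c x
  m : σ.mem = s.m

theorem tmpReg_injective (R : ℕ) : Function.Injective (tmpReg R) := fun a b h => by
  unfold tmpReg at h; omega

theorem vreg_injective (R : ℕ) : Function.Injective (vreg R) := fun a b h =>
  Var.ctorIdx_injective (by unfold vreg at h; omega)

theorem cvreg_injective (R : ℕ) : Function.Injective (cvreg R) := fun a b h =>
  CVar.ctorIdx_injective (by unfold cvreg at h; omega)

theorem vreg_ne_tmpReg (R : ℕ) (x : Var) (k : ℕ) : vreg R x ≠ tmpReg R k := by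
  unfold tmpReg vreg; omega

/-- The code of an expression computes its value and changes no registers but its own temporary
ones. -/
theorem Expr.runs_code {w : ℕ} [NeZero w] {R : ℕ} {s : Env w} (e : Expr) :
    ∀ (k : ℕ) (σ : State w), Rep R σ s → e.Ok s →
    ∃ σ', Runs (e.code R k) σ σ' e.cost ∧ (σ'.reg (tmpReg R k)).toNat = e.ev s ∧
      σ'.creg = σ.creg ∧ σ'.mem = σ.mem ∧
      ∀ r, (∀ k', k ≤ k' → r ≠ tmpReg R k') → σ'.reg r = σ.reg r := by
  induction e with
  | var x =>
    intro k σ h _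
    refine ⟨_, .instr _ _, ?_, rfl, rfl, fun r hr => ?_⟩
    · simp [Instr.step, State.setReg, Op.eval, h.v, ev]
    · simp [Instr.step, State.setReg, hr k le_rfl]
  | lit v =>
    intro k σ h hv
    refine ⟨_, .instr _ _, ?_, rfl, rfl, fun r hr => ?_⟩
    · simpa [Instr.step, State.setReg, ev] using Nat.mod_eq_of_lt hv
    · simp [Instr.step, State.setReg, hr k le_rfl]
  | bin o e e' ih ih' =>
    rintro k σ h ⟨hv, hv', ho⟩
    obtain ⟨σ1, r1, e1, c1, m1, f1⟩ := ih k σ h hv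
    have h1 : Rep R σ1 s :=
      ⟨fun x => by rw [f1 _ fun k' _ => vreg_ne_tmpReg R x k', h.v], by simp [c1, h.c],
        m1.trans h.m⟩
    obtain ⟨σ2, r2, e2, c2, m2, f2⟩ := ih' (k + 1) σ1 h1 hv'
    have e3 : σ2.reg (tmpReg R k) = σ1.reg (tmpReg R k) :=
      f2 _ fun k' hk h => by have := tmpReg_injective R h; omega
    have hc : (Expr.bin o e e').cost = e.cost + (e'.cost + 1) := by simp [cost]; omega
    rw [hc]
    refine ⟨_, .seq r1 (.seq r2 (.instr _ _)), ?_, ?_, ?_, fun r hr => ?_⟩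
    · simp only [Instr.step, State.setReg, Function.update_self, e3]
      rw [Bin.toNat_eval] <;> rw [e1, e2]
      · rfl
      · exact ho
    · simp [Instr.step, State.setReg, c1, c2]
    · simp [Instr.step, State.setReg, m1, m2]
    · simp only [Instr.step, State.setReg]
      rw [Function.update_of_ne (hr k le_rfl), f2 r fun k' hk => hr k' (by omega), f1 r hr]
  | load e ih =>
    intro k σ h hv
    obtain ⟨σ1, r1, e1, c1, m1, f1⟩ := ih k σ h hv
    refine ⟨_, .seq r1 (.instr _ _), ?_, ?_, ?_, fun r hr => ?_⟩
    · simp [Instr.step, State.setReg, e1, m1, h.m, ev]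
    · simp [Instr.step, State.setReg, c1]
    · simp [Instr.step, State.setReg, m1]
    · simp only [Instr.step, State.setReg]
      rw [Function.update_of_ne (hr k le_rfl), f1 r hr]
  | cle x y =>
    intro k σ h _
    refine ⟨_, .instr _ _, ?_, rfl, rfl, fun r hr => ?_⟩
    · have h1 : 1 % 2 ^ w = 1 := Nat.one_mod_two_pow (Nat.pos_of_ne_zero (NeZero.ne w))
      simp only [Instr.step, State.setReg, h.c, ev, Function.update_self]
      split <;> simp [h1]
    · simp [Instr.step, State.setReg, hr k le_rfl]

/-- The variant of `Expr.runs_code` that keeps `Rep`. -/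
theorem Expr.runs_code_rep {w : ℕ} [NeZero w] {R : ℕ} {s : Env w} (e : Expr)
    (k : ℕ) {σ : State w} (h : Rep R σ s) (he : e.Ok s) :
    ∃ σ', Runs (e.code R k) σ σ' e.cost ∧ (σ'.reg (tmpReg R k)).toNat = e.ev s ∧
      Rep R σ' s ∧ σ'.creg = σ.creg ∧
      ∀ r, (∀ k', k ≤ k' → r ≠ tmpReg R k') → σ'.reg r = σ.reg r := by
  obtain ⟨σ1, r1, e1, c1, m1, f1⟩ := e.runs_code k σ h he
  exact ⟨σ1, r1, e1, ⟨fun x => by rw [f1 _ fun k' _ => vreg_ne_tmpReg R x k', h.v],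
    by simp [c1, h.c], m1.trans h.m⟩, c1, f1⟩

/-! ### Assignments -/

/-- Assignments to variables and to memory cells. -/
inductive Assign
  | set (x : Var) (e : Expr)
  | cload (x : CVar) (e : Expr)
  | cneg (x y : CVar)
  | cmove (x y : CVar)
  | store (e e' : Expr)

namespace Assign

variable {w : ℕ}

/-- The effect of an assignment. -/
noncomputable def run (s : Env w) : Assign → Env w
  | .set x e => { s with v := Function.update s.v x (e.ev s) }
  | .cload x e => { s with c := Function.update s.c x (s.m (e.ev s)).toCoord }
  | .cneg x y => { s with c := Function.update s.c x (-s.c y) }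
  | .cmove x y => { s with c := Function.update s.c x (s.c y) }
  | .store e e' =>
      { s with m := Function.update s.m (e.ev s) (.word (BitVec.ofNat w (e'.ev s))) }

/-- No operation in the assignment overflows. -/
def Ok (s : Env w) : Assign → Prop
  | .set _ e => e.Ok s
  | .cload _ e => e.Ok s
  | .store e e' => e.Ok s ∧ e'.Ok s
  | _ => True

def cost : Assign → ℕ
  | .set _ e => e.cost + 1
  | .cload _ e => e.cost + 1
  | .store e e' => e.cost + (e'.cost + 1)
  | _ => 1

/-- The machine code of an assignment. -/
def code (R : ℕ) : Assign → Cmd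
  | .set x e => .seq (e.code R 0) (.instr (.op .or (vreg R x) (tmpReg R 0) (tmpReg R 0)))
  | .cload x e => .seq (e.code R 0) (.instr (.cload (cvreg R x) (tmpReg R 0)))
  | .cneg x y => .instr (.cneg (cvreg R x) (cvreg R y))
  | .cmove x y => .instr (.cmove (cvreg R x) (cvreg R y))
  | .store e e' => .seq (e.code R 0) (.seq (e'.code R 1)
      (.instr (.store (tmpReg R 0) (tmpReg R 1))))

theorem runs_code [NeZero w] {R : ℕ} {s : Env w} {σ : State w} (h : Rep R σ s) (a : Assign)
    (ha : a.Ok s) : ∃ σ', Runs (a.code R) σ σ' a.cost ∧ Rep R σ' (a.run s) := by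
  cases a with
  | set x e =>
    obtain ⟨σ1, r1, e1, h1, c1, f1⟩ := e.runs_code_rep 0 h ha
    refine ⟨_, .seq r1 (.instr _ _), fun y => ?_, h1.c, h1.m⟩
    simp only [Instr.step, State.setReg, Op.eval, BitVec.or_self, Function.update_apply,
      (vreg_injective R).eq_iff, run]
    split
    · exact e1
    · exact h1.v y
  | cload x e =>
    obtain ⟨σ1, r1, e1, h1, c1, f1⟩ := e.runs_code_rep 0 h ha
    refine ⟨_, .seq r1 (.instr _ _), h1.v, fun y => ?_, h1.m⟩
    simp only [Instr.step, State.setCreg, Function.update_apply,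
      (cvreg_injective R).eq_iff, run, e1, h1.m, h1.c]
  | cneg x z =>
    refine ⟨_, .instr _ _, h.v, fun y => ?_, h.m⟩
    simp only [Instr.step, State.setCreg, Function.update_apply,
      (cvreg_injective R).eq_iff, run, h.c]
  | cmove x z =>
    refine ⟨_, .instr _ _, h.v, fun y => ?_, h.m⟩
    simp only [Instr.step, State.setCreg, Function.update_apply,
      (cvreg_injective R).eq_iff, run, h.c]
  | store e e' =>
    obtain ⟨σ1, r1, e1, h1, c1, f1⟩ := e.runs_code_rep 0 h ha.1
    obtain ⟨σ2, r2, e2, h2, c2, f2⟩ := e'.runs_code_rep 1 h1 ha.2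
    refine ⟨_, .seq r1 (.seq r2 (.instr _ _)), h2.v, h2.c, ?_⟩
    have e3 : σ2.reg (tmpReg R 0) = σ1.reg (tmpReg R 0) :=
      f2 _ fun k' hk h => by have := tmpReg_injective R h; omega
    simp only [Instr.step, State.setMem, run, h2.m, e3, e1]
    rw [← e2, BitVec.ofNat_toNat, BitVec.setWidth_eq]

end Assign

/-- A sequence of assignments. -/
abbrev Block := List Assign

namespace Block

variable {w : ℕ}

noncomputable def run (s : Env w) : Block → Env w
  | [] => s
  | a :: l => run (a.run s) l

def Ok (s : Env w) : Block → Prop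
  | [] => True
  | a :: l => a.Ok s ∧ Ok (a.run s) l

def cost : Block → ℕ
  | [] => 1
  | a :: l => a.cost + cost l

def code (R : ℕ) : Block → Cmd
  | [] => .instr (.const (tmpReg R 0) 0)
  | a :: l => .seq (a.code R) (code R l)

theorem runs_code [NeZero w] {R : ℕ} (l : Block) {s : Env w} {σ : State w} (h : Rep R σ s)
    (hl : Ok s l) : ∃ σ', Runs (code R l) σ σ' (cost l) ∧ Rep R σ' (run s l) := by
  induction l generalizing s σ with
  | nil =>
    refine ⟨_, .instr _ _, fun x => ?_, h.c, h.m⟩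
    simp only [Instr.step, State.setReg]
    rw [Function.update_of_ne (vreg_ne_tmpReg R x 0)]
    exact h.v x
  | cons a l ih =>
    obtain ⟨σ1, r1, h1⟩ := a.runs_code h hl.1
    obtain ⟨σ2, r2, h2⟩ := ih h1 hl.2
    exact ⟨σ2, .seq r1 r2, h2⟩

end Block

/-! ### A program logic -/

/-- In every machine state that represents `s`, the program halts within `t` steps, in a state
that represents an environment with the property `Q`. -/
def Exec {w : ℕ} (R : ℕ) (c : Cmd) (s : Env w) (t : ℕ) (Q : Env w → Prop) : Prop :=
  ∀ σ : State w, Rep R σ s → ∃ (σ' : State w) (s' : Env w) (t' : ℕ),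
    Runs c σ σ' t' ∧ t' ≤ t ∧ Rep R σ' s' ∧ Q s'

/-- `if e ≠ 0 then c else d` -/
def ifNonzero (R : ℕ) (e : Expr) (c d : Cmd) : Cmd :=
  .seq (e.code R 0) (.cond (tmpReg R 0) c d)

/-- `while e ≠ 0 do c` -/
def whileNonzero (R : ℕ) (e : Expr) (c : Cmd) : Cmd :=
  .seq (e.code R 0) (.loop (tmpReg R 0) (.seq c (e.code R 0)))

namespace Exec

variable {w : ℕ} {R : ℕ} {c d : Cmd} {s : Env w} {t t' : ℕ} {Q Q' : Env w → Prop}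

theorem mono (h : Exec R c s t Q) (ht : t ≤ t') (hQ : ∀ s', Q s' → Q' s') :
    Exec R c s t' Q' := fun σ hσ =>
  let ⟨σ', s', u, hr, hu, hs, hq⟩ := h σ hσ
  ⟨σ', s', u, hr, hu.trans ht, hs, hQ _ hq⟩

theorem seq (h : Exec R c s t fun s' => Exec R d s' t' Q) :
    Exec R (.seq c d) s (t + t') Q := fun σ hσ => by
  obtain ⟨σ1, s1, u1, hr1, hu1, hs1, hq1⟩ := h σ hσ
  obtain ⟨σ2, s2, u2, hr2, hu2, hs2, hq2⟩ := hq1 σ1 hs1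
  exact ⟨σ2, s2, _, .seq hr1 hr2, by omega, hs2, hq2⟩

/-- Sequential composition, with the time of the second program given in advance. -/
theorem seq_le (t₂ : ℕ) {t₁ : ℕ} (h : Exec R c s t₁ fun s' => Exec R d s' t₂ Q)
    (ht : t₁ + t₂ ≤ t) : Exec R (.seq c d) s t Q :=
  (Exec.seq h).mono ht fun _ => id

/-- Sequential composition, with a property `Q₁` of the intermediate states. -/
theorem seq_of (t₂ : ℕ) {t₁ : ℕ} {Q₁ : Env w → Prop} (h : Exec R c s t₁ Q₁)
    (ht : t₁ + t₂ ≤ t) (hd : ∀ s', Q₁ s' → Exec R d s' t₂ Q) : Exec R (.seq c d) s t Q :=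
  Exec.seq_le t₂ (h.mono le_rfl hd) ht

theorem block [NeZero w] {l : Block} (hl : Block.Ok s l) (hQ : Q (Block.run s l)) :
    Exec R (Block.code R l) s (Block.cost l) Q := fun _ hσ =>
  let ⟨σ', hr, hs⟩ := Block.runs_code l hσ hl
  ⟨σ', _, _, hr, le_rfl, hs, hQ⟩

theorem ite [NeZero w] {e : Expr} (he : e.Ok s) (h1 : e.ev s ≠ 0 → Exec R c s t Q)
    (h0 : e.ev s = 0 → Exec R d s t' Q) :
    Exec R (ifNonzero R e c d) s (e.cost + (max t t' + 1)) Q := fun σ hσ => by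
  obtain ⟨σ1, r1, e1, hs1, -⟩ := e.runs_code_rep 0 hσ he
  by_cases h : e.ev s = 0
  · obtain ⟨σ2, s2, u2, hr2, hu2, hs2, hq2⟩ := h0 h σ1 hs1
    refine ⟨σ2, s2, _, .seq r1 (.cond_false ?_ hr2), by omega, hs2, hq2⟩
    exact BitVec.eq_of_toNat_eq (by simpa [h] using e1)
  · obtain ⟨σ2, s2, u2, hr2, hu2, hs2, hq2⟩ := h1 h σ1 hs1
    refine ⟨σ2, s2, _, .seq r1 (.cond_true ?_ hr2), by omega, hs2, hq2⟩
    intro h'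
    exact h (by rw [← e1, h']; simp)

/-- A loop with invariant `I`, whose argument bounds the number of the remaining iterations. -/
theorem loop [NeZero w] {e : Expr} (I : ℕ → Env w → Prop) (he : ∀ k s, I k s → e.Ok s)
    (hb : ∀ k s, I k s → e.ev s ≠ 0 → ∃ k', k = k' + 1 ∧ Exec R c s t (I k'))
    (hQ : ∀ k s, I k s → e.ev s = 0 → Q s) {k : ℕ} (hI : I k s) :
    Exec R (whileNonzero R e c) s (k * (t + e.cost + 1) + (e.cost + 1)) Q := by
  intro σ hσ
  obtain ⟨σ1, r1, e1, hs1, -⟩ := e.runs_code_rep 0 hσ (he k s hI)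
  -- The guard is evaluated before the loop and again at the end of each iteration.
  suffices H : ∀ (k : ℕ) (s : Env w) (σ1 : State w), I k s → Rep R σ1 s →
      (σ1.reg (tmpReg R 0)).toNat = e.ev s →
      ∃ (σ' : State w) (s' : Env w) (t' : ℕ),
        Runs (.loop (tmpReg R 0) (.seq c (e.code R 0))) σ1 σ' t' ∧
        t' ≤ k * (t + e.cost + 1) + 1 ∧ Rep R σ' s' ∧ Q s' by
    obtain ⟨σ', s', u, hr, hu, hs, hq⟩ := H k s σ1 hI hs1 e1
    exact ⟨σ', s', _, .seq r1 hr, by omega, hs, hq⟩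
  intro k
  induction k with
  | zero =>
    intro s σ hI hs h
    by_cases h0 : e.ev s = 0
    · exact ⟨σ, s, 1, .loop_done (BitVec.eq_of_toNat_eq (by simpa [h0] using h)), by omega, hs,
        hQ _ s hI h0⟩
    · obtain ⟨k', hk, -⟩ := hb _ s hI h0
      omega
  | succ k ih =>
    intro s σ hI hs h
    by_cases h0 : e.ev s = 0
    · exact ⟨σ, s, 1, .loop_done (BitVec.eq_of_toNat_eq (by simpa [h0] using h)), by omega, hs,
        hQ _ s hI h0⟩
    · obtain ⟨k', hk, hx⟩ := hb _ s hI h0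
      obtain rfl : k = k' := by omega
      obtain ⟨σ2, s2, u2, hr2, hu2, hs2, hq2⟩ := hx σ hs
      obtain ⟨σ3, r3, e3, hs3, -⟩ := e.runs_code_rep 0 hs2 (he k s2 hq2)
      obtain ⟨σ', s', u, hr, hu, hs', hq⟩ := ih s2 σ3 hq2 hs3 e3
      refine ⟨σ', s', _, .loop_step ?_ (.seq hr2 r3) hr, ?_, hs', hq⟩
      · intro h'
        exact h0 (by rw [← h, h']; simp)
      · rw [Nat.succ_mul]; omega

end Exec

attribute [simp] Block.run Block.Ok Assign.run Assign.Ok Block.cost Assign.cost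

/-! ### Subroutine calls -/

/-- Code that puts the values of expressions into the registers `k, k + 1, …`. -/
def setArgs (R : ℕ) : List Expr → ℕ → Cmd
  | [], _ => .instr (.const (tmpReg R 0) 0)
  | e :: l, k => .seq (.seq (e.code R 0) (.instr (.op .or k (tmpReg R 0) (tmpReg R 0))))
      (setArgs R l (k + 1))

/-- Code that puts coordinates into the coordinate registers `k, k + 1, …`. -/
def setCArgs (R : ℕ) : List CVar → ℕ → Cmd
  | [], _ => .instr (.const (tmpReg R 0) 0)
  | x :: l, k => .seq (.instr (.cmove k (cvreg R x))) (setCArgs R l (k + 1))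

/-- Calls `c` with the structure at the address `e`, the work space at the address `e'`, and the
given arguments; the result goes to the variable `x`. -/
def call (R : ℕ) (c : Cmd) (e e' : Expr) (args : List Expr) (cargs : List CVar) (x : Var) : Cmd :=
  .seq (setArgs R (e :: e' :: args) 0) (.seq (setCArgs R cargs 0) (.seq c
    (.instr (.op .or (vreg R x) 0 0))))

/-- The time for passing arguments to a subroutine. -/
def callCost (args : List Expr) (cargs : List CVar) : ℕ :=
  (args.map fun e => e.cost + 1).sum + cargs.length + 3

theorem runs_setArgs {w : ℕ} [NeZero w] {R : ℕ} {s : Env w} (l : List Expr) (k : ℕ) (σ : State w)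
    (h : Rep R σ s) (hl : ∀ e ∈ l, e.Ok s) (hk : k + l.length ≤ R) :
    ∃ σ', Runs (setArgs R l k) σ σ' ((l.map fun e => e.cost + 1).sum + 1) ∧
      Rep R σ' s ∧ σ'.creg = σ.creg ∧
      (∀ r, r < k → σ'.reg r = σ.reg r) ∧
      ∀ (i : ℕ) (hi : i < l.length), (σ'.reg (k + i)).toNat = l[i].ev s := by
  induction l generalizing k σ with
  | nil =>
    refine ⟨_, .instr _ _, ⟨fun x => ?_, h.c, h.m⟩, rfl, fun r hr => ?_, by simp⟩
    · simp only [Instr.step, State.setReg]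
      rw [Function.update_of_ne (vreg_ne_tmpReg R x 0)]
      exact h.v x
    · simp only [Instr.step, State.setReg]
      rw [Function.update_of_ne]
      simp at hk
      unfold tmpReg; omega
  | cons e l ih =>
    simp only [List.length_cons] at hk
    obtain ⟨σ1, r1, e1, h1, c1, f1⟩ := e.runs_code_rep 0 h (hl e (by simp))
    have h2 : Rep R ((Instr.op .or k (tmpReg R 0) (tmpReg R 0)).step σ1) s := by
      refine ⟨fun x => ?_, h1.c, h1.m⟩
      simp only [Instr.step, State.setReg]
      rw [Function.update_of_ne, h1.v]
      unfold vreg; omega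
    obtain ⟨σ3, r3, h3, c3, f3, e3⟩ := ih (k + 1) _ h2
      (fun e he => hl e (by simp [he])) (by omega)
    have ht : (List.map (fun e => e.cost + 1) (e :: l)).sum + 1
        = (e.cost + 1) + ((List.map (fun e => e.cost + 1) l).sum + 1) := by
      simp; omega
    rw [ht]
    refine ⟨σ3, .seq (.seq r1 (.instr _ _)) r3, h3, by rw [c3]; exact c1, fun r hr => ?_,
      fun i hi => ?_⟩
    · rw [f3 r (by omega)]
      simp only [Instr.step, State.setReg]
      rw [Function.update_of_ne (by omega), f1]
      intro k' _
      unfold tmpReg; omega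
    · cases i with
      | zero =>
        rw [f3 _ (by omega)]
        simp [Instr.step, State.setReg, Op.eval, e1]
      | succ i =>
        rw [show k + (i + 1) = k + 1 + i by omega, e3 i (by simpa using hi)]
        simp

theorem runs_setCArgs {w : ℕ} {R : ℕ} {s : Env w} (l : List CVar) (k : ℕ) (σ : State w)
    (h : Rep R σ s) (hk : k + l.length ≤ R) :
    ∃ σ', Runs (setCArgs R l k) σ σ' (l.length + 1) ∧
      Rep R σ' s ∧ (∀ r, r < R → σ'.reg r = σ.reg r) ∧
      (∀ r, r < k → σ'.creg r = σ.creg r) ∧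
      ∀ (i : ℕ) (hi : i < l.length), σ'.creg (k + i) = s.c l[i] := by
  induction l generalizing k σ with
  | nil =>
    refine ⟨_, .instr _ _, ⟨fun x => ?_, h.c, h.m⟩, fun r hr => ?_, fun r hr => rfl, by simp⟩
    · simp only [Instr.step, State.setReg]
      rw [Function.update_of_ne (vreg_ne_tmpReg R x 0)]
      exact h.v x
    · simp only [Instr.step, State.setReg]
      rw [Function.update_of_ne]
      unfold tmpReg; omega
  | cons x l ih =>
    simp only [List.length_cons] at hk
    have h2 : Rep R ((Instr.cmove k (cvreg R x)).step σ) s := by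
      refine ⟨h.v, fun x => ?_, h.m⟩
      simp only [Instr.step, State.setCreg]
      rw [Function.update_of_ne, h.c]
      unfold cvreg; omega
    obtain ⟨σ3, r3, h3, g3, f3, e3⟩ := ih (k + 1) _ h2 (by omega)
    rw [show (x :: l).length + 1 = 1 + (l.length + 1) by simp; omega]
    refine ⟨σ3, .seq (.instr _ _) r3, h3, fun r hr => by rw [g3 r hr]; rfl, fun r hr => ?_,
      fun i hi => ?_⟩
    · rw [f3 r (by omega)]
      simp only [Instr.step, State.setCreg]
      rw [Function.update_of_ne (by omega)]
    · cases i with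
      | zero =>
        rw [f3 _ (by omega)]
        simp [Instr.step, State.setCreg, h.c]
      | succ i =>
        rw [show k + (i + 1) = k + 1 + i by omega, e3 i (by simpa using hi)]
        simp

/-- The rule for calls: the variables keep their values, as the subroutine does not know their
registers, and the memory changes within the work space only. -/
theorem Exec.call {w : ℕ} [NeZero w] {R : ℕ} {c : Cmd} {s : Env w} {e e' : Expr}
    {args : List Expr} {cargs : List CVar} {x : Var} {img : List (Cell w)}
    {wargs : List (BitVec w)} {cs : List ℝ} {scratch time : ℝ} {post : ℕ → State w → Prop}
    {Sc T : ℕ} {Q : Env w → Prop}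
    (hc : Answers c img wargs cs scratch time post)
    (hR : c.bound ≤ R) (hargs : args.length + 2 ≤ R) (hcargs : cargs.length ≤ R)
    (he : e.Ok s) (he' : e'.Ok s) (ha : ∀ e ∈ args, e.Ok s)
    (hw : wargs.map BitVec.toNat = args.map (Expr.ev s)) (hcs : cs = cargs.map s.c)
    (himg : StoredAt s.m (e.ev s) img) (hbelow : e.ev s + img.length ≤ e'.ev s)
    (hscratch : scratch ≤ Sc) (hfits : e'.ev s + Sc ≤ 2 ^ w) (hT : ⌊time⌋₊ ≤ T)
    (hQ : ∀ σ' : State w, post (e'.ev s) σ' →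
      (∀ a, a < e'.ev s ∨ e'.ev s + Sc ≤ a → σ'.mem a = s.m a) →
      Q ⟨Function.update s.v x (σ'.reg 0).toNat, s.c, σ'.mem⟩) :
    Exec R (call R c e e' args cargs x) s (T + (e.cost + e'.cost + 3 + callCost args cargs)) Q := by
  intro σ hσ
  obtain ⟨σ1, r1, h1, c1, -, a1⟩ := runs_setArgs (e :: e' :: args) 0 σ hσ
    (by simp only [List.mem_cons]; rintro _ (rfl | rfl | h); exacts [he, he', ha _ h])
    (by simp; omega)
  obtain ⟨σ2, r2, h2, g2, -, a2⟩ := runs_setCArgs cargs 0 σ1 h1 (by omega)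
  have hb0 := a1 0 (by simp)
  have hb1 := a1 1 (by simp)
  simp only [List.getElem_cons_zero, List.getElem_cons_succ, Nat.add_zero, Nat.zero_add]
    at hb0 hb1
  have hwl : wargs.length = args.length := by simpa using congrArg List.length hw
  have hready : Ready σ2 (e.ev s) (e'.ev s) img wargs cs scratch := by
    refine ⟨by rw [g2 _ (by omega), hb0], by rw [g2 _ (by omega), hb1], fun i hi => ?_,
      fun i hi => ?_, by rw [h2.m]; exact himg, hbelow, ?_⟩
    · rw [g2 _ (by omega)]
      apply BitVec.eq_of_toNat_eq
      have := a1 (i + 2) (by simp; omega)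
      simp only [List.getElem_cons_succ, Nat.zero_add] at this
      rw [Nat.add_comm, this]
      have h3 := congrArg (fun l => l[i]?) hw
      simp only [List.getElem?_map, List.getElem?_eq_getElem hi,
        List.getElem?_eq_getElem (hwl ▸ hi), Option.map_some, Option.some.injEq] at h3
      exact h3.symm
    · subst hcs
      have := a2 i (by simpa using hi)
      simpa using this
    · calc (e'.ev s : ℝ) + scratch ≤ e'.ev s + Sc := by gcongr
        _ ≤ 2 ^ w := by exact_mod_cast hfits
  obtain ⟨σ3, t3, r3, ht3, m3, p3⟩ := hc σ2 _ _ hready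
  have ht3' : t3 ≤ T := (Nat.le_floor ht3).trans hT
  have hm : ∀ a, a < e'.ev s ∨ e'.ev s + Sc ≤ a → σ3.mem a = s.m a := by
    intro a h
    rw [m3 a, h2.m]
    rcases h with h | h
    · exact Or.inl h
    · right
      calc (e'.ev s : ℝ) + scratch ≤ e'.ev s + Sc := by gcongr
        _ ≤ a := by exact_mod_cast h
  refine ⟨_, _, _, .seq r1 (.seq r2 (.seq r3 (.instr _ _))), ?_, ⟨fun y => ?_, fun y => ?_, ?_⟩,
    hQ σ3 p3 hm⟩
  · simp only [List.map_cons, List.sum_cons, callCost]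
    omega
  · simp only [Instr.step, State.setReg, Op.eval, BitVec.or_self, Function.update_apply,
      (vreg_injective R).eq_iff]
    split
    · rfl
    · rw [r3.reg_eq (hR.trans (by unfold vreg; omega)), h2.v]
  · change σ3.creg _ = _
    rw [r3.creg_eq (hR.trans (by unfold cvreg; omega)), h2.c]
  · rfl

/-! ### Stored lists -/

theorem StoredAt.append_iff {w : ℕ} {m : ℕ → Cell w} {a : ℕ} {L L' : List (Cell w)} :
    StoredAt m a (L ++ L') ↔ StoredAt m a L ∧ StoredAt m (a + L.length) L' := by
  constructor
  · refine fun h => ⟨fun i hi => ?_, fun i hi => ?_⟩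
    · rw [h i (by simp; omega), List.getElem_append_left hi]
    · rw [Nat.add_assoc, h (L.length + i) (by simp; omega), List.getElem_append_right (by omega)]
      simp
  · rintro ⟨h, h'⟩ i hi
    by_cases hl : i < L.length
    · rw [h i hl, List.getElem_append_left hl]
    · rw [List.getElem_append_right (by omega), ← h' (i - L.length) (by simp at hi; omega)]
      congr 1; omega

theorem StoredAt.flatMap {w : ℕ} {m : ℕ → Cell w} {α : Type*} {l : List α}
    {f : α → List (Cell w)} {a : ℕ} (h : StoredAt m a (l.flatMap f)) {k : ℕ} {x : α}
    (hk : l[k]? = some x) : StoredAt m (a + ((l.take k).flatMap f).length) (f x) := by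
  obtain ⟨hk, rfl⟩ := List.getElem?_eq_some_iff.1 hk
  have : l = l.take k ++ l[k] :: l.drop (k + 1) := by simp
  rw [this, List.flatMap_append, List.flatMap_cons, append_iff, append_iff] at h
  exact h.2.1

theorem StoredAt.congr {w : ℕ} {m m' : ℕ → Cell w} {a : ℕ} {L : List (Cell w)}
    (h : StoredAt m a L) (hm : ∀ i, i < L.length → m' (a + i) = m (a + i)) : StoredAt m' a L :=
  fun i hi => by rw [hm i hi, h i hi]

theorem StoredAt.get {w : ℕ} {m : ℕ → Cell w} {a : ℕ} {L : List (Cell w)} (h : StoredAt m a L)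
    {i : ℕ} {u : Cell w} (hi : L[i]? = some u) : m (a + i) = u := by
  obtain ⟨hi', rfl⟩ := List.getElem?_eq_some_iff.1 hi
  exact h i hi'

/-! ### Binary search -/

section Search

open Var CVar

/-- `x < k` or `x ≤ k` -/
def Below (strict : Bool) (k x : ℝ) : Prop :=
  if strict then x < k else x ≤ k

theorem Below.mono {strict : Bool} {k x y : ℝ} (h : Below strict k y) (hxy : x ≤ y) :
    Below strict k x := by
  cases strict
  · exact hxy.trans h
  · exact lt_of_le_of_lt hxy h

/-- The test whether `tmp` is below `key`. -/
def belowTest (strict : Bool) : Expr :=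
  if strict then .bin .eq (.cle key tmp) 0 else .cle tmp key

theorem belowTest_ok {w : ℕ} (strict : Bool) (s : Env w) : (belowTest strict).Ok s := by
  cases strict <;> simp [belowTest]

theorem belowTest_ev {w : ℕ} (strict : Bool) (s : Env w) :
    (belowTest strict).ev s ≠ 0 ↔ Below strict (s.c key) (s.c tmp) := by
  cases strict <;> simp [belowTest, Below]

theorem belowTest_cost (strict : Bool) : (belowTest strict).cost ≤ 3 := by
  cases strict <;> simp [belowTest]

/-- Binary search in the sorted list of length `len` at the address `tab`; leaves the number of
elements below `key` in `low`. -/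
def search (R : ℕ) (strict : Bool) : Cmd :=
  .seq (Block.code R [.set low 0, .set high len])
    (whileNonzero R (.bin .lt low high)
      (.seq (Block.code R [.set mid ((low + high) / 2), .cload tmp (tab + mid)])
        (ifNonzero R (belowTest strict)
          (Block.code R [.set low (mid + 1)])
          (Block.code R [.set high mid]))))

/-- Binary search: before each of the at most `t` rounds, the positions before `low` are known to be
below `key`, those from `high` on are known not to be, and `high - low` is below a power of two that
is halved in the round. -/
theorem exec_search {w : ℕ} [NeZero w] {R : ℕ} {strict : Bool} {s : Env w} {L : List ℝ}
    (hL : L.Pairwise (· ≤ ·)) (hst : StoredAt s.m (s.v tab) (L.map Cell.coord))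
    (hlen : s.v len = L.length) (h1 : s.v tab + L.length < 2 ^ w) (h2 : 2 * L.length < 2 ^ w)
    {t : ℕ} (ht : L.length < 2 ^ t) :
    Exec R (search R strict) s (t * 27 + 10) fun s' =>
      s'.m = s.m ∧ (∀ x, x ∉ [low, high, mid] → s'.v x = s.v x) ∧
      (∀ x, x ≠ tmp → s'.c x = s.c x) ∧ s'.v low ≤ L.length ∧
      ∀ (i : ℕ) (x : ℝ), L[i]? = some x → (Below strict (s.c key) x ↔ i < s'.v low) := by
  have hmono : ∀ (i j : ℕ) (x y : ℝ), L[i]? = some x → L[j]? = some y → i ≤ j → x ≤ y := by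
    intro i j x y hi hj hij
    obtain ⟨hi, rfl⟩ := List.getElem?_eq_some_iff.1 hi
    obtain ⟨hj, rfl⟩ := List.getElem?_eq_some_iff.1 hj
    rcases hij.eq_or_lt with rfl | hij
    · rfl
    · exact List.pairwise_iff_getElem.1 hL _ _ _ _ hij
  refine Exec.mono (Exec.seq (Exec.block ?_ (Exec.loop (t := 23) (fun k s' =>
    s'.m = s.m ∧ (∀ x, x ∉ [low, high, mid] → s'.v x = s.v x) ∧
    (∀ x, x ≠ tmp → s'.c x = s.c x) ∧ s'.v low ≤ s'.v high ∧ s'.v high ≤ L.length ∧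
    s'.v high - s'.v low < 2 ^ k ∧
    (∀ (i : ℕ) (x : ℝ), L[i]? = some x → i < s'.v low → Below strict (s.c key) x) ∧
    ∀ (i : ℕ) (x : ℝ), L[i]? = some x → s'.v high ≤ i → ¬ Below strict (s.c key) x)
    ?_ ?_ ?_ (k := t) ?_))) ?_ (fun s' h => h)
  · simp
  · simp
  · rintro k s' ⟨hm, hv, hc, hlh, hhl, hk, hlo, hhi⟩ h
    have hlt : s'.v low < s'.v high := by
      by_contra hn
      simp [hn] at h
    obtain ⟨k, rfl⟩ : ∃ k', k = k' + 1 := by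
      cases k with
      | zero => simp at hk; omega
      | succ k => exact ⟨k, rfl⟩
    refine ⟨k, rfl, ?_⟩
    rw [pow_succ] at hk
    have htab := hv tab (by simp)
    have hmid : (s'.v low + s'.v high) / 2 < L.length := by omega
    have hget := List.getElem?_eq_getElem hmid
    have hcell : s'.m (s'.v tab + (s'.v low + s'.v high) / 2)
        = .coord (L[(s'.v low + s'.v high) / 2]) := by
      rw [hm, htab]
      exact hst.get (by rw [List.getElem?_map, hget]; rfl)
    refine Exec.mono (Exec.seq (Exec.block ?_ (Exec.ite (belowTest_ok _ _)
      (fun hb => Exec.block ?_ ?_) (fun hb => Exec.block ?_ ?_)))) ?_ (fun s' h => h)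
    · simp; omega
    · simp [NeZero.ne w]; omega
    · rw [belowTest_ev] at hb
      simp only [Block.run, Assign.run, Expr.ev_div, Expr.ev_add, Expr.ev_var, Expr.ev_lit,
        Function.update_self, ne_eq, reduceCtorEq, not_false_eq_true, Function.update_of_ne,
        hcell, Cell.toCoord] at hb
      rw [hc _ (by simp)] at hb
      refine ⟨hm, fun x hx => ?_, fun x hx => ?_, ?_, ?_, ?_, ?_, ?_⟩
      · simp only [List.mem_cons, List.not_mem_nil, or_false, not_or] at hx
        simp [hx, hv]
      · simp [hx, hc]
      · simp; omega
      · simp; omega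
      · simp; omega
      · intro i x hi hlt
        simp only [Block.run, Assign.run, Expr.ev_add, Expr.ev_var, Function.update_self,
          Expr.ev_div, Expr.ev_lit] at hlt
        exact hb.mono (hmono _ _ _ _ hi hget (by omega))
      · intro i x hi hle
        exact hhi i x hi (by simpa using hle)
    · simp
    · have hb : ¬ _ := fun h => ((belowTest_ev _ _).2 h) hb
      simp only [Block.run, Assign.run, Expr.ev_div, Expr.ev_add, Expr.ev_var, Expr.ev_lit,
        Function.update_self, ne_eq, reduceCtorEq, not_false_eq_true, Function.update_of_ne,
        hcell, Cell.toCoord] at hb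
      rw [hc _ (by simp)] at hb
      refine ⟨hm, fun x hx => ?_, fun x hx => ?_, ?_, ?_, ?_, ?_, ?_⟩
      · simp only [List.mem_cons, List.not_mem_nil, or_false, not_or] at hx
        simp [hx, hv]
      · simp [hx, hc]
      · simp; omega
      · simp; omega
      · simp; omega
      · intro i x hi hlt
        exact hlo i x hi (by simpa using hlt)
      · intro i x hi hle
        simp only [Block.run, Assign.run, Expr.ev_add, Expr.ev_var, Function.update_self,
          Expr.ev_div, Expr.ev_lit] at hle
        exact fun h => hb (h.mono (hmono _ _ _ _ hget hi (by omega)))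
    · have := belowTest_cost strict
      simp
      omega
  · rintro k s' ⟨hm, hv, hc, hlh, hhl, hk, hlo, hhi⟩ h
    have hlt : s'.v low = s'.v high := by
      by_contra hn
      have : s'.v low < s'.v high := by omega
      simp [this] at h
    refine ⟨hm, hv, hc, by omega, fun i x hi => ⟨fun h => ?_, hlo i x hi⟩⟩
    by_contra hn
    exact hhi i x hi (by omega) h
  · refine ⟨rfl, fun x hx => ?_, fun x hx => rfl, ?_, ?_, ?_, ?_, ?_⟩
    · simp only [List.mem_cons, List.not_mem_nil, or_false, not_or] at hx
      simp [hx]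
    · simp
    · simp [hlen]
    · simpa [hlen] using ht
    · simp
    · intro i x hi hle
      have := (List.getElem?_eq_some_iff.1 hi).1
      simp [hlen] at hle
      omega
  · simp; omega

end Search

/-! ### The range tree -/

theorem internalNodes_eq {lo hi : ℕ} (h : 2 ≤ hi - lo) :
    internalNodes lo hi =
      (lo, hi) :: (internalNodes lo ((lo + hi) / 2) ++ internalNodes ((lo + hi) / 2) hi) := by
  rw [internalNodes, if_pos h]

theorem internalNodes_eq_nil {lo hi : ℕ} (h : ¬ 2 ≤ hi - lo) : internalNodes lo hi = [] := by
  rw [internalNodes, if_neg h]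

theorem length_internalNodes (lo hi : ℕ) : (internalNodes lo hi).length = hi - lo - 1 := by
  induction lo, hi using internalNodes.induct with
  | case1 lo hi h ih1 ih2 =>
    rw [internalNodes_eq h, List.length_cons, List.length_append, ih1, ih2]
    omega
  | case2 lo hi h =>
    rw [internalNodes_eq_nil h, List.length_nil]
    omega

theorem mem_internalNodes {lo hi : ℕ} {v : ℕ × ℕ} (h : v ∈ internalNodes lo hi) :
    lo ≤ v.1 ∧ v.1 + 2 ≤ v.2 ∧ v.2 ≤ hi := by
  induction lo, hi using internalNodes.induct with
  | case1 lo hi h2 ih1 ih2 =>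
    rw [internalNodes_eq h2, List.mem_cons, List.mem_append] at h
    rcases h with rfl | h | h
    · simp; omega
    · have := ih1 h; omega
    · have := ih2 h; omega
  | case2 lo hi h2 =>
    rw [internalNodes_eq_nil h2] at h
    simp at h

/-- In preorder, the nodes of the left subtree follow the root. -/
theorem getElem?_internalNodes_left {lo hi j : ℕ} (h : 2 ≤ hi - lo)
    (hj : j < (lo + hi) / 2 - lo - 1) :
    (internalNodes lo hi)[j + 1]? = (internalNodes lo ((lo + hi) / 2))[j]? := by
  rw [internalNodes_eq h, List.getElem?_cons_succ, List.getElem?_append_left]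
  rwa [length_internalNodes]

/-- In preorder, the nodes of the right subtree follow the root and the left subtree. -/
theorem getElem?_internalNodes_right {lo hi j : ℕ} (h : 2 ≤ hi - lo) :
    (internalNodes lo hi)[j + ((lo + hi) / 2 - lo)]? =
      (internalNodes ((lo + hi) / 2) hi)[j]? := by
  rw [internalNodes_eq h, show j + ((lo + hi) / 2 - lo) = (j + ((lo + hi) / 2 - lo - 1)) + 1 by
    omega, List.getElem?_cons_succ, List.getElem?_append_right] <;> rw [length_internalNodes]
  · congr 1; omega
  · omega

/-- A sum over the internal nodes `[lo, hi)` of a tree of depth at most `t`. -/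
theorem sum_internalNodes_le {lo hi t : ℕ} (h : hi - lo ≤ 2 ^ t) (A B : ℝ) (hA : 0 ≤ A)
    (hB : 0 ≤ B) :
    ((internalNodes lo hi).map fun v => A * ((v.2 - v.1 : ℕ) : ℝ) +
      B * (((v.1 + v.2) / 2 - v.1 : ℕ) * ((v.2 - (v.1 + v.2) / 2 : ℕ) : ℝ))).sum ≤
      A * ((hi - lo : ℕ) * t) + B * ((hi - lo : ℕ) : ℝ) ^ 2 := by
  induction t generalizing lo hi with
  | zero =>
    rw [internalNodes_eq_nil (by simp at h; omega)]
    simp only [List.map_nil, List.sum_nil]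
    positivity
  | succ t ih =>
    by_cases h2 : 2 ≤ hi - lo
    · have h1 := @ih lo ((lo + hi) / 2) (by rw [pow_succ] at h; omega)
      have h3 := @ih ((lo + hi) / 2) hi (by rw [pow_succ] at h; omega)
      rw [internalNodes_eq h2]
      simp only [List.map_cons, List.sum_cons, List.map_append, List.sum_append]
      have e : hi - lo = ((lo + hi) / 2 - lo) + (hi - (lo + hi) / 2) := by omega
      rw [e]
      generalize (lo + hi) / 2 - lo = p at *
      generalize hi - (lo + hi) / 2 = q at *
      push_cast
      have : 0 ≤ B * ((p : ℝ) * q) := by positivity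
      nlinarith
    · rw [internalNodes_eq_nil h2]
      simp only [List.map_nil, List.sum_nil]
      positivity

section Descend

open Var

/-- The descent from the root to the node that separates the leaves `yl` and `yr - 1`. -/
def descend (R : ℕ) : Cmd :=
  .seq (Block.code R [.set left 0, .set right num, .set node 0, .set half (num / 2)])
    (whileNonzero R (.bin .lt half (yl + 1) + .bin .lt yr (half + 1))
      (.seq
        (ifNonzero R (.bin .lt yr (half + 1))
          (Block.code R [.set node (node + 1), .set right half])
          (Block.code R [.set node (node + (half - left)), .set left half]))
        (Block.code R [.set half ((left + right) / 2)])))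

/-- The descent keeps the number `node` of the current node in the preorder `internalNodes`, so that
no tree links are needed: the children of a node follow it at the distances `1` and `half - left`.
It ends at the node whose midpoint `half` separates the positions `yl` and `yr - 1`. -/
theorem exec_descend {w : ℕ} [NeZero w] {R : ℕ} {s : Env w} (h1 : s.v yl + 2 ≤ s.v yr)
    (h2 : s.v yr ≤ s.v num) (h3 : 2 * s.v num < 2 ^ w) {t : ℕ} (ht : s.v num ≤ 2 ^ t) :
    Exec R (descend R) s (t * 39 + 24) fun s' =>
      s'.m = s.m ∧ s'.c = s.c ∧ (∀ x, x ∉ [left, right, node, half] → s'.v x = s.v x) ∧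
      (internalNodes 0 (s.v num))[s'.v node]? = some (s'.v left, s'.v right) ∧
      s'.v half = (s'.v left + s'.v right) / 2 ∧
      s'.v left ≤ s.v yl ∧ s.v yl < s'.v half ∧ s'.v half < s.v yr ∧ s.v yr ≤ s'.v right := by
  have hn := NeZero.ne w
  refine Exec.mono (Exec.seq (Exec.block ?_ (Exec.loop (t := 27) (fun k s' =>
    s'.m = s.m ∧ s'.c = s.c ∧ (∀ x, x ∉ [left, right, node, half] → s'.v x = s.v x) ∧
    s'.v half = (s'.v left + s'.v right) / 2 ∧
    s'.v left ≤ s.v yl ∧ s.v yr ≤ s'.v right ∧ s'.v right ≤ s.v num ∧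
    s'.v right - s'.v left ≤ 2 ^ k ∧ s'.v node + (s'.v right - s'.v left) ≤ s.v num ∧
    ∀ j, j < s'.v right - s'.v left - 1 → (internalNodes 0 (s.v num))[s'.v node + j]? =
      (internalNodes (s'.v left) (s'.v right))[j]?)
    ?_ ?_ ?_ (k := t) ?_))) ?_ (fun s' h => h)
  · simp; omega
  · rintro k s' ⟨hm, hc, hv, hh, hl, hr, hrn, hk, hnode, hnodes⟩
    have e1 := hv yl (by simp)
    have e2 := hv yr (by simp)
    simp [hn]
    split_ifs <;> omega
  · rintro k s' ⟨hm, hc, hv, hh, hl, hr, hrn, hk, hnode, hnodes⟩ h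
    have e1 := hv yl (by simp)
    have e2 := hv yr (by simp)
    obtain ⟨k, rfl⟩ : ∃ k', k = k' + 1 := by
      cases k with
      | zero => simp at hk; omega
      | succ k => exact ⟨k, rfl⟩
    refine ⟨k, rfl, ?_⟩
    rw [pow_succ] at hk
    refine Exec.mono (Exec.seq (Exec.ite ?_
      (fun hb => Exec.block ?_ (Exec.block ?_ ?_))
      (fun hb => Exec.block ?_ (Exec.block ?_ ?_)))) ?_ (fun s' h => h)
    · simp [hn]; omega
    · simp [hn]; omega
    · simp; omega
    · have hlt : s'.v yr < s'.v half + 1 := by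
        by_contra hn
        simp [hn] at hb
      refine ⟨hm, hc, fun x hx => ?_, ?_, ?_, ?_, ?_, ?_, ?_, ?_⟩
      · simp only [List.mem_cons, List.not_mem_nil, or_false, not_or] at hx
        simp [hx, hv]
      · simp
      · simp; omega
      · simp; omega
      · simp; omega
      · simp; omega
      · simp; omega
      · intro j hj
        simp at hj ⊢
        rw [Nat.add_assoc, Nat.add_comm 1 j, hnodes _ (by omega), hh]
        exact getElem?_internalNodes_left (by omega) (by omega)
    · simp; omega
    · simp; omega
    · have hlt : ¬ s'.v yr < s'.v half + 1 := by
        intro hn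
        simp [hn] at hb
      have hlt' : s'.v half < s'.v yl + 1 := by
        by_contra hn
        simp [hn] at h
        omega
      refine ⟨hm, hc, fun x hx => ?_, ?_, ?_, ?_, ?_, ?_, ?_, ?_⟩
      · simp only [List.mem_cons, List.not_mem_nil, or_false, not_or] at hx
        simp [hx, hv]
      · simp
      · simp; omega
      · simp; omega
      · simp; omega
      · simp; omega
      · simp; omega
      · intro j hj
        simp at hj ⊢
        rw [Nat.add_assoc, Nat.add_comm _ j, hnodes _ (by omega), hh]
        exact getElem?_internalNodes_right (by omega)
    · simp
  · rintro k s' ⟨hm, hc, hv, hh, hl, hr, hrn, hk, hnode, hnodes⟩ h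
    have e1 := hv yl (by simp)
    have e2 := hv yr (by simp)
    have h5 : ¬ s'.v half < s'.v yl + 1 := fun hn => by simp [hn] at h
    have h6 : ¬ s'.v yr < s'.v half + 1 := fun hn => by simp [hn] at h
    refine ⟨hm, hc, hv, ?_, hh, hl, by omega, by omega, hr⟩
    have := hnodes 0 (by omega)
    rw [Nat.add_zero, internalNodes_eq (lo := s'.v left) (by omega)] at this
    exact this
  · refine ⟨rfl, rfl, fun x hx => ?_, ?_, ?_, ?_, ?_, ?_, ?_, ?_⟩
    · simp only [List.mem_cons, List.not_mem_nil, or_false, not_or] at hx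
      simp [hx]
    · simp
    · simp
    · simpa using h2
    · simp
    · simpa using ht
    · simp
    · simp
  · simp; omega

end Descend

/-! ### Scanning the located prefixes -/

/-- `s'` agrees with `s` except for the variables in `V` and the cells outside `A`. -/
structure Agree {w : ℕ} (V : List Var) (A : ℕ → Prop) (s s' : Env w) : Prop where
  v : ∀ x, x ∉ V → s'.v x = s.v x
  c : s'.c = s.c
  m : ∀ a, A a → s'.m a = s.m a

theorem Agree.refl {w : ℕ} (V : List Var) (A : ℕ → Prop) (s : Env w) : Agree V A s s :=
  ⟨fun _ _ => rfl, rfl, fun _ _ => rfl⟩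

theorem Agree.trans {w : ℕ} {V : List Var} {A : ℕ → Prop} {s s' s'' : Env w}
    (h : Agree V A s s') (h' : Agree V A s' s'') : Agree V A s s'' :=
  ⟨fun x hx => (h'.v x hx).trans (h.v x hx), h'.c.trans h.c,
    fun a ha => (h'.m a ha).trans (h.m a ha)⟩

theorem Agree.mono {w : ℕ} {V V' : List Var} {A A' : ℕ → Prop} {s s' : Env w}
    (h : Agree V A s s') (hV : ∀ x ∈ V, x ∈ V') (hA : ∀ a, A' a → A a) : Agree V' A' s s' :=
  ⟨fun x hx => h.v x fun hx' => hx (hV x hx'), h.c, fun a ha => h.m a (hA a ha)⟩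

/-- The list `L` is stored at the address `a`, within the cells in `A`. -/
structure Held {w : ℕ} (A : ℕ → Prop) (m : ℕ → Cell w) (a : ℕ) (L : List (Cell w)) : Prop where
  stored : StoredAt m a L
  mem : ∀ i, i < L.length → A (a + i)

theorem Held.agree {w : ℕ} {V : List Var} {A : ℕ → Prop} {s s' : Env w} {a : ℕ}
    {L : List (Cell w)} (h : Held A s.m a L) (hs : Agree V A s s') : StoredAt s'.m a L :=
  h.stored.congr fun i hi => hs.m _ (h.mem i hi)

theorem Held.agree_get {w : ℕ} {V : List Var} {A : ℕ → Prop} {s s' : Env w} {a : ℕ}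
    {L : List (Cell w)} (h : Held A s.m a L) (hs : Agree V A s s') {i : ℕ} {u : Cell w}
    (hi : L[i]? = some u) : s'.m (a + i) = u :=
  (h.agree hs).get hi

theorem length_flatMap_const {α β : Type*} {l : List α} {f : α → List β} {k : ℕ}
    (h : ∀ x ∈ l, (f x).length = k) : (l.flatMap f).length = l.length * k := by
  induction l with
  | nil => simp
  | cons x l ih =>
    rw [List.flatMap_cons, List.length_append, h x (by simp), ih fun y hy => h y (by simp [hy]),
      List.length_cons]
    ring

section Scan

open Var

/-- The variables that a scan uses itself. -/
abbrev scanVars : List Var := [i, cur, plen, k, j, box, color, res, total]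

/-- The variables reserved for the actions performed during a scan. -/
abbrev hookVars : List Var := [common, marked, nrows, t]

/-- The cells outside the work space of the subroutines. -/
abbrev OutsideSub {w : ℕ} (s : Env w) (Sc : ℕ) (a : ℕ) : Prop :=
  a < s.v sub ∨ s.v sub + Sc ≤ a

/-- The words that describe the prefix with the record at `cur`. -/
def prefixWords (W : ℕ) : List Expr :=
  (List.range W).map fun i => .load (cur + .lit i)

/-- The loop over the boxes of a prefix that are not in its full blocks. -/
def scanResidual (R W : ℕ) (report probe hook : Cmd) : Cmd :=
  whileNonzero R (.bin .lt j plen)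
    (.seq (call R report simg sub (prefixWords W ++ [.var j]) [] box)
    (.seq (Block.code R [.set color (.load (cols + box))])
    (.seq probe
    (.seq hook
      (Block.code R [.set j (j + 1)])))))

/-- The loop over the located prefixes.  It adds up their lengths, performs `full` for each prefix
that has a full block, and, for each box after the full blocks, computes its color, calls `probe`
on this color, and performs `hook`. -/
def scan (R W : ℕ) (length report probe full hook : Cmd) : Cmd :=
  .seq (Block.code R [.set i 0])
    (whileNonzero R (.bin .lt i count)
      (.seq (call R length simg sub (prefixWords W) [] plen)
      (.seq (Block.code R [.set total (.bin .wadd total plen), .set k (plen / blk),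
        .set j (k * blk)])
      (.seq (ifNonzero R k full (Block.code R []))
      (.seq (scanResidual R W report probe hook)
        (Block.code R [.set cur (cur + .lit W), .set i (i + 1)]))))))

/-- The colors of the boxes of `p` after its full blocks. -/
def residual {w N n : ℕ} (X : ℕ) (bx : LocatedPrefix w → List (Fin N)) (colr : Fin N → Fin n)
    (p : LocatedPrefix w) : List (Fin n) :=
  ((bx p).drop (p.len / X * X)).map colr

/-- The conditions under which a scan from `s₀` is correct.  `D` are the located prefixes, `bx`
gives their boxes, `colr` the colors of the boxes, and `probe` decides whether the color is in
`O`.  `I Fs Ks` is the invariant after the actions for the prefixes `Fs` and the colors `Ks`. -/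
structure ScanSpec {w N n : ℕ} (R X W Sc : ℕ) (length report probe full hook : Cmd) (s₀ : Env w)
    (A : ℕ → Prop) (D : List (LocatedPrefix w)) (img : List (Cell w))
    (bx : LocatedPrefix w → List (Fin N)) (colr : Fin N → Fin n) (O : Finset (Fin n))
    (I : List (LocatedPrefix w) → List (Fin n) → Env w → Prop) (scratch tl tr : ℝ)
    (Tp Tf Th : ℕ) : Prop where
  bound_length : length.bound ≤ R
  bound_report : report.bound ≤ R
  width_le : W + 3 ≤ R
  scratch_le : scratch ≤ Sc
  sub_le : s₀.v sub + Sc ≤ 2 ^ w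
  outside : ∀ a, A a → OutsideSub s₀ Sc a
  img_held : Held A s₀.m (s₀.v simg) img
  img_le : s₀.v simg + img.length ≤ s₀.v sub
  cols_held : Held A s₀.m (s₀.v cols)
    (List.ofFn fun i => Cell.word (BitVec.ofNat w (colr i)))
  cols_le : s₀.v cols + N < 2 ^ w
  n_lt : n < 2 ^ w
  words_held : Held A s₀.m (s₀.v cur) (D.flatMap fun p => p.words.map Cell.word)
  words_length : ∀ p ∈ D, p.words.length = W
  words_le : s₀.v cur + D.length * W < 2 ^ w
  D_le : D.length < 2 ^ w
  total_lt : s₀.v total < 2 ^ w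
  count_eq : s₀.v count = D.length
  blk_eq : s₀.v blk = X
  one_le : 1 ≤ X
  box_length : ∀ p ∈ D, (bx p).length = p.len
  answers_length : ∀ p ∈ D, Answers length img p.words [] scratch tl
    fun _ σ => (σ.reg 0).toNat = p.len
  answers_report : ∀ p ∈ D, ∀ (j : ℕ) (i : Fin N), (bx p)[j]? = some i →
    Answers report img (p.words ++ [BitVec.ofNat w j]) [] scratch tr
      fun _ σ => (σ.reg 0).toNat = i
  exec_probe : ∀ (s : Env w) (κ : Fin n), Agree (scanVars ++ hookVars) A s₀ s →
    s.v color = κ → Exec R probe s Tp fun s' =>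
      s'.v res = (if κ ∈ O then 1 else 0) ∧ Agree [res] (OutsideSub s₀ Sc) s s'
  stable : ∀ Fs Ks s s', Agree scanVars (OutsideSub s₀ Sc) s s' → I Fs Ks s → I Fs Ks s'
  exec_full : ∀ Fs Ks p s, p ∈ D → Fs ++ [p] <+: D.filter (fun p => 0 < p.len / X) →
    I Fs Ks s → Agree (scanVars ++ hookVars) A s₀ s → s.v k = p.len / X → 0 < p.len / X →
    s.m (s.v cur) = .word (BitVec.ofNat w p.node) →
    Exec R full s Tf fun s' => I (Fs ++ [p]) Ks s' ∧ Agree hookVars A s s'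
  exec_hook : ∀ Fs Ks κ s, Ks ++ [κ] <+: D.flatMap (residual X bx colr) →
    I Fs Ks s → Agree (scanVars ++ hookVars) A s₀ s → s.v color = κ.1 →
    s.v res = (if κ ∈ O then 1 else 0) →
    Exec R hook s Th fun s' => I Fs (Ks ++ [κ]) s' ∧ Agree hookVars A s s'

theorem prefixWords_cost (W : ℕ) : ((prefixWords W).map fun e => e.cost + 1).sum = W * 5 := by
  simp [prefixWords, List.map_map, Function.comp_def]

theorem prefixWords_ok {w : ℕ} {s : Env w} {W : ℕ} (h : s.v cur + W < 2 ^ w) :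
    ∀ e ∈ prefixWords W, e.Ok s := by
  simp only [prefixWords, List.mem_map, List.mem_range]
  rintro _ ⟨i, hi, rfl⟩
  simp; omega

theorem prefixWords_ev {w : ℕ} {s : Env w} {L : List (BitVec w)}
    (h : StoredAt s.m (s.v cur) (L.map Cell.word)) :
    L.map BitVec.toNat = (prefixWords L.length).map (Expr.ev s) := by
  apply List.ext_getElem
  · simp [prefixWords]
  · intro i hi hi'
    have : s.m (s.v cur + i) = .word (L[i]'(by simpa using hi)) := h.get (by
      rw [List.getElem?_map, List.getElem?_eq_getElem (by simpa using hi)]; rfl)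
    simp [prefixWords, this, Cell.toWord]

namespace ScanSpec

variable {w N n : ℕ} [NeZero w] {R X W Sc : ℕ} {length report probe full hook : Cmd} {s₀ : Env w}
    {A : ℕ → Prop} {D : List (LocatedPrefix w)} {img : List (Cell w)}
    {bx : LocatedPrefix w → List (Fin N)} {colr : Fin N → Fin n} {O : Finset (Fin n)}
    {I : List (LocatedPrefix w) → List (Fin n) → Env w → Prop} {scratch tl tr : ℝ} {Tp Tf Th : ℕ}

/-- The residual boxes of one prefix are fewer than `X`, which bounds the number of the
iterations. -/
theorem exec_residual
    (h : ScanSpec R X W Sc length report probe full hook s₀ A D img bx colr O I scratch tl tr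
      Tp Tf Th) {p : LocatedPrefix w} (hp : p ∈ D) {Fs : List (LocatedPrefix w)}
    {Ks : List (Fin n)} (hKs : Ks ++ residual X bx colr p <+: D.flatMap (residual X bx colr))
    {s : Env w} (hI : I Fs Ks s) (hs : Agree (scanVars ++ hookVars) A s₀ s)
    (hcur : StoredAt s.m (s.v cur) (p.words.map Cell.word)) (hcurW : s.v cur + W < 2 ^ w)
    (hwA : ∀ i, i < W → A (s.v cur + i))
    (hplen : s.v plen = p.len) (hplt : p.len < 2 ^ w) (hj : s.v j = p.len / X * X) :
    Exec R (scanResidual R W report probe hook) s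
      (X * (⌊tr⌋₊ + W * 5 + Tp + Th + 30) + 4) fun s' =>
        I Fs (Ks ++ residual X bx colr p) s' ∧
        Agree ([j, box, color, res] ++ hookVars) A s s' := by
  have hn := NeZero.ne w
  have hX : p.len / X * X ≤ p.len := Nat.div_mul_le_self _ _
  have hX' : p.len - p.len / X * X < X := by
    have := Nat.div_add_mod p.len X
    have := Nat.mod_lt p.len h.one_le
    have := Nat.mul_comm X (p.len / X)
    omega
  have hrlen : (residual X bx colr p).length = p.len - p.len / X * X := by
    simp [residual, h.box_length p hp]
  refine Exec.mono (Exec.loop (t := ⌊tr⌋₊ + W * 5 + Tp + Th + 26) (k := p.len - p.len / X * X)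
    (fun r s' => p.len / X * X ≤ s'.v j ∧ s'.v j ≤ p.len ∧ r = p.len - s'.v j ∧
      I Fs (Ks ++ (residual X bx colr p).take (s'.v j - p.len / X * X)) s' ∧
      Agree ([j, box, color, res] ++ hookVars) A s s') ?_ ?_ ?_ ?_) ?_ fun s' hs' => hs'
  · simp
  · rintro r s1 ⟨hj1, hj2, hr, hI1, hs1⟩ hlt
    have hplen1 : s1.v plen = p.len := by rw [hs1.v _ (by simp), hplen]
    have hcur1 : s1.v cur = s.v cur := hs1.v _ (by simp)
    have hlt : s1.v j < p.len := by
      by_contra hge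
      simp [hplen1, hge] at hlt
    refine ⟨r - 1, by omega, ?_⟩
    have hs01 : Agree (scanVars ++ hookVars) A s₀ s1 :=
      hs.trans (hs1.mono (by simp +contextual) fun _ => id)
    have hlt' : s1.v j < (bx p).length := by rw [h.box_length p hp]; exact hlt
    have hget := List.getElem?_eq_getElem hlt'
    have hw1 : StoredAt s1.m (s1.v cur) (p.words.map Cell.word) := by
      rw [hcur1]
      refine hcur.congr fun i hi => hs1.m _ (hwA i ?_)
      simpa [h.words_length p hp] using hi
    have hsub := hs01.v sub (by simp)
    have hsimg := hs01.v simg (by simp)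
    have hcols := hs01.v cols (by simp)
    have hsl := h.sub_le
    refine Exec.seq_le (Tp + Th + 16) (Exec.call (h.answers_report p hp _ _ hget) h.bound_report
      ?_ ?_ trivial trivial ?_ ?_ rfl ?_ ?_ h.scratch_le ?_ le_rfl ?_) ?_
    · have := h.width_le; simp [prefixWords]; omega
    · simp
    · intro e he
      rcases List.mem_append.1 he with he | he
      · exact prefixWords_ok (by rw [hcur1]; exact hcurW) e he
      · simp only [List.mem_singleton] at he
        subst he; simp
    · rw [List.map_append, List.map_append, prefixWords_ev hw1, h.words_length p hp]
      simp only [List.map_cons, List.map_nil, BitVec.toNat_ofNat, Expr.ev_var]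
      rw [Nat.mod_eq_of_lt (by omega)]
    · simp only [Expr.ev_var, hsimg]
      exact h.img_held.agree hs01
    · simp only [Expr.ev_var, hsimg, hsub]
      exact h.img_le
    · simp only [Expr.ev_var, hsub]
      exact h.sub_le
    · intro σ' hpost hmem
      simp only [Expr.ev_var, hsub] at hmem
      set s2 : Env w := ⟨Function.update s1.v box (σ'.reg 0).toNat, s1.c, σ'.mem⟩ with hs2
      have ha2 : Agree [box] (OutsideSub s₀ Sc) s1 s2 :=
        ⟨fun x hx => by simp at hx; simp [hs2, hx], rfl, fun a ha => hmem a ha⟩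
      have hs02 : Agree (scanVars ++ hookVars) A s₀ s2 :=
        hs01.trans (ha2.mono (by simp) h.outside)
      have hbox : s2.v box = ((bx p)[s1.v j] : ℕ) := by simp [hs2, hpost]
      set κ : Fin n := colr (bx p)[s1.v j] with hκ
      have hcol : (s2.m (s2.v cols + s2.v box)).toWord.toNat = κ := by
        rw [hs02.v cols (by simp), hbox, h.cols_held.agree_get hs02 (u := .word (BitVec.ofNat w κ))]
        · simp only [Cell.toWord, BitVec.toNat_ofNat]
          exact Nat.mod_eq_of_lt (κ.isLt.trans h.n_lt)
        · simp [hκ]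
      refine Exec.seq_le (Tp + Th + 6) (Exec.block ?_ ?_) ?_
      · have := h.cols_le
        have := (bx p)[s1.v j].isLt
        have := hs02.v cols (by simp)
        simp; omega
      · set s3 := Block.run s2 [.set color (.load (cols + box))] with hs3
        have ha3 : Agree [color] (OutsideSub s₀ Sc) s2 s3 :=
          ⟨fun x hx => by simp at hx; simp [hs3, hx], rfl, fun a ha => rfl⟩
        have hs03 : Agree (scanVars ++ hookVars) A s₀ s3 :=
          hs02.trans (ha3.mono (by simp) h.outside)
        have hc3 : s3.v color = κ := by simp [hs3, hcol]
        refine Exec.seq_of (Th + 6) (h.exec_probe s3 κ hs03 hc3) (by omega) ?_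
        rintro s4 ⟨hres, ha4⟩
        have hs04 : Agree (scanVars ++ hookVars) A s₀ s4 :=
          hs03.trans (ha4.mono (by simp) h.outside)
        have ha14 : Agree [box, color, res] (OutsideSub s₀ Sc) s1 s4 :=
          ((ha2.mono (by simp) fun _ => id).trans (ha3.mono (by simp) fun _ => id)).trans
            (ha4.mono (by simp) fun _ => id)
        have hget' : (residual X bx colr p)[s1.v j - p.len / X * X]? = some κ := by
          rw [residual, List.getElem?_map, List.getElem?_drop,
            show p.len / X * X + (s1.v j - p.len / X * X) = s1.v j by omega, hget]
          rfl
        have htake : (residual X bx colr p).take (s1.v j - p.len / X * X) ++ [κ] =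
            (residual X bx colr p).take (s1.v j + 1 - p.len / X * X) := by
          rw [show s1.v j + 1 - p.len / X * X = (s1.v j - p.len / X * X) + 1 by omega,
            List.take_add_one, hget']
          rfl
        have hI4 := h.stable _ _ _ _ (ha14.mono (by simp) fun _ => id) hI1
        refine Exec.seq_of 6 (h.exec_hook _ _ κ s4 ?_ hI4 hs04 ?_ hres) (by omega) ?_
        · rw [List.append_assoc, htake]
          refine List.IsPrefix.trans ?_ hKs
          exact (List.prefix_append_right_inj _).2 (List.take_prefix _ _)
        · rw [ha4.v _ (by simp), hc3]
        · rintro s5 ⟨hI5, ha5⟩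
          have hj5 : s5.v j = s1.v j := by rw [ha5.v _ (by simp), ha14.v _ (by simp)]
          refine Exec.mono (Exec.block ?_ ?_) (t := 5) (by simp) fun s' hs' => hs'
          · simp [hn, hj5]; omega
          · have ha6 : Agree [j] (OutsideSub s₀ Sc) s5 (Block.run s5 [.set j (j + 1)]) :=
              ⟨fun x hx => by simp at hx; simp [hx], rfl, fun a ha => rfl⟩
            refine ⟨by simp [hj5]; omega, by simp [hj5]; omega, by simp [hj5]; omega, ?_, ?_⟩
            · rw [List.append_assoc, htake, ← hj5] at hI5
              have := h.stable _ _ _ _ (ha6.mono (by simp) fun _ => id) hI5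
              simpa using this
            · refine hs1.trans ?_
              refine (Agree.trans ?_ (ha5.mono (by simp) fun _ => id)).trans
                (ha6.mono (by simp) h.outside)
              exact ha14.mono (by simp) h.outside
      · simp; omega
    · simp only [callCost, List.map_append, List.sum_append, prefixWords_cost]
      simp
      omega
  · rintro r s1 ⟨hj1, hj2, hr, hI1, hs1⟩ hge
    have hplen1 : s1.v plen = p.len := by rw [hs1.v _ (by simp), hplen]
    have : s1.v j = p.len := by
      by_contra hne
      have : s1.v j < p.len := by omega
      simp [hplen1, this] at hge
    rw [this, List.take_of_length_le (by omega)] at hI1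
    exact ⟨hI1, hs1⟩
  · refine ⟨hj.ge, by omega, by rw [hj], ?_, Agree.refl _ _ _⟩
    simpa [hj] using hI
  · have : (p.len - p.len / X * X) * (⌊tr⌋₊ + W * 5 + Tp + Th + 30) ≤
        X * (⌊tr⌋₊ + W * 5 + Tp + Th + 30) := Nat.mul_le_mul_right _ hX'.le
    simp only [Expr.cost_bin, Expr.cost_var]
    rw [show ⌊tr⌋₊ + W * 5 + Tp + Th + 26 + (1 + 1 + 1) + 1 =
      ⌊tr⌋₊ + W * 5 + Tp + Th + 30 by omega]
    omega

/-- A scan performs `full` and `hook` for all prefixes with a full block and for all residual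
colors, in the order of the prefixes, and adds up the lengths of the prefixes. -/
theorem exec_scan
    (h : ScanSpec R X W Sc length report probe full hook s₀ A D img bx colr O I scratch tl tr
      Tp Tf Th) (hI : I [] [] s₀) :
    Exec R (scan R W length report probe full hook) s₀
      (D.length * (⌊tl⌋₊ + W * 5 + Tf + X * (⌊tr⌋₊ + W * 5 + Tp + Th + 30) + 60) + 10) fun s' =>
        I (D.filter fun p => 0 < p.len / X) (D.flatMap (residual X bx colr)) s' ∧
        Agree (scanVars ++ hookVars) A s₀ s' ∧
        s'.v total = (s₀.v total + (D.map LocatedPrefix.len).sum) % 2 ^ w := by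
  have hn := NeZero.ne w
  set T := ⌊tl⌋₊ + W * 5 + Tf + X * (⌊tr⌋₊ + W * 5 + Tp + Th + 30) with hT
  have hsl := h.sub_le
  -- Each prefix is described by `W` words.
  have hwords : ∀ (k : ℕ) (p : LocatedPrefix w), D[k]? = some p →
      StoredAt s₀.m (s₀.v cur + k * W) (p.words.map Cell.word) ∧
      (∀ i, i < W → A (s₀.v cur + k * W + i)) := by
    intro k p hk
    have hk' := (List.getElem?_eq_some_iff.1 hk).1
    have hW : ∀ l : List (LocatedPrefix w), (∀ p ∈ l, p ∈ D) →
        (l.flatMap fun p => p.words.map Cell.word).length = l.length * W := fun l hl =>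
      length_flatMap_const fun p hp => by rw [List.length_map, h.words_length p (hl p hp)]
    constructor
    · have := h.words_held.stored.flatMap hk
      rwa [hW _ fun p hp => List.mem_of_mem_take hp, List.length_take_of_le hk'.le] at this
    · intro i hi
      rw [Nat.add_assoc]
      refine h.words_held.mem _ ?_
      rw [hW _ fun p hp => hp]
      calc k * W + i < (k + 1) * W := by rw [Nat.succ_mul]; omega
        _ ≤ _ := Nat.mul_le_mul_right _ hk'
  refine Exec.seq_le (D.length * (T + 60) + 4) (Exec.block ?_ ?_) ?_
  · simp
  · refine Exec.mono (Exec.loop (t := T + 56) (k := D.length)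
      (fun r s' => s'.v i ≤ D.length ∧ r = D.length - s'.v i ∧
        I ((D.take (s'.v i)).filter fun p => 0 < p.len / X)
          ((D.take (s'.v i)).flatMap (residual X bx colr)) s' ∧
        Agree (scanVars ++ hookVars) A s₀ s' ∧ s'.v cur = s₀.v cur + s'.v i * W ∧
        s'.v total = (s₀.v total + ((D.take (s'.v i)).map LocatedPrefix.len).sum) % 2 ^ w)
      ?_ ?_ ?_ ?_) ?_ fun s' hs' => hs'
    · simp
    · rintro r s1 ⟨hi, hr, hI1, hs1, hcur, htot⟩ hlt
      have hcount : s1.v count = D.length := by rw [hs1.v _ (by simp), h.count_eq]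
      have hlt : s1.v i < D.length := by
        by_contra hge
        simp [hcount, hge] at hlt
      refine ⟨r - 1, by omega, ?_⟩
      set p := D[s1.v i] with hpdef
      have hget : D[s1.v i]? = some p := List.getElem?_eq_getElem hlt
      have hp : p ∈ D := List.getElem_mem hlt
      obtain ⟨hst, hwA⟩ := hwords _ _ hget
      rw [← hcur] at hst hwA
      have hcurW : s1.v cur + W < 2 ^ w := by
        have h1 := h.words_le
        have h2 : (s1.v i + 1) * W ≤ D.length * W := Nat.mul_le_mul_right _ hlt
        rw [Nat.succ_mul] at h2
        omega
      have hw1 : StoredAt s1.m (s1.v cur) (p.words.map Cell.word) :=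
        hst.congr fun i hi => hs1.m _ (hwA i (by simpa [h.words_length p hp] using hi))
      have htake : D.take (s1.v i + 1) = D.take (s1.v i) ++ [p] := by
        rw [List.take_add_one, hget]; rfl
      have hsub := hs1.v sub (by simp)
      have hsimg := hs1.v simg (by simp)
      refine Exec.seq_le (Tf + X * (⌊tr⌋₊ + W * 5 + Tp + Th + 30) + 43)
        (Exec.call (h.answers_length p hp) h.bound_length
          ?_ ?_ trivial trivial ?_ ?_ rfl ?_ ?_ h.scratch_le ?_ le_rfl ?_) ?_
      · have := h.width_le; simp [prefixWords]; omega
      · simp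
      · exact prefixWords_ok hcurW
      · rw [prefixWords_ev hw1, h.words_length p hp]
      · simp only [Expr.ev_var, hsimg]
        exact h.img_held.agree hs1
      · simp only [Expr.ev_var, hsimg, hsub]
        exact h.img_le
      · simp only [Expr.ev_var, hsub]
        exact h.sub_le
      · intro σ' hpost hmem
        simp only [Expr.ev_var, hsub] at hmem
        have hplt : p.len < 2 ^ w := by rw [← hpost]; exact BitVec.isLt _
        set s2 : Env w := ⟨Function.update s1.v plen (σ'.reg 0).toNat, s1.c, σ'.mem⟩ with hs2
        have ha2 : Agree [plen] (OutsideSub s₀ Sc) s1 s2 :=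
          ⟨fun x hx => by simp at hx; simp [hs2, hx], rfl, fun a ha => hmem a ha⟩
        have hplen2 : s2.v plen = p.len := by simp [hs2, hpost]
        have hblk2 : s2.v blk = X := by
          rw [ha2.v _ (by simp), hs1.v _ (by simp), h.blk_eq]
        refine Exec.seq_le (Tf + X * (⌊tr⌋₊ + W * 5 + Tp + Th + 30) + 30) (Exec.block ?_ ?_) ?_
        · have := Nat.div_mul_le_self p.len X
          simp [hplen2, hblk2]; omega
        · set s3 := Block.run s2 [.set total (.bin .wadd total plen), .set k (plen / blk),
            .set j (k * blk)] with hs3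
          have ha3 : Agree [total, k, j] (OutsideSub s₀ Sc) s2 s3 :=
            ⟨fun x hx => by
              simp only [List.mem_cons, List.not_mem_nil, or_false, not_or] at hx
              simp [hs3, hx], rfl, fun a ha => rfl⟩
          have ha13 : Agree scanVars (OutsideSub s₀ Sc) s1 s3 :=
            (ha2.mono (by simp) fun _ => id).trans (ha3.mono (by simp) fun _ => id)
          have hs03 : Agree (scanVars ++ hookVars) A s₀ s3 :=
            hs1.trans (ha13.mono (by simp +contextual) h.outside)
          have hi3 : s3.v i = s1.v i := by simp [hs3, hs2]
          have hcur3 : s3.v cur = s1.v cur := by simp [hs3, hs2]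
          have hk3 : s3.v k = p.len / X := by simp [hs3, hplen2, hblk2]
          have hj3 : s3.v j = p.len / X * X := by simp [hs3, hplen2, hblk2]
          have hplen3 : s3.v plen = p.len := by simp [hs3, hplen2]
          have htot3 : s3.v total = (s1.v total + p.len) % 2 ^ w := by
            simp [hs3, hs2, hpost]
          have hnode : s3.m (s3.v cur) = .word (BitVec.ofNat w p.node) := by
            rw [hcur3]
            have h1 := hst.congr (m' := s3.m) fun i hi =>
              hs03.m _ (hwA i (by simpa [h.words_length p hp] using hi))
            exact h1.get (i := 0) (by simp [LocatedPrefix.words])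
          have hI3 := h.stable _ _ _ _ ha13 hI1
          refine Exec.seq_of (X * (⌊tr⌋₊ + W * 5 + Tp + Th + 30) + 20)
            (Q₁ := fun s4 => I ((D.take (s1.v i + 1)).filter fun p => 0 < p.len / X)
              ((D.take (s1.v i)).flatMap (residual X bx colr)) s4 ∧ Agree hookVars A s3 s4)
            (Exec.ite (t := Tf) (t' := 1) trivial (fun hk => ?_) (fun hk => ?_)) ?_ ?_
          · simp only [Expr.ev_var, hk3] at hk
            have hf : (D.take (s1.v i + 1)).filter (fun p => 0 < p.len / X) =
                (D.take (s1.v i)).filter (fun p => 0 < p.len / X) ++ [p] := by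
              rw [htake, List.filter_append, List.filter_cons_of_pos
                (by simpa using Nat.pos_of_ne_zero hk), List.filter_nil]
            rw [hf]
            refine h.exec_full _ _ p s3 hp ?_ hI3 hs03 hk3 (Nat.pos_of_ne_zero hk) hnode
            rw [← hf]
            exact (List.take_prefix _ _).filter _
          · simp only [Expr.ev_var, hk3] at hk
            have hf : (D.take (s1.v i + 1)).filter (fun p => 0 < p.len / X) =
                (D.take (s1.v i)).filter (fun p => 0 < p.len / X) := by
              rw [htake, List.filter_append, List.filter_cons_of_neg (by rw [hk]; simp),
                List.filter_nil, List.append_nil]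
            rw [hf]
            exact Exec.block trivial ⟨hI3, Agree.refl _ _ _⟩
          · simp; omega
          · rintro s4 ⟨hI4, ha4⟩
            have hs04 : Agree (scanVars ++ hookVars) A s₀ s4 :=
              hs03.trans (ha4.mono (by simp) fun _ => id)
            have e4 : s4.v cur = s1.v cur := by rw [ha4.v _ (by simp), hcur3]
            refine Exec.seq_of 12 (h.exec_residual hp ?_ hI4 hs04 ?_ ?_ ?_ ?_ hplt ?_) (by omega) ?_
            · have : (D.take (s1.v i)).flatMap (residual X bx colr) ++ residual X bx colr p =
                  (D.take (s1.v i + 1)).flatMap (residual X bx colr) := by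
                rw [htake]; simp
              rw [this]
              obtain ⟨l, hl⟩ := List.take_prefix (s1.v i + 1) D
              exact ⟨l.flatMap (residual X bx colr), by rw [← List.flatMap_append, hl]⟩
            · rw [e4]
              exact hst.congr fun i hi => hs04.m _ (hwA i (by
                simpa [h.words_length p hp] using hi))
            · rw [e4]; exact hcurW
            · rw [e4]; exact hwA
            · rw [ha4.v _ (by simp), hplen3]
            · rw [ha4.v _ (by simp), hj3]
            · rintro s5 ⟨hI5, ha5⟩
              have hi5 : s5.v i = s1.v i := by
                rw [ha5.v _ (by simp), ha4.v _ (by simp), hi3]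
              have hcur5 : s5.v cur = s1.v cur := by rw [ha5.v _ (by simp), e4]
              have htot5 : s5.v total = (s1.v total + p.len) % 2 ^ w := by
                rw [ha5.v _ (by simp), ha4.v _ (by simp), htot3]
              refine Exec.mono (Exec.block ?_ ?_) (t := 9) (by simp) fun s' hs' => hs'
              · have := h.D_le
                simp [hn, hi5, hcur5]; omega
              · set s6 := Block.run s5 [.set cur (cur + .lit W), .set i (i + 1)] with hs6
                have ha6 : Agree [cur, i] (OutsideSub s₀ Sc) s5 s6 :=
                  ⟨fun x hx => by
                    simp only [List.mem_cons, List.not_mem_nil, or_false, not_or] at hx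
                    simp [hs6, hx], rfl, fun a ha => rfl⟩
                have hi6 : s6.v i = s1.v i + 1 := by simp [hs6, hi5]
                have htot6 : s6.v total = (s1.v total + p.len) % 2 ^ w := by
                  simp [hs6, htot5]
                refine ⟨by omega, by omega, ?_, ?_, ?_, ?_⟩
                · rw [hi6]
                  have := h.stable _ _ _ _ (ha6.mono (by simp) fun _ => id) hI5
                  convert this using 1
                  rw [htake]; simp
                · exact (hs04.trans (ha5.mono (by simp) fun _ => id)).trans
                    (ha6.mono (by simp) h.outside)
                · rw [hi6]
                  simp [hs6, hcur5, hcur]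
                  ring
                · rw [hi6, htot6, htake, htot, Nat.mod_add_mod, List.map_append, List.sum_append,
                    List.map_singleton, List.sum_singleton, Nat.add_assoc]
        · simp; omega
      · simp only [callCost, prefixWords_cost]
        simp [hT]
        omega
    · rintro r s1 ⟨hi, hr, hI1, hs1, hcur, htot⟩ hge
      have hcount : s1.v count = D.length := by rw [hs1.v _ (by simp), h.count_eq]
      have : s1.v i = D.length := by
        by_contra hne
        have : s1.v i < D.length := by omega
        simp [hcount, this] at hge
      rw [this, List.take_length] at hI1 htot
      exact ⟨hI1, hs1, htot⟩
    · refine ⟨by simp, by simp, ?_, ?_, by simp, ?_⟩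
      · have : Agree [i] (OutsideSub s₀ Sc) s₀ (Block.run s₀ [.set i 0]) :=
          ⟨fun x hx => by simp at hx; simp [hx], rfl, fun a ha => rfl⟩
        simpa using h.stable _ _ _ _ (this.mono (by simp) fun _ => id) hI
      · exact ⟨fun x hx => by
          simp only [List.cons_append, List.nil_append, List.mem_cons, not_or] at hx
          simp [hx], rfl, fun a ha => rfl⟩
      · simp [Nat.mod_eq_of_lt h.total_lt]
    · simp only [Expr.cost_bin, Expr.cost_var]
      rw [show T + 56 + (1 + 1 + 1) + 1 = T + 60 by omega]
  · simp; omega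

end ScanSpec

end Scan

/-! ### The actions during the scans -/

section Hooks

open Var

theorem toNat_word {w x : ℕ} (h : x < 2 ^ w) :
    (Cell.word (BitVec.ofNat w x)).toWord.toNat = x := by
  simpa [Cell.toWord] using Nat.mod_eq_of_lt h

/-- The emptiness query for the color `color` in the rectangle `[x1, x2) × [y1, y2]`. -/
def probe (R : ℕ) (query : Cmd) : Cmd :=
  ifNonzero R (.bin .lt x1 x2)
    (call R query eimg sub [.var color, .var x1, x2 - 1, .var y1, .var y2] [] res)
    (Block.code R [.set res 0])

/-- The emptiness query decides whether the color `κ` occurs among the points whose positions by `x`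
are in `[x1, x2)` and whose `y`-ranks are in `[y1, y2]`. An empty interval `[x1, x2)` must not be
passed on, since the structure takes closed intervals of positions. -/
theorem exec_probe {w n : ℕ} [NeZero w] {R Sc : ℕ} {query : Cmd} {s : Env w} {img : List (Cell w)}
    {L : List (ℕ × Fin n)} {scratch time : ℝ} {κ : Fin n}
    (hq : ∀ x₁ x₂ y₁ y₂ : Fin L.length, Answers query img
      [BitVec.ofNat w κ, BitVec.ofNat w x₁, BitVec.ofNat w x₂, BitVec.ofNat w y₁,
        BitVec.ofNat w y₂] [] scratch time
      fun _ σ => (HasColorIn L κ x₁ x₂ y₁ y₂ → σ.reg 0 = 1#w) ∧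
        (¬ HasColorIn L κ x₁ x₂ y₁ y₂ → σ.reg 0 = 0#w))
    (hR : query.bound ≤ R) (hR' : 7 ≤ R) (hκ : s.v color = κ) (hn : n < 2 ^ w)
    (hL : L.length < 2 ^ w) (hx : s.v x2 ≤ L.length) (hy1 : s.v y1 < L.length)
    (hy2 : s.v y2 < L.length) (himg : StoredAt s.m (s.v eimg) img)
    (hbelow : s.v eimg + img.length ≤ s.v sub) (hsc : scratch ≤ Sc)
    (hfits : s.v sub + Sc ≤ 2 ^ w) {O : Finset (Fin n)}
    (hO : κ ∈ O ↔ ∃ i y : ℕ, L[i]? = some (y, κ) ∧ (s.v x1 ≤ i ∧ i < s.v x2) ∧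
      (s.v y1 ≤ y ∧ y ≤ s.v y2)) :
    Exec R (probe R query) s (⌊time⌋₊ + 30) fun s' =>
      s'.v res = (if κ ∈ O then 1 else 0) ∧ Agree [res] (OutsideSub s Sc) s s' := by
  have hw := NeZero.ne w
  have h1 : 1 < 2 ^ w := Nat.one_lt_two_pow hw
  refine Exec.mono (Exec.ite (t := ⌊time⌋₊ + 24) (t' := 3) (by simp) (fun h => ?_) (fun h => ?_))
    (by simp; omega) fun s' hs' => hs'
  · have hlt : s.v x1 < s.v x2 := by
      by_contra hge
      simp [hge] at h
    have hiff : κ ∈ O ↔ HasColorIn L κ (s.v x1) (s.v x2 - 1) (s.v y1) (s.v y2) := by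
      rw [hO]
      refine exists_congr fun i => exists_congr fun y => and_congr_right fun _ =>
        and_congr_left fun _ => ?_
      omega
    refine (Exec.call (e := eimg) (e' := sub) (hq ⟨s.v x1, by omega⟩
      ⟨s.v x2 - 1, by omega⟩ ⟨s.v y1, hy1⟩ ⟨s.v y2, hy2⟩) hR
      ?_ ?_ ?_ ?_ ?_ ?_ rfl himg hbelow hsc hfits le_rfl ?_).mono ?_ fun s' hs' => hs'
    · simpa using hR'
    · simp
    · simp
    · simp
    · simp [hw]; omega
    · have h2 := κ.isLt
      simp [hκ]
      refine ⟨?_, ?_, ?_, ?_, ?_⟩ <;> exact Nat.mod_eq_of_lt (by omega)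
    · intro σ' hpost hmem
      refine ⟨?_, fun x hx => ?_, rfl, fun a ha => hmem a ha⟩
      · simp only [Function.update_self]
        split_ifs with hm
        · rw [hpost.1 (hiff.1 hm)]
          simpa using Nat.mod_eq_of_lt h1
        · rw [hpost.2 fun h => hm (hiff.2 h)]
          simp
      · simp at hx
        simp [hx]
    · simp [callCost]
  · have hge : ¬ s.v x1 < s.v x2 := fun hlt => by simp [hlt] at h
    have hO' : κ ∉ O := by
      rw [hO]
      rintro ⟨i, y, -, hi, -⟩
      omega
    refine (Exec.block ?_ ?_).mono (by simp) fun s' hs' => hs'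
    · simp
    · refine ⟨by simp [hO'], fun x hx => ?_, rfl, fun a ha => rfl⟩
      simp at hx
      simp [hx]

/-- For a prefix with a full block: pushes the address of its row of the matrix. -/
def leftFull (R : ℕ) : Cmd :=
  Block.code R [
    .store (rows + nrows) (matrix + (.load (table + .load cur) + (k - 1)) * ncols),
    .set nrows (nrows + 1)]

/-- For a color of a residual box: counts it if it occurs on the other side, and inserts it into
the set of marked colors.  This is the list at `fp + num`; the array at `fp`, which is not
initialized, gives the position of each marked color in the list. -/
def leftHook (R : ℕ) : Cmd :=
  Block.code R [
    .set common (.bin .wadd common res),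
    .store (fp + color) marked,
    .store (fp + num + marked) color,
    .set marked (marked + 1)]

/-- For a prefix with a full block: adds up the entries of its column of the matrix in the rows
that have been pushed. -/
def rightFull (R : ℕ) : Cmd :=
  .seq (Block.code R [.set t 0])
    (whileNonzero R (.bin .lt t nrows)
      (Block.code R [
        .set common (.bin .wadd common
          (.load (.load (rows + t) + (.load (table + .load cur) + (k - 1))))),
        .set t (t + 1)]))

/-- For a color of a residual box: counts it if it occurs on the other side and is not marked. -/
def rightHook (R : ℕ) : Cmd :=
  .seq (Block.code R [.set t (.load (fp + color))])
    (ifNonzero R (.bin .lt t marked)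
      (Block.code R [.set common (.bin .wadd common
        (res * (1 - .bin .eq (.load (fp + num + t)) color)))])
      (Block.code R [.set common (.bin .wadd common res)]))

/-- The layout of the work space: two arrays with a cell for each color, the located prefixes
(from `area` on), the addresses of rows (from `rows` on), the work space of subroutines. -/
structure Layout {w : ℕ} (n : ℕ) (s : Env w) : Prop where
  num_eq : s.v num = n
  area_eq : s.v area = s.v fp + 2 * n
  rows_le : s.v area ≤ s.v rows
  sub_le : s.v rows ≤ s.v sub
  sub_lt : s.v sub < 2 ^ w

/-- The set of marked colors is `Ks`. -/
structure Marks {w n : ℕ} (Ks : List (Fin n)) (s : Env w) : Prop where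
  marked_eq : s.v marked = Ks.length
  length_le : Ks.length ≤ n
  get : ∀ (t : ℕ) (κ : Fin n), Ks[t]? = some κ →
    s.m (s.v fp + n + t) = .word (BitVec.ofNat w κ) ∧
    s.m (s.v fp + κ) = .word (BitVec.ofNat w t)

/-- The pushed row addresses are `ra`. -/
structure RowsAt {w : ℕ} (ra : List ℕ) (s : Env w) : Prop where
  nrows_eq : s.v nrows = ra.length
  le_sub : s.v rows + ra.length ≤ s.v sub
  get : ∀ (t : ℕ) (a : ℕ), ra[t]? = some a → s.m (s.v rows + t) = .word (BitVec.ofNat w a)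

theorem Layout.congr {w n : ℕ} {s s' : Env w} (h : Layout n s)
    (hv : ∀ x ∈ [num, area, fp, rows, sub], s'.v x = s.v x) : Layout n s' := by
  simp only [List.mem_cons, List.not_mem_nil, or_false, forall_eq_or_imp, forall_eq] at hv
  obtain ⟨h1, h2, h3, h4, h5⟩ := hv
  constructor
  · rw [h1, h.num_eq]
  · rw [h2, h3, h.area_eq]
  · rw [h2, h4]; exact h.rows_le
  · rw [h4, h5]; exact h.sub_le
  · rw [h5]; exact h.sub_lt

theorem Marks.congr {w n : ℕ} {Ks : List (Fin n)} {s s' : Env w} (h : Marks Ks s)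
    (hv : ∀ x ∈ [marked, fp], s'.v x = s.v x)
    (hm : ∀ a, a < s.v fp + 2 * n → s'.m a = s.m a) : Marks Ks s' := by
  simp only [List.mem_cons, List.not_mem_nil, or_false, forall_eq_or_imp, forall_eq] at hv
  refine ⟨by rw [hv.1, h.marked_eq], h.length_le, fun t κ ht => ?_⟩
  have h1 := (List.getElem?_eq_some_iff.1 ht).1
  have h2 := h.length_le
  have h3 := κ.isLt
  rw [hv.2, hm _ (by omega), hm _ (by omega)]
  exact h.get t κ ht

theorem RowsAt.congr {w : ℕ} {ra : List ℕ} {s s' : Env w} (h : RowsAt ra s)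
    (hv : ∀ x ∈ [nrows, rows, sub], s'.v x = s.v x)
    (hm : ∀ a, s.v rows ≤ a → a < s.v sub → s'.m a = s.m a) : RowsAt ra s' := by
  simp only [List.mem_cons, List.not_mem_nil, or_false, forall_eq_or_imp, forall_eq] at hv
  obtain ⟨h1, h2, h3⟩ := hv
  refine ⟨by rw [h1, h.nrows_eq], by rw [h2, h3]; exact h.le_sub, fun t a ht => ?_⟩
  have h4 := (List.getElem?_eq_some_iff.1 ht).1
  have h5 := h.le_sub
  rw [h2, hm _ (by omega) (by omega)]
  exact h.get t a ht

/-- For the prefixes `p` with a full block, the table at `table` gives the number `st p` of the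
first row (or column) of the bottom list, and `st p + (p.len / X - 1)` is the number of the row
(or column) of `p`. -/
def TableAt {w : ℕ} (X : ℕ) (A : ℕ → Prop) (D : List (LocatedPrefix w))
    (st : LocatedPrefix w → ℕ) (s : Env w) : Prop :=
  ∀ p ∈ D, 0 < p.len / X → A (s.v table + p.node) ∧
    s.m (s.v table + p.node) = .word (BitVec.ofNat w (st p)) ∧
    s.v table + p.node < 2 ^ w ∧ st p + p.len / X < 2 ^ w

/-- The invariant of the scan of the left structure. -/
structure LeftInv {w n : ℕ} (O : Finset (Fin n)) (ra : LocatedPrefix w → ℕ)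
    (Fs : List (LocatedPrefix w)) (Ks : List (Fin n)) (s : Env w) : Prop where
  layout : Layout n s
  marks : Marks Ks s
  rowsAt : RowsAt (Fs.map ra) s
  common_eq : s.v common = (Ks.countP (· ∈ O)) % 2 ^ w

theorem LeftInv.congr {w n : ℕ} {O : Finset (Fin n)} {ra : LocatedPrefix w → ℕ}
    {Fs : List (LocatedPrefix w)} {Ks : List (Fin n)} {s s' : Env w} {Sc : ℕ}
    (h : LeftInv O ra Fs Ks s) (hs : Agree scanVars (OutsideSub s Sc) s s') :
    LeftInv O ra Fs Ks s' := by
  have h1 := h.layout.area_eq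
  have h2 := h.layout.rows_le
  have h3 := h.layout.sub_le
  refine ⟨h.layout.congr ?_, h.marks.congr ?_ fun a ha => hs.m a (Or.inl (by omega)),
    h.rowsAt.congr ?_ fun a _ ha => hs.m a (Or.inl ha), ?_⟩
  · intro x hx; apply hs.v; fin_cases hx <;> simp
  · intro x hx; apply hs.v; fin_cases hx <;> simp
  · intro x hx; apply hs.v; fin_cases hx <;> simp
  · rw [hs.v _ (by simp), h.common_eq]

/-- The cells in `A` are not changed by the actions during a scan. -/
def Avoids {w : ℕ} (A : ℕ → Prop) (s : Env w) : Prop :=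
  ∀ a, A a → ¬ (s.v fp ≤ a ∧ a < s.v area) ∧ ¬ (s.v rows ≤ a ∧ a < s.v sub)

section

variable {w n : ℕ} [NeZero w] {R X : ℕ} {s₀ s : Env w} {A : ℕ → Prop}
    {D : List (LocatedPrefix w)} {O : Finset (Fin n)} {ra st : LocatedPrefix w → ℕ}
    {Fs : List (LocatedPrefix w)} {Ks : List (Fin n)} {p : LocatedPrefix w} {κ : Fin n}

theorem exec_leftFull (hA : Avoids A s₀) (hD : s₀.v rows + D.length ≤ s₀.v sub)
    (htab : TableAt X A D st s₀)
    (hra : ∀ p ∈ D, 0 < p.len / X →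
      ra p = s₀.v matrix + (st p + (p.len / X - 1)) * s₀.v ncols ∧ ra p < 2 ^ w)
    (hp : p ∈ D) (hpre : Fs ++ [p] <+: D.filter (fun p => 0 < p.len / X))
    (hI : LeftInv O ra Fs Ks s) (hs : Agree (scanVars ++ hookVars) A s₀ s)
    (hk : s.v k = p.len / X) (hpos : 0 < p.len / X)
    (hnode : s.m (s.v cur) = .word (BitVec.ofNat w p.node)) :
    Exec R (leftFull R) s 22 fun s' => LeftInv O ra (Fs ++ [p]) Ks s' ∧ Agree hookVars A s s' := by
  have hw := NeZero.ne w
  obtain ⟨t1, t2, t3, t4⟩ := htab p hp hpos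
  obtain ⟨r1, r2⟩ := hra p hp hpos
  have e1 := hs.v table (by simp)
  have e2 := hs.v matrix (by simp)
  have e3 := hs.v ncols (by simp)
  have e4 := hs.v rows (by simp)
  have e5 := hs.v sub (by simp)
  have e6 := hs.v fp (by simp)
  have e7 := hs.v area (by simp)
  have hnr : s.v nrows = Fs.length := by rw [hI.rowsAt.nrows_eq]; simp
  have hlen : Fs.length + 1 ≤ D.length := by
    have := hpre.length_le.trans (List.length_filter_le _ _)
    simpa using this
  have l1 := hI.layout.area_eq
  have l2 := hI.layout.rows_le
  have l3 := hI.layout.sub_le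
  have l4 := hI.layout.sub_lt
  have v1 : (s.m (s.v cur)).toWord.toNat = p.node := by rw [hnode, toNat_word (by omega)]
  have v2 : (s.m (s.v table + p.node)).toWord.toNat = st p := by
    rw [e1, hs.m _ t1, t2, toNat_word (by omega)]
  refine (Exec.block ?_ ?_).mono (by simp) fun s' hs' => hs'
  · simp [hw, v1, v2, hk]
    rw [← e2, ← e3] at r1
    have : (st p + (p.len / X - 1)) * s.v ncols ≤ ra p := by omega
    omega
  · have hm : ∀ a, a ≠ s.v rows + s.v nrows →
        (Block.run s [.store (rows + nrows)
          (matrix + (.load (table + .load cur) + (k - 1)) * ncols),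
          .set nrows (nrows + 1)]).m a = s.m a := fun a ha => by simp [ha]
    refine ⟨⟨hI.layout.congr (by simp), hI.marks.congr (by simp) fun a ha => hm a (by omega), ?_,
      ?_⟩, fun x hx => ?_, rfl, fun a ha => hm a fun h => ?_⟩
    · refine ⟨by simp [hnr], by simp; omega, fun t a ht => ?_⟩
      rw [List.map_append, List.getElem?_append] at ht
      split_ifs at ht with hlt
      · simp only [List.length_map] at hlt
        rw [hm _ (by simp; omega)]
        exact hI.rowsAt.get t a ht
      · have ht' : t = Fs.length := by
          have := (List.getElem?_eq_some_iff.1 ht).1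
          simp at this hlt
          omega
        subst ht'
        simp at ht
        simp [hnr, v1, v2, hk, ← ht, r1, e2, e3]
    · simp [hI.common_eq]
    · simp at hx; simp [hx]
    · have := (hA a ha).2
      omega

/-- Marking a new color: it is appended to the list, and the array records its position there. The
colors of the left scan are distinct, so the list has room. -/
theorem exec_leftHook (hA : Avoids A s₀) (hpre : (Ks ++ [κ]).Nodup) (hI : LeftInv O ra Fs Ks s)
    (hs : Agree (scanVars ++ hookVars) A s₀ s) (hκ : s.v color = κ)
    (hres : s.v res = if κ ∈ O then 1 else 0) :
    Exec R (leftHook R) s 22 fun s' => LeftInv O ra Fs (Ks ++ [κ]) s' ∧ Agree hookVars A s s' := by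
  have hw := NeZero.ne w
  have e4 := hs.v rows (by simp)
  have e5 := hs.v sub (by simp)
  have e6 := hs.v fp (by simp)
  have e7 := hs.v area (by simp)
  have l0 := hI.layout.num_eq
  have l1 := hI.layout.area_eq
  have l2 := hI.layout.rows_le
  have l3 := hI.layout.sub_le
  have l4 := hI.layout.sub_lt
  have hlen : Ks.length + 1 ≤ n := by
    simpa using hpre.length_le_card
  have hmk := hI.marks.marked_eq
  have hκn := κ.isLt
  refine (Exec.block ?_ ?_).mono (by simp) fun s' hs' => hs'
  · simp [hw, hκ, hmk, l0]
    omega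
  · set s' := Block.run s [.set common (.bin .wadd common res), .store (fp + color) marked,
      .store (fp + num + marked) color, .set marked (marked + 1)] with hs'
    have hm : ∀ a, a ≠ s.v fp + κ → a ≠ s.v fp + n + Ks.length → s'.m a = s.m a :=
      fun a h1 h2 => by
        rw [hs']
        simp [hκ, hmk, l0, h1, h2]
    have hm1 : s'.m (s.v fp + κ) = .word (BitVec.ofNat w Ks.length) := by
      rw [hs']
      have : s.v fp + κ ≠ s.v fp + n + Ks.length := by omega
      simp [hκ, hmk, l0, this]
    have hm2 : s'.m (s.v fp + n + Ks.length) = .word (BitVec.ofNat w κ) := by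
      rw [hs']; simp [hκ, hmk, l0]
    have hfp : s'.v fp = s.v fp := by simp [hs']
    refine ⟨⟨hI.layout.congr (by simp [hs']), ⟨by simp [hs', hmk], by simpa using hlen,
      fun t κ' ht => ?_⟩, hI.rowsAt.congr (by simp [hs'])
      fun a h1 h2 => hm a (by omega) (by omega), ?_⟩, fun x hx => ?_, rfl, fun a ha => ?_⟩
    · rw [hfp]
      rw [List.getElem?_append] at ht
      split_ifs at ht with hlt
      · have hne : (κ' : ℕ) ≠ κ := by
          intro h
          rw [Fin.val_inj.1 h] at ht
          have h1 := List.mem_of_getElem? ht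
          rw [List.nodup_append] at hpre
          exact hpre.2.2 _ h1 κ (by simp) rfl
        have h3 := κ'.isLt
        rw [hm _ (by omega) (by omega), hm _ (by omega) (by omega)]
        exact hI.marks.get t κ' ht
      · have ht' : t = Ks.length := by
          have := (List.getElem?_eq_some_iff.1 ht).1
          simp at this
          omega
        subst ht'
        simp at ht
        subst ht
        exact ⟨hm2, hm1⟩
    · have : s'.v common = (s.v common + s.v res) % 2 ^ w := by simp [hs']
      rw [this, hI.common_eq, hres, Nat.mod_add_mod, List.countP_append]
      simp [List.countP_cons]
    · simp at hx; simp [hs', hx]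
    · have := hA a ha
      exact hm a (by omega) (by omega)

/-- The invariant of the scan of the right structure, after the scan of the left structure has
pushed the rows of the prefixes `FL`, marked the colors `KL`, and counted `c₀` colors. -/
structure RightInv {w n : ℕ} (O : Finset (Fin n)) (c₀ : ℕ) (ra : LocatedPrefix w → ℕ)
    (M : LocatedPrefix w → LocatedPrefix w → ℕ) (FL : List (LocatedPrefix w)) (KL : List (Fin n))
    (Fs : List (LocatedPrefix w)) (Ks : List (Fin n)) (s : Env w) : Prop where
  layout : Layout n s
  marks : Marks KL s
  rowsAt : RowsAt (FL.map ra) s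
  common_eq : s.v common = (c₀ + (Fs.map fun p' => (FL.map fun p => M p p').sum).sum +
    Ks.countP fun κ => κ ∈ O ∧ κ ∉ KL) % 2 ^ w

theorem RightInv.congr {w n : ℕ} {O : Finset (Fin n)} {c₀ : ℕ} {ra : LocatedPrefix w → ℕ}
    {M : LocatedPrefix w → LocatedPrefix w → ℕ} {FL : List (LocatedPrefix w)} {KL : List (Fin n)}
    {Fs : List (LocatedPrefix w)} {Ks : List (Fin n)} {s s' : Env w} {Sc : ℕ}
    (h : RightInv O c₀ ra M FL KL Fs Ks s) (hs : Agree scanVars (OutsideSub s Sc) s s') :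
    RightInv O c₀ ra M FL KL Fs Ks s' := by
  have h1 := h.layout.area_eq
  have h2 := h.layout.rows_le
  have h3 := h.layout.sub_le
  refine ⟨h.layout.congr ?_, h.marks.congr ?_ fun a ha => hs.m a (Or.inl (by omega)),
    h.rowsAt.congr ?_ fun a _ ha => hs.m a (Or.inl ha), ?_⟩
  · intro x hx; apply hs.v; fin_cases hx <;> simp
  · intro x hx; apply hs.v; fin_cases hx <;> simp
  · intro x hx; apply hs.v; fin_cases hx <;> simp
  · rw [hs.v _ (by simp), h.common_eq]

variable {c₀ : ℕ} {M : LocatedPrefix w → LocatedPrefix w → ℕ} {FL : List (LocatedPrefix w)}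
  {KL : List (Fin n)}

/-- For each pushed row, the entry of the matrix is found by adding the number of the column to the
address of the row. -/
theorem exec_rightFull (htab : TableAt X A D st s₀)
    (hra : ∀ p ∈ FL, ra p < 2 ^ w)
    (hM : ∀ p ∈ FL, ∀ p' ∈ D, 0 < p'.len / X → A (ra p + (st p' + (p'.len / X - 1))) ∧
      s₀.m (ra p + (st p' + (p'.len / X - 1))) = .word (BitVec.ofNat w (M p p')) ∧
      ra p + (st p' + (p'.len / X - 1)) < 2 ^ w)
    (hp : p ∈ D) (hI : RightInv O c₀ ra M FL KL Fs Ks s)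
    (hs : Agree (scanVars ++ hookVars) A s₀ s)
    (hk : s.v k = p.len / X) (hpos : 0 < p.len / X)
    (hnode : s.m (s.v cur) = .word (BitVec.ofNat w p.node)) :
    Exec R (rightFull R) s (FL.length * 30 + 10) fun s' =>
      RightInv O c₀ ra M FL KL (Fs ++ [p]) Ks s' ∧ Agree hookVars A s s' := by
  have hw := NeZero.ne w
  obtain ⟨t1, t2, t3, t4⟩ := htab p hp hpos
  have e1 := hs.v table (by simp)
  have e4 := hs.v rows (by simp)
  have e5 := hs.v sub (by simp)
  have hnr : s.v nrows = FL.length := by rw [hI.rowsAt.nrows_eq]; simp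
  have l3 := hI.rowsAt.le_sub
  have l4 := hI.layout.sub_lt
  rw [List.length_map] at l3
  have v1 : (s.m (s.v cur)).toWord.toNat = p.node := by rw [hnode, toNat_word (by omega)]
  have v2 : (s.m (s.v table + p.node)).toWord.toNat = st p := by
    rw [e1, hs.m _ t1, t2, toNat_word (by omega)]
  refine Exec.seq_le (FL.length * 30 + 4) (Exec.block (by simp) (Exec.mono (Exec.loop (t := 26)
    (fun r s' => s'.v t ≤ FL.length ∧ r = FL.length - s'.v t ∧
      (∀ x, x ∉ [common, t] → s'.v x = s.v x) ∧ s'.m = s.m ∧ s'.c = s.c ∧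
      s'.v common = (s.v common + ((FL.take (s'.v t)).map fun q => M q p).sum) % 2 ^ w)
    ?_ ?_ ?_ (k := FL.length) ?_) ?_ fun s' hs' => hs')) (by simp; omega)
  · simp
  · rintro r s' ⟨ht, hr, hv, hm, hc, hcom⟩ hlt
    have f1 := hv nrows (by simp)
    have f2 := hv rows (by simp)
    have f3 := hv table (by simp)
    have f4 := hv cur (by simp)
    have f5 := hv k (by simp)
    have hlt : s'.v t < FL.length := by
      by_contra hge
      simp [f1, hnr, hge] at hlt
    refine ⟨r - 1, by omega, ?_⟩
    set q := FL[s'.v t] with hq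
    have hget : FL[s'.v t]? = some q := List.getElem?_eq_getElem hlt
    have hqm : q ∈ FL := List.getElem_mem hlt
    have hra' := hra q hqm
    obtain ⟨m1, m2, m3⟩ := hM q hqm p hp hpos
    have v3 : (s'.m (s.v rows + s'.v t)).toWord.toNat = ra q := by
      rw [hm, hI.rowsAt.get _ (ra q) (by rw [List.getElem?_map, hget]; rfl), toNat_word hra']
    have v4 : (s'.m (ra q + (st p + (p.len / X - 1)))).toWord.toNat = M q p % 2 ^ w := by
      rw [hm, hs.m _ m1, m2]
      simp [Cell.toWord]
    have v1' : (s'.m (s.v cur)).toWord.toNat = p.node := by rw [hm, v1]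
    have v2' : (s'.m (s.v table + p.node)).toWord.toNat = st p := by rw [hm, v2]
    refine (Exec.block ?_ ?_).mono (by simp) fun s' hs' => hs'
    · simp [hw, v1', v2', v3, f2, f3, f4, f5, hk]
      omega
    · refine ⟨by simp; omega, by simp; omega, fun x hx => ?_, by simp [hm], by simp [hc], ?_⟩
      · simp at hx
        simp [hx, hv]
      · simp [v1', v2', v3, v4, f2, f3, f4, f5, hk, hcom]
        rw [List.take_add_one, List.getElem?_map, hget]
        simp [Nat.add_assoc]
  · rintro r s' ⟨ht, hr, hv, hm, hc, hcom⟩ hge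
    have f1 := hv nrows (by simp)
    have ht' : s'.v t = FL.length := by
      by_contra hne
      have : s'.v t < FL.length := by omega
      simp [f1, hnr, this] at hge
    rw [ht', List.take_length, hI.common_eq] at hcom
    refine ⟨⟨hI.layout.congr ?_, hI.marks.congr ?_ fun a _ => by rw [hm],
      hI.rowsAt.congr ?_ fun a _ _ => by rw [hm], ?_⟩, fun x hx => hv x ?_, hc,
      fun a _ => by rw [hm]⟩
    · intro x hx; apply hv; fin_cases hx <;> simp
    · intro x hx; apply hv; fin_cases hx <;> simp
    · intro x hx; apply hv; fin_cases hx <;> simp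
    · rw [hcom, Nat.mod_add_mod]
      congr 1
      simp
      ring
    · simp at hx
      simp [hx]
  · refine ⟨by simp, by simp, fun x hx => ?_, rfl, rfl, ?_⟩
    · simp at hx
      simp [hx]
    · simp [hI.common_eq]
  · simp

/-- A color is marked if its entry `t` in the array is a position in the list and the list has the
color there. An entry that has never been written may have any value, but it fails this test. -/
theorem exec_rightHook (hI : RightInv O c₀ ra M FL KL Fs Ks s) (hκ : s.v color = κ)
    (hres : s.v res = if κ ∈ O then 1 else 0) :
    Exec R (rightHook R) s 30 fun s' =>
      RightInv O c₀ ra M FL KL Fs (Ks ++ [κ]) s' ∧ Agree hookVars A s s' := by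
  have hw := NeZero.ne w
  have l0 := hI.layout.num_eq
  have l1 := hI.layout.area_eq
  have l2 := hI.layout.rows_le
  have l3 := hI.layout.sub_le
  have l4 := hI.layout.sub_lt
  have hmk := hI.marks.marked_eq
  have hle := hI.marks.length_le
  have hκn := κ.isLt
  have key : ∀ (s' : Env w), s'.m = s.m → s'.c = s.c →
      (∀ x, x ∉ [common, t] → s'.v x = s.v x) →
      s'.v common = (s.v common + if κ ∈ O ∧ κ ∉ KL then 1 else 0) % 2 ^ w →
      RightInv O c₀ ra M FL KL Fs (Ks ++ [κ]) s' ∧ Agree hookVars A s s' := by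
    intro s' hm hc hv hcom
    refine ⟨⟨hI.layout.congr ?_, hI.marks.congr ?_ fun a _ => by rw [hm],
      hI.rowsAt.congr ?_ fun a _ _ => by rw [hm], ?_⟩, fun x hx => hv x ?_, hc,
      fun a _ => by rw [hm]⟩
    · intro x hx; apply hv; fin_cases hx <;> simp
    · intro x hx; apply hv; fin_cases hx <;> simp
    · intro x hx; apply hv; fin_cases hx <;> simp
    · rw [hcom, hI.common_eq, Nat.mod_add_mod, List.countP_append]
      congr 1
      simp [List.countP_cons, Nat.add_assoc]
    · simp at hx
      simp [hx]
  refine Exec.seq_le 24 (Exec.block ?_ ?_) (by simp)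
  · simp [hκ]; omega
  · set q := (s.m (s.v fp + κ)).toWord.toNat with hq
    refine (Exec.ite (t := 17) (t' := 17) (by simp) (fun h => ?_) fun h => ?_).mono (by simp)
      fun s' hs' => hs'
    · have hlt : q < KL.length := by
        by_contra hge
        simp [hκ, hmk, ← hq, hge] at h
      set κ' := KL[q] with hκ'
      have hget : KL[q]? = some κ' := List.getElem?_eq_getElem hlt
      have v1 : (s.m (s.v fp + n + q)).toWord.toNat = κ' := by
        rw [(hI.marks.get q κ' hget).1, toNat_word (by have := κ'.isLt; omega)]
      have hiff : κ' = κ ↔ κ ∈ KL := by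
        refine ⟨fun h => h ▸ List.getElem_mem hlt, fun h => ?_⟩
        obtain ⟨u, hu, hu'⟩ := List.getElem_of_mem h
        have h1 : KL[u]? = some κ := by rw [List.getElem?_eq_getElem hu, hu']
        have h2 := (hI.marks.get u κ h1).2
        have h3 : q = u := by rw [hq, h2, toNat_word (by omega)]
        subst h3
        exact hu'
      refine (Exec.block ?_ ?_).mono (by simp) fun s' hs' => hs'
      · simp [hw, hκ, ← hq, l0, v1, hres]
        have h1 : 1 < 2 ^ w := Nat.one_lt_two_pow hw
        split_ifs <;> omega
      · refine key _ rfl rfl (fun x hx => ?_) ?_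
        · simp at hx; simp [hx]
        · simp only [← hiff]
          simp [hκ, ← hq, l0, v1, hres, Fin.val_inj]
          congr 2
          by_cases h1 : κ ∈ O <;> by_cases h2 : κ' = κ <;> simp [h1, h2]
    · have hge : ¬ q < KL.length := fun hlt => by simp [hκ, hmk, ← hq, hlt] at h
      have hnot : κ ∉ KL := by
        intro h
        obtain ⟨u, hu, hu'⟩ := List.getElem_of_mem h
        have h1 : KL[u]? = some κ := by rw [List.getElem?_eq_getElem hu, hu']
        have h2 := (hI.marks.get u κ h1).2
        have h3 : q = u := by rw [hq, h2, toNat_word (by omega)]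
        omega
      refine (Exec.block ?_ ?_).mono (by simp) fun s' hs' => hs'
      · simp
      · refine key _ rfl rfl (fun x hx => ?_) ?_
        · simp at hx; simp [hx]
        · simp [hres, hnot]

end

end Hooks

/-! ### Counting the common colors -/

theorem countP_mem_eq_card_inter {α : Type*} [DecidableEq α] {l : List α} (hl : l.Nodup)
    (S : Finset α) : l.countP (· ∈ S) = (l.toFinset ∩ S).card := by
  have : l.toFinset ∩ S = (l.filter (· ∈ S)).toFinset := by ext; simp
  rw [this, List.countP_eq_length_filter, List.toFinset_card_of_nodup (hl.filter _)]

theorem countP_flatMap' {α β : Type*} (l : List α) (f : α → List β) (p : β → Bool) :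
    (l.flatMap f).countP p = (l.map fun x => (f x).countP p).sum := by
  induction l with
  | nil => simp
  | cons x l ih => simp [ih]

theorem sum_map_filter {α : Type*} (l : List α) (p : α → Bool) (f : α → ℕ)
    (h : ∀ x ∈ l, p x = false → f x = 0) : ((l.filter p).map f).sum = (l.map f).sum := by
  induction l with
  | nil => simp
  | cons x l ih =>
    have ih := ih fun y hy => h y (by simp [hy])
    cases hx : p x
    · rw [List.filter_cons_of_neg (by simp [hx]), ih, List.map_cons, List.sum_cons,
        h x (by simp) hx, Nat.zero_add]
    · rw [List.filter_cons_of_pos hx, List.map_cons, List.sum_cons, ih, List.map_cons,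
        List.sum_cons]

/-- Each of `L` and `R` is listed without repetition by lists `f p ++ r p`.  Common elements lie
in lists `f p` on both sides, or in some `r p` on the left, or in some `r p` on the right but in
none on the left. -/
theorem count_common {α β β' : Type*} [DecidableEq α] {DL : List β} {DR : List β'}
    {fL rL : β → List α} {fR rR : β' → List α} {L R : Finset α}
    (ndL : (DL.flatMap fun p => fL p ++ rL p).Nodup)
    (ndR : (DR.flatMap fun p => fR p ++ rR p).Nodup)
    (hL : ∀ κ, κ ∈ L ↔ κ ∈ DL.flatMap fun p => fL p ++ rL p)
    (hR : ∀ κ, κ ∈ R ↔ κ ∈ DR.flatMap fun p => fR p ++ rR p)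
    (bL : β → Bool) (bR : β' → Bool)
    (hbL : ∀ p ∈ DL, bL p = false → fL p = []) (hbR : ∀ p ∈ DR, bR p = false → fR p = []) :
    (DL.flatMap rL).countP (· ∈ R) +
      ((DR.filter bR).map fun p' =>
        ((DL.filter bL).map fun p => ((fL p).toFinset ∩ (fR p').toFinset).card).sum).sum +
      (DR.flatMap rR).countP (fun κ => κ ∈ L ∧ κ ∉ DL.flatMap rL) = (L ∩ R).card := by
  have pL := List.flatMap_append_perm DL fL rL
  have pR := List.flatMap_append_perm DR fR rR
  have nL := pL.nodup_iff.2 ndL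
  have nR := pR.nodup_iff.2 ndR
  set FL := DL.flatMap fL with hFL
  set KL := DL.flatMap rL with hKL
  set FR := DR.flatMap fR with hFR
  set KR := DR.flatMap rR with hKR
  have hL' : L = (FL ++ KL).toFinset := by
    ext κ; rw [hL, ← pL.mem_iff, List.mem_toFinset]
  have hR' : R = (FR ++ KR).toFinset := by
    ext κ; rw [hR, ← pR.mem_iff, List.mem_toFinset]
  have nFL := (List.nodup_append.1 nL).1
  have nFR := (List.nodup_append.1 nR).1
  have e1 : (L ∩ R).card = FL.countP (· ∈ R) + KL.countP (· ∈ R) := by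
    rw [hL', ← countP_mem_eq_card_inter nL, List.countP_append]
  have e2 : FL.countP (· ∈ R) = FR.countP (· ∈ FL.toFinset) + KR.countP (· ∈ FL.toFinset) := by
    rw [countP_mem_eq_card_inter nFL, hR', Finset.inter_comm, ← countP_mem_eq_card_inter nR,
      List.countP_append]
  have e3 : KR.countP (fun κ => κ ∈ L ∧ κ ∉ KL) = KR.countP (· ∈ FL.toFinset) := by
    refine List.countP_congr fun κ _ => ?_
    simp only [decide_eq_true_eq, hL', List.mem_toFinset, List.mem_append]
    have := (List.nodup_append.1 nL).2.2
    constructor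
    · rintro ⟨h | h, h'⟩
      · exact h
      · exact absurd h h'
    · exact fun h => ⟨Or.inl h, fun h' => this κ h κ h' rfl⟩
  have e4 : FR.countP (· ∈ FL.toFinset) = ((DR.filter bR).map fun p' =>
      ((DL.filter bL).map fun p => ((fL p).toFinset ∩ (fR p').toFinset).card).sum).sum := by
    rw [sum_map_filter _ _ _ fun p' hp' hb => ?_]
    · rw [hFR, countP_flatMap']
      congr 1
      refine List.map_congr_left fun p' hp' => ?_
      have nf : (fR p').Nodup := (List.nodup_flatMap.1 nFR).1 p' hp'
      rw [countP_mem_eq_card_inter nf, Finset.inter_comm, ← countP_mem_eq_card_inter nFL, hFL,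
        countP_flatMap', sum_map_filter]
      · congr 1
        refine List.map_congr_left fun p hp => ?_
        exact countP_mem_eq_card_inter ((List.nodup_flatMap.1 nFL).1 p hp) _
      · intro p hp hb
        simp [hbL p hp hb]
    · simp [hbR p' hp' hb]
  omega

/-! ### Ranks -/

section Rank

open Var CVar

/-- Computes the interval `[a, b)` of the positions, in a sorted list, of the elements between
`u` and `u'`. -/
def rankSearch (R : ℕ) (e e' : Expr) (u u' : CVar) (a b : Var) : Cmd :=
  .seq (Block.code R [.set tab e, .set len e', .cmove key u])
    (.seq (search R true)
    (.seq (Block.code R [.set a low, .cmove key u'])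
    (.seq (search R false)
      (Block.code R [.set b low]))))

/-- The interval is found by a search for the elements `< s.c u` and a search for the elements
`≤ s.c u'`; it is empty, possibly with `b < a`, if no element lies between. -/
theorem exec_rankSearch {w : ℕ} [NeZero w] {R : ℕ} {s : Env w} {e e' : Expr} {u u' : CVar}
    {a b : Var} {L : List ℝ} (he : e.Ok s)
    (he' : e'.Ok { s with v := Function.update s.v tab (e.ev s) })
    (hlen : e'.ev { s with v := Function.update s.v tab (e.ev s) } = L.length)
    (hL : L.Pairwise (· ≤ ·)) (hst : StoredAt s.m (e.ev s) (L.map Cell.coord))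
    (h1 : e.ev s + L.length < 2 ^ w) (h2 : 2 * L.length < 2 ^ w)
    (hu' : u' ∉ [key, tmp])
    (ha : a ∉ [tab, len, low, high, mid]) (hab : a ≠ b)
    {t : ℕ} (ht : L.length < 2 ^ t) :
    Exec R (rankSearch R e e' u u' a b) s (e.cost + e'.cost + t * 54 + 40) fun s' =>
      s'.m = s.m ∧ (∀ x, x ∉ [tab, len, low, high, mid, a, b] → s'.v x = s.v x) ∧
      (∀ x, x ∉ [key, tmp] → s'.c x = s.c x) ∧ s'.v a ≤ L.length ∧ s'.v b ≤ L.length ∧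
      ∀ (i : ℕ) (x : ℝ), L[i]? = some x →
        (s'.v a ≤ i ∧ i < s'.v b ↔ s.c u ≤ x ∧ x ≤ s.c u') := by
  simp only [List.mem_cons, List.not_mem_nil, or_false, not_or] at hu' ha
  refine Exec.seq_le (t * 54 + 35) (Exec.block ⟨he, he', trivial, trivial⟩ ?_)
    (by simp; omega)
  set s1 := Block.run s [.set tab e, .set len e', .cmove key u] with hs1
  refine Exec.seq_of (t * 27 + 20) (exec_search hL (by simpa [hs1] using hst) (by simpa [hs1])
    (by simpa [hs1]) h2 ht) (by omega) ?_
  rintro s2 ⟨m2, v2, c2, l2, p2⟩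
  refine Exec.seq_le (t * 27 + 15) (Exec.block (by simp) ?_) (by simp; omega)
  set s3 := Block.run s2 [.set a low, .cmove key u'] with hs3
  have e3 : ∀ x, x ≠ a → s3.v x = s2.v x := fun x hx => by simp [hs3, hx]
  have tab3 : s3.v tab = e.ev s := by
    rw [e3 _ (Ne.symm ha.1), v2 _ (by simp)]; simp [hs1]
  have len3 : s3.v len = L.length := by
    rw [e3 _ (Ne.symm ha.2.1), v2 _ (by simp)]; simp [hs1, hlen]
  have m3 : s3.m = s.m := by
    change s2.m = _
    rw [m2]; rfl
  refine Exec.seq_of 4 (exec_search hL (by rw [m3, tab3]; exact hst) len3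
    (by rw [tab3]; exact h1) h2 ht) (by omega) ?_
  rintro s4 ⟨m4, v4, c4, l4, p4⟩
  refine (Exec.block ?_ ?_).mono (by simp) fun s' hs' => hs'
  · simp
  · have ea : Block.run s4 [.set b low] = { s4 with v := Function.update s4.v b (s4.v low) } := by
      simp
    have hva : s4.v a = s2.v low := by
      rw [v4 a (by simp [ha]), hs3]; simp
    rw [ea]
    refine ⟨m4.trans m3, fun x hx => ?_, fun x hx => ?_, ?_, ?_, fun i x hi => ?_⟩
    · simp only [List.mem_cons, List.not_mem_nil, or_false, not_or] at hx
      simp only [ne_eq, hx, not_false_eq_true, Function.update_of_ne]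
      rw [v4 x (by simp [hx]), e3 x hx.2.2.2.2.2.1, v2 x (by simp [hx])]
      simp [hs1, hx]
    · simp only [List.mem_cons, List.not_mem_nil, or_false, not_or] at hx
      change s4.c x = _
      rw [c4 x hx.2]
      simp only [hs3, Block.run, Assign.run]
      rw [Function.update_of_ne hx.1, c2 x hx.2]
      simp [hs1, hx]
    · simpa [hab, hva] using l2
    · simpa using l4
    · have h5 := p2 i x hi
      have h6 := p4 i x hi
      have k1 : s1.c key = s.c u := by simp [hs1]
      have k3 : s3.c key = s.c u' := by
        simp only [hs3, Block.run, Assign.run, Function.update_self]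
        rw [c2 _ hu'.2]
        simp [hs1, hu']
      rw [k1] at h5
      rw [k3] at h6
      simp only [Below, if_true, Bool.false_eq_true, if_false] at h5 h6
      simp only [ne_eq, hab, not_false_eq_true, Function.update_of_ne, Function.update_self, hva,
        h6]
      rw [← not_lt, ← h5, not_lt]

end Rank

/-! ### The query at a node of the range tree -/

section NodeQuery

open Var CVar

/-- The conditions on the stabbing structure of one side: the located prefixes `D` contain the
boxes stabbed by `q`, whose colors are distinct and form the set `L`.  The list `tbl` gives the
number of the first row (or column) of each bottom list. -/
structure SideSpec {w N n : ℕ} (X W Sc : ℕ) (locate length report : Cmd)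
    (img : List (Cell w)) (q : List ℝ) (D : List (LocatedPrefix w))
    (bx : LocatedPrefix w → List (Fin N)) (colr : Fin N → Fin n) (L : Finset (Fin n))
    (st : LocatedPrefix w → ℕ) (tbl : List ℕ) (scratch tq tl tr : ℝ) : Prop where
  scratch_le : scratch ≤ Sc
  answers_locate : Answers locate img [] q scratch tq fun fp σ => (σ.reg 0).toNat = D.length ∧
    StoredAt σ.mem fp (D.flatMap fun p => p.words.map Cell.word)
  answers_length : ∀ p ∈ D, Answers length img p.words [] scratch tl
    fun _ σ => (σ.reg 0).toNat = p.len
  answers_report : ∀ p ∈ D, ∀ (j : ℕ) (i : Fin N), (bx p)[j]? = some i →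
    Answers report img (p.words ++ [BitVec.ofNat w j]) [] scratch tr
      fun _ σ => (σ.reg 0).toNat = i
  words_length : ∀ p ∈ D, p.words.length = W
  box_length : ∀ p ∈ D, (bx p).length = p.len
  nodup : (D.flatMap fun p => (bx p).map colr).Nodup
  mem_iff : ∀ κ, κ ∈ L ↔ κ ∈ D.flatMap fun p => (bx p).map colr
  tbl_get : ∀ p ∈ D, 0 < p.len / X → tbl[p.node]? = some (st p) ∧ st p + p.len / X < 2 ^ w

/-- The conditions on the emptiness structure of one side: the points of `Ls` have the sorted
`x`-coordinates `xs`, and `O` is the set of colors of the points in `[a, b] × [ylo, yhi]`, where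
`ylo` and `yhi` are `y`-ranks. -/
structure ProbeSpec {w n : ℕ} (Sc : ℕ) (query : Cmd) (img : List (Cell w))
    (Ls : List (ℕ × Fin n)) (xs : List ℝ) (a b : ℝ) (ylo yhi : ℕ) (O : Finset (Fin n))
    (scratch time : ℝ) : Prop where
  scratch_le : scratch ≤ Sc
  answers : ∀ (κ : Fin n) (x₁ x₂ y₁ y₂ : Fin Ls.length), Answers query img
      [BitVec.ofNat w κ, BitVec.ofNat w x₁, BitVec.ofNat w x₂, BitVec.ofNat w y₁,
        BitVec.ofNat w y₂] [] scratch time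
      fun _ σ => (HasColorIn Ls κ x₁ x₂ y₁ y₂ → σ.reg 0 = 1#w) ∧
        (¬ HasColorIn Ls κ x₁ x₂ y₁ y₂ → σ.reg 0 = 0#w)
  length_eq : xs.length = Ls.length
  length_le : Ls.length ≤ n
  sorted : xs.Pairwise (· ≤ ·)
  ylo_lt : ylo < Ls.length
  yhi_lt : yhi < Ls.length
  mem_iff : ∀ κ, κ ∈ O ↔ ∃ (i y : ℕ) (x : ℝ), Ls[i]? = some (y, κ) ∧ xs[i]? = some x ∧
    (a ≤ x ∧ x ≤ b) ∧ (ylo ≤ y ∧ y ≤ yhi)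

/-- The list `L` is stored at the address `a`, below the address `lim`. -/
structure StoredBelow {w : ℕ} (lim : ℕ) (m : ℕ → Cell w) (a : ℕ) (L : List (Cell w)) : Prop where
  stored : StoredAt m a L
  le : a + L.length ≤ lim

/-- The words for a list of numbers. -/
abbrev natCells (w : ℕ) (l : List ℕ) : List (Cell w) := l.map fun x => .word (BitVec.ofNat w x)

/-- The parts of the memory image that belong to a node. -/
structure NodeParts (w : ℕ) where
  imgL : List (Cell w)
  colL : List (Cell w)
  imgR : List (Cell w)
  colR : List (Cell w)
  empL : List (Cell w)
  empR : List (Cell w)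
  mat : List (Cell w)
  ncol : ℕ
  tblL : List ℕ
  tblR : List ℕ
  xsL : List ℝ
  xsR : List ℝ

/-- The parts of a node are stored relative to the address `b`, at the offsets recorded in the
twelve words from address `e` on; the eighth word is the number of columns of the matrix. -/
structure NodeStored {w : ℕ} (lim : ℕ) (m : ℕ → Cell w) (b e : ℕ) (p : NodeParts w)
    (off : ℕ → ℕ) : Prop where
  entry : ∀ k, k < 12 → m (e + k) = .word (BitVec.ofNat w (off k))
  entry_le : e + 12 ≤ lim
  off_lt : ∀ k, k < 12 → b + off k < 2 ^ w
  imgL : StoredBelow lim m (b + off 0) p.imgL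
  colL : StoredBelow lim m (b + off 1) p.colL
  imgR : StoredBelow lim m (b + off 2) p.imgR
  colR : StoredBelow lim m (b + off 3) p.colR
  empL : StoredBelow lim m (b + off 4) p.empL
  empR : StoredBelow lim m (b + off 5) p.empR
  mat : StoredBelow lim m (b + off 6) p.mat
  ncol : off 7 = p.ncol
  tblL : StoredBelow lim m (b + off 8) (natCells w p.tblL)
  tblR : StoredBelow lim m (b + off 9) (natCells w p.tblR)
  xsL : StoredBelow lim m (b + off 10) (p.xsL.map Cell.coord)
  xsR : StoredBelow lim m (b + off 11) (p.xsR.map Cell.coord)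

theorem StoredBelow.congr {w lim a : ℕ} {m m' : ℕ → Cell w} {L : List (Cell w)}
    (h : StoredBelow lim m a L) (hm : ∀ a, a < lim → m' a = m a) : StoredBelow lim m' a L :=
  ⟨h.stored.congr fun i hi => hm _ (by have := h.le; omega), h.le⟩

theorem NodeStored.congr {w lim b e : ℕ} {m m' : ℕ → Cell w} {p : NodeParts w} {off : ℕ → ℕ}
    (h : NodeStored lim m b e p off) (hm : ∀ a, a < lim → m' a = m a) :
    NodeStored lim m' b e p off where
  entry k hk := by rw [hm _ (by have := h.entry_le; omega), h.entry k hk]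
  entry_le := h.entry_le
  off_lt := h.off_lt
  imgL := h.imgL.congr hm
  colL := h.colL.congr hm
  imgR := h.imgR.congr hm
  colR := h.colR.congr hm
  empL := h.empL.congr hm
  empR := h.empR.congr hm
  mat := h.mat.congr hm
  ncol := h.ncol
  tblL := h.tblL.congr hm
  tblR := h.tblR.congr hm
  xsL := h.xsL.congr hm
  xsR := h.xsR.congr hm

/-- The word number `k` of the record of the node. -/
def fld (k : ℕ) : Expr := .load (entry + .lit k)

/-- The variables that are set before a scan. -/
abbrev setupVars : List Var :=
  [tab, len, low, high, mid, x1, x2, y1, y2, simg, cols, table, eimg, matrix, ncols, count, cur]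

/-- The expression has the value `a`, even after changes of the variables in `setupVars`. -/
def Gives {w : ℕ} (s : Env w) (e : Expr) (a : ℕ) : Prop :=
  ∀ s' : Env w, (∀ x, x ∉ setupVars → s'.v x = s.v x) → s'.m = s.m → e.Ok s' ∧ e.ev s' = a

theorem gives_fld {w : ℕ} {s : Env w} {k b : ℕ} (h1 : s.v entry + k < 2 ^ w) (hb : b < 2 ^ w)
    (h2 : s.m (s.v entry + k) = .word (BitVec.ofNat w b)) : Gives s (fld k) b := by
  intro s' hv hm
  have := hv entry (by simp)
  refine ⟨?_, ?_⟩
  · simp [fld, this]; omega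
  · simp [fld, this, hm, h2, toNat_word hb]

theorem gives_base_fld {w : ℕ} {s : Env w} {k b : ℕ} (h1 : s.v entry + k < 2 ^ w)
    (hb : s.v base + b < 2 ^ w) (h2 : s.m (s.v entry + k) = .word (BitVec.ofNat w b)) :
    Gives s (base + fld k) (s.v base + b) := by
  intro s' hv hm
  have := hv base (by simp)
  obtain ⟨h3, h4⟩ := gives_fld h1 (by omega) h2 s' hv hm
  exact ⟨by simp [this, h3, h4, hb], by simp [this, h4]⟩

/-- Assignments of expressions that do not depend on the variables assigned: all of them take effect
together. -/
theorem sets_spec {w : ℕ} {s : Env w} (l : List (Var × Expr × ℕ))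
    (hl : ∀ p ∈ l, p.1 ∈ setupVars ∧ Gives s p.2.1 p.2.2) (hnd : (l.map Prod.fst).Nodup)
    {s1 : Env w} (hv : ∀ x, x ∉ setupVars → s1.v x = s.v x) (hm : s1.m = s.m) :
    Block.Ok s1 (l.map fun p => .set p.1 p.2.1) ∧
    (∀ p ∈ l, (Block.run s1 (l.map fun p => .set p.1 p.2.1)).v p.1 = p.2.2) ∧
    (∀ x, x ∉ l.map Prod.fst → (Block.run s1 (l.map fun p => .set p.1 p.2.1)).v x = s1.v x) ∧
    (Block.run s1 (l.map fun p => .set p.1 p.2.1)).m = s1.m ∧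
    (Block.run s1 (l.map fun p => .set p.1 p.2.1)).c = s1.c := by
  induction l generalizing s1 with
  | nil => simp
  | cons p l ih =>
    obtain ⟨hp, hg⟩ := hl p (by simp)
    obtain ⟨ho, he⟩ := hg s1 hv hm
    rw [List.map_cons, List.nodup_cons] at hnd
    obtain ⟨i1, i2, i3, i4, i5⟩ := ih (fun p hp => hl p (by simp [hp])) hnd.2
      (s1 := (Assign.set p.1 p.2.1).run s1) (fun x hx => by
        have : x ≠ p.1 := fun h => hx (h ▸ hp)
        simp [this, hv x hx]) hm
    simp only [List.map_cons, Block.Ok, Block.run]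
    refine ⟨⟨ho, i1⟩, ?_, ?_, i4, i5⟩
    · simp only [List.mem_cons, forall_eq_or_imp]
      refine ⟨?_, i2⟩
      rw [i3 _ hnd.1]
      simp [he]
    · intro x hx
      simp only [List.mem_cons, not_or] at hx
      rw [i3 x hx.2]
      simp [hx.1]

/-- What a scan needs: the parts of the record for this scan are those with the numbers `kx`, …,
and `e`, `e'`, … give the number of points, the bounds on `y`-ranks, and the list of prefixes. -/
def scanSetup (R kx kimg kcol ktab kemp : ℕ) (e ey ey' ecount ecur : Expr) : Cmd :=
  .seq (rankSearch R (base + fld kx) e xmin xmax x1 x2)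
    (Block.code R [.set y1 ey, .set y2 ey', .set simg (base + fld kimg),
      .set cols (base + fld kcol), .set table (base + fld ktab), .set eimg (base + fld kemp),
      .set matrix (base + fld 6), .set ncols (fld 7), .set count ecount, .set cur ecur])

/-- After the setup, the variables of the scan have the values that the record of the node
prescribes, and `[x1, x2)` is the interval of the positions of the points between `xmin` and
`xmax`. -/
theorem exec_scanSetup {w : ℕ} [NeZero w] {R kx kimg kcol ktab kemp : ℕ}
    {e ey ey' ecount ecur : Expr} {s : Env w} {p : NodeParts w} {off : ℕ → ℕ}
    (h : NodeStored (s.v fp) s.m (s.v base) (s.v entry) p off)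
    (hk : kx < 12 ∧ kimg < 12 ∧ kcol < 12 ∧ ktab < 12 ∧ kemp < 12) {xs : List ℝ}
    (hxs : StoredBelow (s.v fp) s.m (s.v base + off kx) (xs.map Cell.coord))
    (hsorted : xs.Pairwise (· ≤ ·)) {ylo yhi N c : ℕ}
    (he : Gives s e xs.length) (hey : Gives s ey ylo) (hey' : Gives s ey' yhi)
    (hecount : Gives s ecount N) (hecur : Gives s ecur c)
    (hcost : e.cost ≤ 10 ∧ ey.cost ≤ 10 ∧ ey'.cost ≤ 10 ∧ ecount.cost ≤ 10 ∧ ecur.cost ≤ 10)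
    (hfp : s.v fp < 2 ^ w) (h2 : 2 * xs.length < 2 ^ w) {t : ℕ} (ht : xs.length < 2 ^ t) :
    Exec R (scanSetup R kx kimg kcol ktab kemp e ey ey' ecount ecur) s (t * 54 + 200) fun s' =>
      s'.m = s.m ∧ (∀ x, x ∉ setupVars → s'.v x = s.v x) ∧
      (∀ x, x ∉ [key, tmp] → s'.c x = s.c x) ∧
      s'.v y1 = ylo ∧ s'.v y2 = yhi ∧ s'.v simg = s.v base + off kimg ∧
      s'.v cols = s.v base + off kcol ∧ s'.v table = s.v base + off ktab ∧
      s'.v eimg = s.v base + off kemp ∧ s'.v matrix = s.v base + off 6 ∧ s'.v ncols = off 7 ∧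
      s'.v count = N ∧ s'.v cur = c ∧ s'.v x2 ≤ xs.length ∧
      ∀ (i : ℕ) (x : ℝ), xs[i]? = some x →
        (s'.v x1 ≤ i ∧ i < s'.v x2 ↔ s.c xmin ≤ x ∧ x ≤ s.c xmax) := by
  obtain ⟨hc1, hc2, hc3, hc4, hc5⟩ := hcost
  obtain ⟨hk1, hk2, hk3, hk4, hk5⟩ := hk
  have hent := h.entry_le
  have hg : ∀ k, k < 12 → Gives s (base + fld k) (s.v base + off k) := fun k hk =>
    gives_base_fld (by omega) (h.off_lt k hk) (h.entry k hk)
  obtain ⟨g1, g2⟩ := hg kx hk1 s (fun _ _ => rfl) rfl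
  have hxle := hxs.le
  rw [List.length_map] at hxle
  have g3 := he { s with v := Function.update s.v tab ((Expr.var base + fld kx).ev s) }
    (fun x hx => by
      have : x ≠ tab := by rintro rfl; simp at hx
      simp [this]) rfl
  refine Exec.seq_of 130 (exec_rankSearch (L := xs) g1 ?_ ?_ hsorted ?_ ?_ h2 (by simp)
    (by simp) (by simp) ht) ?_ ?_
  · exact g3.1
  · exact g3.2
  · rw [g2]; exact hxs.stored
  · rw [g2]; omega
  · simp [fld]; omega
  · rintro s1 ⟨m1, v1, c1, -, l1, r1⟩
    have hv1 : ∀ x, x ∉ setupVars → s1.v x = s.v x := fun x hx => v1 x fun h => hx (by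
      simp only [List.mem_cons, List.not_mem_nil, or_false] at h
      rcases h with rfl | rfl | rfl | rfl | rfl | rfl | rfl <;> simp)
    obtain ⟨b1, b2, b3, b4, b5⟩ := sets_spec (s := s) (s1 := s1) [(y1, ey, ylo), (y2, ey', yhi),
      (simg, base + fld kimg, s.v base + off kimg), (cols, base + fld kcol, s.v base + off kcol),
      (table, base + fld ktab, s.v base + off ktab),
      (eimg, base + fld kemp, s.v base + off kemp),
      (matrix, base + fld 6, s.v base + off 6), (ncols, fld 7, off 7), (count, ecount, N),
      (cur, ecur, c)] (by
        simp only [List.mem_cons, List.not_mem_nil, or_false, forall_eq_or_imp, forall_eq]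
        exact ⟨⟨by simp, hey⟩, ⟨by simp, hey'⟩, ⟨by simp, hg _ hk2⟩, ⟨by simp, hg _ hk3⟩,
          ⟨by simp, hg _ hk4⟩, ⟨by simp, hg _ hk5⟩, ⟨by simp, hg _ (by omega)⟩,
          ⟨by simp, gives_fld (by omega) (by have := h.off_lt 7 (by omega); omega)
            (h.entry 7 (by omega))⟩, ⟨by simp, hecount⟩, ⟨by simp, hecur⟩⟩) (by simp) hv1 m1
    simp only [List.mem_cons, List.not_mem_nil, or_false, forall_eq_or_imp, forall_eq] at b2
    obtain ⟨d1, d2, d3, d4, d5, d6, d7, d8, d9, d10⟩ := b2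
    refine (Exec.block b1 ?_).mono ?_ fun s' hs' => hs'
    · refine ⟨b4.trans m1, fun x hx => ?_, fun x hx => ?_, d1, d2, d3, d4, d5, d6, d7, d8, d9, d10,
        ?_, fun i x hi => ?_⟩
      · rw [b3 x fun h => hx ?_, hv1 x hx]
        simp only [List.map_cons, List.map_nil, List.mem_cons, List.not_mem_nil, or_false] at h
        rcases h with rfl | rfl | rfl | rfl | rfl | rfl | rfl | rfl | rfl | rfl <;> simp
      · rw [b5]
        exact c1 x hx
      · rw [b3 _ (by simp)]
        exact l1
      · rw [b3 x1 (by simp), b3 x2 (by simp)]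
        exact r1 i x hi
    · simp [fld]
      omega

/-- The cells that do not change during a scan. -/
def Kept {w : ℕ} (s : Env w) (Sc a : ℕ) : Prop :=
  a < s.v fp ∨ (s.v area ≤ a ∧ a < s.v rows) ∨ s.v sub + Sc ≤ a

/-- The specifications of the stabbing structure of one side and of the emptiness structure of the
other side, together with the rules for `full` and `hook`, give the conditions for a scan. -/
theorem scanSpec_of {w N n : ℕ} [NeZero w] {R X W Sc : ℕ}
    {locate length report query full hook : Cmd}
    {s₀ : Env w} {D : List (LocatedPrefix w)} {img emp : List (Cell w)} {q : List ℝ}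
    {bx : LocatedPrefix w → List (Fin N)} {colr : Fin N → Fin n} {L O : Finset (Fin n)}
    {st : LocatedPrefix w → ℕ} {tbl : List ℕ} {scratch tq tl tr scratch' te : ℝ}
    {Ls : List (ℕ × Fin n)} {xs : List ℝ}
    {I : List (LocatedPrefix w) → List (Fin n) → Env w → Prop} {Tf Th : ℕ}
    (side : SideSpec X W Sc locate length report img q D bx colr L st tbl scratch tq tl tr)
    (hprobe : ProbeSpec Sc query emp Ls xs (s₀.c xmin) (s₀.c xmax) (s₀.v y1) (s₀.v y2) O
      scratch' te)
    (hRl : length.bound ≤ R) (hRr : report.bound ≤ R) (hRq : query.bound ≤ R) (hRW : W + 3 ≤ R)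
    (hR7 : 7 ≤ R) (hX : 1 ≤ X) (hblk : s₀.v blk = X) (hlay : Layout n s₀)
    (hsc : s₀.v sub + Sc ≤ 2 ^ w)
    (himg : StoredBelow (s₀.v fp) s₀.m (s₀.v simg) img)
    (hcol : StoredBelow (s₀.v fp) s₀.m (s₀.v cols)
      (List.ofFn fun i => Cell.word (BitVec.ofNat w (colr i))))
    (hemp : StoredBelow (s₀.v fp) s₀.m (s₀.v eimg) emp)
    (hwords : StoredAt s₀.m (s₀.v cur) (D.flatMap fun p => p.words.map Cell.word))
    (hcur : s₀.v area ≤ s₀.v cur) (hcur' : s₀.v cur + D.length * W ≤ s₀.v rows)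
    (hcount : s₀.v count = D.length) (htotal : s₀.v total < 2 ^ w) (hDw : D.length < 2 ^ w)
    (hx2 : s₀.v x2 ≤ xs.length)
    (hrank : ∀ (i : ℕ) (x : ℝ), xs[i]? = some x →
        (s₀.v x1 ≤ i ∧ i < s₀.v x2 ↔ s₀.c xmin ≤ x ∧ x ≤ s₀.c xmax))
    (hstable : ∀ Fs Ks s s', Agree scanVars (OutsideSub s₀ Sc) s s' → I Fs Ks s → I Fs Ks s')
    (hfull : ∀ Fs Ks p s, p ∈ D → Fs ++ [p] <+: D.filter (fun p => 0 < p.len / X) →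
      I Fs Ks s → Agree (scanVars ++ hookVars) (Kept s₀ Sc) s₀ s → s.v k = p.len / X →
      0 < p.len / X → s.m (s.v cur) = .word (BitVec.ofNat w p.node) →
      Exec R full s Tf fun s' => I (Fs ++ [p]) Ks s' ∧ Agree hookVars (Kept s₀ Sc) s s')
    (hhook : ∀ Fs Ks κ s, Ks ++ [κ] <+: D.flatMap (residual X bx colr) →
      I Fs Ks s → Agree (scanVars ++ hookVars) (Kept s₀ Sc) s₀ s → s.v color = κ.1 →
      s.v res = (if κ ∈ O then 1 else 0) →
      Exec R hook s Th fun s' => I Fs (Ks ++ [κ]) s' ∧ Agree hookVars (Kept s₀ Sc) s s') :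
    ScanSpec R X W Sc length report (probe R query) full hook s₀ (Kept s₀ Sc) D img bx colr O I
      scratch tl tr (⌊te⌋₊ + 30) Tf Th := by
  have l1 := hlay.area_eq
  have l2 := hlay.rows_le
  have l3 := hlay.sub_le
  have l4 := hlay.sub_lt
  have hc := hcol.le
  rw [List.length_ofFn] at hc
  have hi := himg.le
  have he := hemp.le
  have hA : ∀ a, Kept s₀ Sc a → OutsideSub s₀ Sc a := by
    rintro a (h | ⟨-, h⟩ | h)
    · exact Or.inl (by omega)
    · exact Or.inl (by omega)
    · exact Or.inr h
  have hheld : ∀ {a : ℕ} {l : List (Cell w)}, StoredBelow (s₀.v fp) s₀.m a l →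
      Held (Kept s₀ Sc) s₀.m a l := fun h => ⟨h.stored, fun i hi => Or.inl (by
        have := h.le; omega)⟩
  exact
  { bound_length := hRl
    bound_report := hRr
    width_le := hRW
    scratch_le := side.scratch_le
    sub_le := hsc
    outside := hA
    img_held := hheld himg
    img_le := by omega
    cols_held := hheld hcol
    cols_le := by omega
    n_lt := by omega
    words_held := ⟨hwords, fun i hi => Or.inr (Or.inl ⟨by omega, by
      rw [length_flatMap_const (k := W) fun p hp => by
        rw [List.length_map, side.words_length p hp]] at hi
      omega⟩)⟩
    words_length := side.words_length
    words_le := by omega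
    D_le := hDw
    total_lt := htotal
    count_eq := hcount
    blk_eq := hblk
    one_le := hX
    box_length := side.box_length
    answers_length := side.answers_length
    answers_report := side.answers_report
    stable := hstable
    exec_full := hfull
    exec_hook := hhook
    exec_probe := fun s κ hs hκ => by
      have e1 := hs.v sub (by simp)
      have e2 := hs.v x2 (by simp)
      have e3 := hs.v x1 (by simp)
      have e4 := hs.v y1 (by simp)
      have e5 := hs.v y2 (by simp)
      have e6 := hs.v eimg (by simp)
      have h1 := hprobe.length_eq
      have h2 := hprobe.length_le
      have := exec_probe (R := R) (s := s) (Sc := Sc) (κ := κ) (O := O) (hprobe.answers κ) hRq hR7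
        hκ (by omega) (by omega) (by omega) (by rw [e4]; exact hprobe.ylo_lt)
        (by rw [e5]; exact hprobe.yhi_lt) (by rw [e6]; exact (hheld hemp).agree hs)
        (by omega) hprobe.scratch_le (by omega) (by
          rw [hprobe.mem_iff κ]
          refine exists_congr fun i => exists_congr fun y => ?_
          constructor
          · rintro ⟨x, h3, h4, h5, h6⟩
            rw [e2, e3, e4, e5]
            exact ⟨h3, (hrank i x h4).2 h5, h6⟩
          · rintro ⟨h3, h5, h6⟩
            rw [e2, e3] at h5
            rw [e4, e5] at h6
            have h7 := (List.getElem?_eq_some_iff.1 h3).1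
            have h8 := List.getElem?_eq_getElem (l := xs) (i := i) (by omega)
            exact ⟨_, h3, h8, (hrank i _ h8).1 h5, h6⟩)
      refine this.mono le_rfl fun s' hs' => ⟨hs'.1, hs'.2.mono (fun _ => id) fun a ha => ?_⟩
      simpa [OutsideSub, e1] using ha }

/-- Finds the record of the node and locates the prefixes in the stabbing structures of its
children. -/
def locateBoth (R W : ℕ) (locate : Cmd) : Cmd :=
  .seq (Block.code R [.set entry (base + (num * 2 + 2) + node * 12), .set area (fp + num * 2),
    .cneg nxmin xmin, .cneg nymin ymin])
  (.seq (call R locate (base + fld 0) area [] [nxmin, xmax, nymin] nl)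
  (.seq (Block.code R [.set cur (area + nl * .lit W)])
  (.seq (call R locate (base + fld 2) cur [] [nxmin, xmax, ymax] nr)
    (Block.code R [.set rows (cur + nr * .lit W), .set sub (rows + nl), .set total 0,
      .set common 0, .set marked 0, .set nrows 0]))))

/-- The state `s'` after `locateBoth`, started in `s`. -/
structure Located {w : ℕ} (n W Tot : ℕ) (DL DR : List (LocatedPrefix w)) (s s' : Env w) :
    Prop where
  v : ∀ x, x ∉ [entry, area, nl, cur, nr, rows, sub, total, common, marked, nrows] →
    s'.v x = s.v x
  c : ∀ x, x ∉ [nxmin, nymin] → s'.c x = s.c x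
  m : ∀ a, a < s.v fp ∨ s.v fp + Tot ≤ a → s'.m a = s.m a
  entry_eq : s'.v entry = s.v base + (2 * n + 2) + 12 * s.v node
  area_eq : s'.v area = s.v fp + 2 * n
  nl_eq : s'.v nl = DL.length
  nr_eq : s'.v nr = DR.length
  rows_eq : s'.v rows = s.v fp + 2 * n + DL.length * W + DR.length * W
  sub_eq : s'.v sub = s.v fp + 2 * n + DL.length * W + DR.length * W + DL.length
  total_eq : s'.v total = 0
  common_eq : s'.v common = 0
  marked_eq : s'.v marked = 0
  nrows_eq : s'.v nrows = 0
  wordsL : StoredAt s'.m (s.v fp + 2 * n) (DL.flatMap fun p => p.words.map Cell.word)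
  wordsR : StoredAt s'.m (s.v fp + 2 * n + DL.length * W)
    (DR.flatMap fun p => p.words.map Cell.word)

variable {w n NL NR : ℕ} [NeZero w] {R X W Sc Tφ : ℕ} {locate length report query : Cmd}
  {s : Env w} {parts : NodeParts w} {off : ℕ → ℕ}
  {DL DR : List (LocatedPrefix w)} {bxL : LocatedPrefix w → List (Fin NL)}
  {bxR : LocatedPrefix w → List (Fin NR)} {colrL : Fin NL → Fin n} {colrR : Fin NR → Fin n}
  {L O : Finset (Fin n)} {stL stR : LocatedPrefix w → ℕ} {scratch tq tl tr scratch' te : ℝ}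

/-- The prefixes of both sides are written one after the other: the structure of the left child
places its output at `area`, that of the right child directly after it. -/
theorem exec_locateBoth
    (hst : NodeStored (s.v fp) s.m (s.v base) (s.v base + (2 * n + 2) + 12 * s.v node) parts off)
    (hL : SideSpec X W Sc locate length report parts.imgL [-s.c xmin, s.c xmax, -s.c ymin] DL bxL
      colrL L stL parts.tblL scratch tq tl tr)
    (hR : SideSpec X W Sc locate length report parts.imgR [-s.c xmin, s.c xmax, s.c ymax] DR bxR
      colrR O stR parts.tblR scratch' tq tl tr)
    (hDL : DL.length ≤ Tφ) (hDR : DR.length ≤ Tφ) (hRl : locate.bound ≤ R) (hR7 : 7 ≤ R)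
    (hnum : s.v num = n) (hSc : 1 ≤ Sc)
    (hfits : s.v fp + (2 * n + 2 * (Tφ * W) + Tφ + Sc) ≤ 2 ^ w) (hW : W < 2 ^ w) :
    Exec R (locateBoth R W locate) s (2 * ⌊tq⌋₊ + 150)
      (Located n W (2 * n + 2 * (Tφ * W) + Tφ + Sc) DL DR s) := by
  have hw := NeZero.ne w
  have hent := hst.entry_le
  have hDL' : DL.length * W ≤ Tφ * W := Nat.mul_le_mul_right _ hDL
  have hDR' : DR.length * W ≤ Tφ * W := Nat.mul_le_mul_right _ hDR
  refine Exec.seq_le (2 * ⌊tq⌋₊ + 120) (Exec.block ?_ ?_) (by simp; omega)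
  · simp [hnum]; omega
  set s1 := Block.run s [.set entry (base + (num * 2 + 2) + node * 12), .set area (fp + num * 2),
    .cneg nxmin xmin, .cneg nymin ymin] with hs1
  have m1 : s1.m = s.m := rfl
  have v1 : ∀ x, x ∉ [entry, area] → s1.v x = s.v x := fun x hx => by
    simp only [List.mem_cons, List.not_mem_nil, or_false, not_or] at hx
    simp [hs1, hx]
  have c1 : ∀ x, x ∉ [nxmin, nymin] → s1.c x = s.c x := fun x hx => by
    simp only [List.mem_cons, List.not_mem_nil, or_false, not_or] at hx
    simp [hs1, hx]
  have e1 : s1.v entry = s.v base + (2 * n + 2) + 12 * s.v node := by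
    simp [hs1, hnum]; ring
  have a1 : s1.v area = s.v fp + 2 * n := by simp [hs1, hnum]; ring
  have b1 : s1.v base = s.v base := v1 _ (by simp)
  obtain ⟨g1, g2⟩ := gives_base_fld (s := s1) (k := 0) (b := off 0) (by omega)
    (by rw [b1]; exact hst.off_lt 0 (by omega)) (by rw [e1, m1]; exact hst.entry 0 (by omega)) s1
    (fun _ _ => rfl) rfl
  have hle := hst.imgL.le
  refine Exec.seq_le (⌊tq⌋₊ + 95) (Exec.call (e := base + fld 0) (e' := area) hL.answers_locate hRl
    ?_ ?_ ?_ ?_ ?_ ?_ ?_ ?_ ?_ hL.scratch_le ?_ le_rfl ?_) ?_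
  · simp; omega
  · simp; omega
  · exact g1
  · simp
  · simp
  · rfl
  · simp [hs1]
  · rw [g2, b1]; exact hst.imgL.stored
  · rw [g2, b1]; simp only [Expr.ev_var, a1]; omega
  · simp only [Expr.ev_var, a1]; omega
  · intro σ2 hpost2 hm2
    simp only [Expr.ev_var, a1] at hpost2 hm2
    set s2 : Env w := ⟨Function.update s1.v nl (σ2.reg 0).toNat, s1.c, σ2.mem⟩ with hs2
    have nl2 : s2.v nl = DL.length := by simp [hs2, hpost2.1]
    have v2 : ∀ x, x ≠ nl → s2.v x = s1.v x := fun x hx => by simp [hs2, hx]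
    refine Exec.seq_le (⌊tq⌋₊ + 85) (Exec.block ?_ ?_) ?_
    · simp [nl2, v2 area (by simp), a1, hW]; omega
    · set s3 := Block.run s2 [.set cur (area + nl * .lit W)] with hs3
      have v3 : ∀ x, x ≠ cur → s3.v x = s2.v x := fun x hx => by simp [hs3, hx]
      have cur3 : s3.v cur = s.v fp + 2 * n + DL.length * W := by
        simp [hs3, nl2, v2 area (by simp), a1]
      have m3 : s3.m = σ2.mem := rfl
      have b3 : s3.v base = s.v base := by rw [v3 _ (by simp), v2 _ (by simp), b1]
      have e3 : s3.v entry = s.v base + (2 * n + 2) + 12 * s.v node := by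
        rw [v3 _ (by simp), v2 _ (by simp), e1]
      have hst3 := hst.congr (m' := s3.m) fun a ha => by rw [m3, hm2 a (Or.inl (by omega)), m1]
      obtain ⟨g1, g2⟩ := gives_base_fld (s := s3) (k := 2) (b := off 2) (by omega)
        (by rw [b3]; exact hst.off_lt 2 (by omega)) (by rw [e3]; exact hst3.entry 2 (by omega)) s3
        (fun _ _ => rfl) rfl
      have hle := hst.imgR.le
      refine Exec.seq_le 50 (Exec.call (e := base + fld 2) (e' := cur) hR.answers_locate
        hRl ?_ ?_ ?_ ?_ ?_ ?_ ?_ ?_ ?_ hR.scratch_le ?_ le_rfl ?_) ?_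
      · simp; omega
      · simp; omega
      · exact g1
      · simp
      · simp
      · rfl
      · simp [hs3, hs2, hs1]
      · rw [g2, b3]; exact hst3.imgR.stored
      · rw [g2, b3]; simp only [Expr.ev_var, cur3]; omega
      · simp only [Expr.ev_var, cur3]; omega
      · intro σ4 hpost4 hm4
        simp only [Expr.ev_var, cur3] at hpost4 hm4
        set s4 : Env w := ⟨Function.update s3.v nr (σ4.reg 0).toNat, s3.c, σ4.mem⟩ with hs4
        have nr4 : s4.v nr = DR.length := by simp [hs4, hpost4.1]
        have v4 : ∀ x, x ≠ nr → s4.v x = s3.v x := fun x hx => by simp [hs4, hx]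
        have cur4 : s4.v cur = s.v fp + 2 * n + DL.length * W := by rw [v4 _ (by simp), cur3]
        have nl4 : s4.v nl = DL.length := by rw [v4 _ (by simp), v3 _ (by simp), nl2]
        have ar4 : s4.v area = s.v fp + 2 * n := by
          rw [v4 _ (by simp), v3 _ (by simp), v2 _ (by simp), a1]
        refine (Exec.block ?_ ?_).mono ?_ fun s' hs' => hs'
        · simp [nr4, cur4, nl4, hW]
          omega
        · constructor
          · intro x hx
            simp only [List.mem_cons, List.not_mem_nil, or_false, not_or] at hx
            simp only [Block.run, Assign.run, hx, ne_eq, not_false_eq_true,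
              Function.update_of_ne]
            rw [v4 x (by simp [hx]), v3 x (by simp [hx]), v2 x (by simp [hx]), v1 x (by simp [hx])]
          · intro x hx
            exact c1 x hx
          · intro a ha
            change σ4.mem a = _
            rw [hm4 a (by omega), m3, hm2 a (by omega), m1]
          · simp only [Block.run, Assign.run, ne_eq, reduceCtorEq, not_false_eq_true,
              Function.update_of_ne]
            rw [v4 _ (by simp), e3]
          · simp [ar4]
          · simp [nl4]
          · simp [nr4]
          · simp [nr4, cur4]
          · simp [nr4, cur4, nl4]
          · simp
          · simp
          · simp
          · simp
          · refine hpost2.2.congr fun i hi => ?_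
            rw [length_flatMap_const (k := W) fun p hp => by
              rw [List.length_map, hL.words_length p hp]] at hi
            change σ4.mem _ = _
            rw [hm4 _ (Or.inl (by omega)), m3]
          · exact hpost4.2
        · simp
      · simp [callCost, fld]
    · simp; omega
  · simp [callCost, fld]; omega

/-- The colors of the boxes of `p` in its full blocks. -/
def fullColors {w N n : ℕ} (X : ℕ) (bx : LocatedPrefix w → List (Fin N)) (colr : Fin N → Fin n)
    (p : LocatedPrefix w) : List (Fin n) :=
  ((bx p).take (p.len / X * X)).map colr

theorem fullColors_append_residual {w N n : ℕ} (X : ℕ) (bx : LocatedPrefix w → List (Fin N))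
    (colr : Fin N → Fin n) (p : LocatedPrefix w) :
    fullColors X bx colr p ++ residual X bx colr p = (bx p).map colr := by
  rw [fullColors, residual, ← List.map_append, List.take_append_drop]

/-- Computes the number of colors at the node that separates `c` and `d`. -/
def nodeQuery (R W : ℕ) (locate length report query : Cmd) : Cmd :=
  .seq (locateBoth R W locate)
  (.seq (scanSetup R 11 0 1 8 5 (right - half) 0 (yr - 1 - half) nl area)
  (.seq (scan R W length report (probe R query) (leftFull R) (leftHook R))
  (.seq (scanSetup R 10 2 3 9 4 (half - left) (yl - left) (half - left - 1) nr
    (area + nl * .lit W))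
  (.seq (scan R W length report (probe R query) (rightFull R) (rightHook R))
    (Block.code R [.set total (total - common)])))))

/-- The number of colors that occur both in the full blocks of `p` and in those of `p'`. -/
def fullCommon (X : ℕ) (bxL : LocatedPrefix w → List (Fin NL))
    (bxR : LocatedPrefix w → List (Fin NR)) (colrL : Fin NL → Fin n) (colrR : Fin NR → Fin n)
    (p p' : LocatedPrefix w) : ℕ :=
  ((fullColors X bxL colrL p).toFinset ∩ (fullColors X bxR colrR p').toFinset).card

set_option maxHeartbeats 800000 in
/-- The query at a node counts `L ∪ O`, where `L` and `O` are the sets of the colors of the points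
of the left and of the right child in the rectangle: the scans add up `L.card + O.card` in `total`
and `(L ∩ O).card`, split as in `count_common`, in `common`. -/
theorem exec_nodeQuery {scratchL scratchR : ℝ} {LsL LsR : List (ℕ × Fin n)}
    (hst : NodeStored (s.v fp) s.m (s.v base) (s.v base + (2 * n + 2) + 12 * s.v node) parts off)
    (hL : SideSpec X W Sc locate length report parts.imgL [-s.c xmin, s.c xmax, -s.c ymin] DL bxL
      colrL L stL parts.tblL scratch tq tl tr)
    (hR : SideSpec X W Sc locate length report parts.imgR [-s.c xmin, s.c xmax, s.c ymax] DR bxR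
      colrR O stR parts.tblR scratch' tq tl tr)
    (pL : ProbeSpec Sc query parts.empL LsL parts.xsL (s.c xmin) (s.c xmax) (s.v yl - s.v left)
      (s.v half - s.v left - 1) L scratchL te)
    (pR : ProbeSpec Sc query parts.empR LsR parts.xsR (s.c xmin) (s.c xmax) 0
      (s.v yr - 1 - s.v half) O scratchR te)
    (hlL : s.v half - s.v left = LsL.length) (hlR : s.v right - s.v half = LsR.length)
    (hnodes : s.v left ≤ s.v yl ∧ s.v yl < s.v half ∧ s.v half < s.v yr ∧ s.v yr ≤ s.v right)
    (hcolL : parts.colL = List.ofFn fun i => Cell.word (BitVec.ofNat w (colrL i)))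
    (hcolR : parts.colR = List.ofFn fun i => Cell.word (BitVec.ofNat w (colrR i)))
    (hmat : ∀ p ∈ DL, ∀ p' ∈ DR, 0 < p.len / X → 0 < p'.len / X →
      parts.mat[(stL p + (p.len / X - 1)) * parts.ncol + (stR p' + (p'.len / X - 1))]? =
        some (.word (BitVec.ofNat w (fullCommon X bxL bxR colrL colrR p p'))))
    (hmat' : ∀ p ∈ DL, 0 < p.len / X →
      (stL p + (p.len / X - 1)) * parts.ncol ≤ parts.mat.length)
    (hDL : DL.length ≤ Tφ) (hDR : DR.length ≤ Tφ)
    (hRo : locate.bound ≤ R) (hRl : length.bound ≤ R) (hRr : report.bound ≤ R)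
    (hRq : query.bound ≤ R) (hRW : W + 3 ≤ R) (hR7 : 7 ≤ R)
    (hX : 1 ≤ X) (hnum : s.v num = n) (hblk : s.v blk = X) (hSc : 1 ≤ Sc)
    (hfits : s.v fp + (2 * n + 2 * (Tφ * W) + Tφ + Sc) ≤ 2 ^ w) (hW : W < 2 ^ w)
    {t : ℕ} (ht : n < 2 ^ t) :
    Exec R (nodeQuery R W locate length report query) s
      (2 * ⌊tq⌋₊ + t * 108 + (2 * Tφ) * (⌊tl⌋₊ + W * 5 + Tφ * 30 +
        X * (⌊tr⌋₊ + W * 5 + ⌊te⌋₊ + 100) + 100) + 600) fun s' =>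
      s'.v total = (L ∪ O).card ∧
      ∀ a, a < s.v fp ∨ s.v fp + (2 * n + 2 * (Tφ * W) + Tφ + Sc) ≤ a → s'.m a = s.m a := by
  have hw := NeZero.ne w
  have hDL' : DL.length * W ≤ Tφ * W := Nat.mul_le_mul_right _ hDL
  have hDR' : DR.length * W ≤ Tφ * W := Nat.mul_le_mul_right _ hDR
  obtain ⟨hn1, hn2, hn3, hn4⟩ := hnodes
  have hxL := pL.length_eq
  have hxR := pR.length_eq
  have hnL := pL.length_le
  have hnR := pR.length_le
  set B := ⌊tl⌋₊ + W * 5 + Tφ * 30 + X * (⌊tr⌋₊ + W * 5 + ⌊te⌋₊ + 100) + 100 with hB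
  -- The time bounds below are for the remaining parts of the program.
  refine Exec.seq_of (t * 108 + (2 * Tφ) * B + 450)
    (exec_locateBoth hst hL hR hDL hDR hRo hR7 hnum hSc hfits hW) (by omega) fun s1 h1 => ?_
  have hst1 : NodeStored (s1.v fp) s1.m (s1.v base) (s1.v entry) parts off := by
    rw [h1.v fp (by simp), h1.v base (by simp), h1.entry_eq]
    exact hst.congr fun a ha => h1.m a (Or.inl ha)
  have hfp1 := h1.v fp (by simp)
  have hle := hst.entry_le
  refine Exec.seq_of (t * 54 + (2 * Tφ) * B + 250)
    (exec_scanSetup (p := parts) (off := off) (xs := parts.xsR) (ylo := 0)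
      (yhi := s.v yr - 1 - s.v half) (N := DL.length) (c := s.v fp + 2 * n) (t := t) hst1 (by omega)
      hst1.xsR pR.sorted ?_ ?_ ?_ ?_ ?_ ?_ (by omega) (by omega) (by omega)) (by omega)
    fun s2 h2 => ?_
  · intro s' hv _
    have e1 := hv right (by simp)
    have e2 := hv half (by simp)
    rw [h1.v _ (by simp)] at e1 e2
    simp [e1, e2]; omega
  · intro s' _ _
    simp
  · intro s' hv _
    have e1 := hv yr (by simp)
    have e2 := hv half (by simp)
    rw [h1.v _ (by simp)] at e1 e2
    simp [e1, e2, hw]; omega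
  · intro s' hv _
    have e1 := hv nl (by simp)
    simp [e1, h1.nl_eq]
  · intro s' hv _
    have e1 := hv area (by simp)
    simp [e1, h1.area_eq]
  · simp
  obtain ⟨m2, v2, c2, y12, y22, simg2, cols2, table2, eimg2, matrix2, ncols2, count2, cur2, x22,
    rank2⟩ := h2
  have vs2 : ∀ x, x ∉ [entry, area, nl, cur, nr, rows, sub, total, common, marked, nrows] →
      x ∉ setupVars → s2.v x = s.v x := fun x hx hx' => by rw [v2 x hx', h1.v x hx]
  have base2 := vs2 base (by simp) (by simp)
  have fp2 := vs2 fp (by simp) (by simp)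
  have num2 := vs2 num (by simp) (by simp)
  have blk2 := vs2 blk (by simp) (by simp)
  have area2 := v2 area (by simp)
  have rows2 := v2 rows (by simp)
  have sub2 := v2 sub (by simp)
  have total2 := v2 total (by simp)
  have common2 := v2 common (by simp)
  have marked2 := v2 marked (by simp)
  have nrows2 := v2 nrows (by simp)
  have nl2 := v2 nl (by simp)
  have nr2 := v2 nr (by simp)
  have ent2 := v2 entry (by simp)
  rw [h1.area_eq] at area2
  rw [h1.rows_eq] at rows2
  rw [h1.sub_eq] at sub2
  rw [h1.total_eq] at total2
  rw [h1.common_eq] at common2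
  rw [h1.marked_eq] at marked2
  rw [h1.nrows_eq] at nrows2
  rw [h1.nl_eq] at nl2
  rw [h1.nr_eq] at nr2
  have xmin2 : s2.c xmin = s.c xmin := by rw [c2 _ (by simp), h1.c _ (by simp)]
  have xmax2 : s2.c xmax = s.c xmax := by rw [c2 _ (by simp), h1.c _ (by simp)]
  have hb1 : s1.v base = s.v base := h1.v base (by simp)
  rw [hb1] at simg2 cols2 table2 eimg2 matrix2
  have hst2 : NodeStored (s2.v fp) s2.m (s.v base) (s2.v entry) parts off := by
    rw [m2, ent2, fp2, ← hfp1, ← hb1]; exact hst1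
  have hlay2 : Layout n s2 := ⟨by rw [num2, hnum], by omega, by omega, by omega, by omega⟩
  have hAv2 : Avoids (Kept s2 Sc) s2 := by
    rintro a (h | ⟨h, h'⟩ | h) <;> omega
  -- The left scan pushes the address at which the row of `p` begins.
  set raL : LocatedPrefix w → ℕ := fun p =>
    s2.v matrix + (stL p + (p.len / X - 1)) * s2.v ncols with hraL
  have hraL' : ∀ p ∈ DL, 0 < p.len / X → raL p < 2 ^ w := fun p hp hpos => by
    have h3 := hmat' p hp hpos
    have h4 := hst2.mat.le
    simp only [hraL]
    rw [ncols2, hst.ncol, matrix2]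
    omega
  have htabOf : ∀ (s0 : Env w) (D : List (LocatedPrefix w)) (st : LocatedPrefix w → ℕ)
      (tbl : List ℕ), StoredBelow (s0.v fp) s0.m (s0.v table) (natCells w tbl) →
      s0.v fp < 2 ^ w →
      (∀ p ∈ D, 0 < p.len / X → tbl[p.node]? = some (st p) ∧ st p + p.len / X < 2 ^ w) →
      TableAt X (Kept s0 Sc) D st s0 := by
    intro s0 D st tbl hs0 hlt htbl p hp hpos
    obtain ⟨h3, h4⟩ := htbl p hp hpos
    have h5 := (List.getElem?_eq_some_iff.1 h3).1
    have h6 := hs0.le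
    rw [List.length_map] at h6
    exact ⟨Or.inl (by omega), hs0.stored.get (by rw [List.getElem?_map, h3]; rfl), by omega, h4⟩
  have htab2 : TableAt X (Kept s2 Sc) DL stL s2 :=
    htabOf s2 DL stL parts.tblL (by rw [table2]; exact hst2.tblL) (by omega) hL.tbl_get
  have cL : ∀ p, (bxL p).map colrL = fullColors X bxL colrL p ++ residual X bxL colrL p :=
    fun p => (fullColors_append_residual X bxL colrL p).symm
  have cR : ∀ p, (bxR p).map colrR = fullColors X bxR colrR p ++ residual X bxR colrR p :=
    fun p => (fullColors_append_residual X bxR colrR p).symm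
  have ndL := hL.nodup
  have ndR := hR.nodup
  have memL := hL.mem_iff
  have memR := hR.mem_iff
  -- Each color of `L` occurs once in the located prefixes, so `L.card` is the sum of their lengths.
  have sumL : (DL.map LocatedPrefix.len).sum = L.card := by
    have : L = (DL.flatMap fun p => (bxL p).map colrL).toFinset := by
      ext κ; rw [memL, List.mem_toFinset]
    rw [this, List.toFinset_card_of_nodup ndL, List.length_flatMap]
    congr 1
    exact List.map_congr_left fun p hp => by rw [List.length_map, hL.box_length p hp]
  have sumR : (DR.map LocatedPrefix.len).sum = O.card := by
    have : O = (DR.flatMap fun p => (bxR p).map colrR).toFinset := by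
      ext κ; rw [memR, List.mem_toFinset]
    rw [this, List.toFinset_card_of_nodup ndR, List.length_flatMap]
    congr 1
    exact List.map_congr_left fun p hp => by rw [List.length_map, hR.box_length p hp]
  simp only [cL] at ndL memL
  simp only [cR] at ndR memR
  have ndKL : (DL.flatMap (residual X bxL colrL)).Nodup :=
    (List.nodup_append.1 ((List.flatMap_append_perm DL (fullColors X bxL colrL)
      (residual X bxL colrL)).nodup_iff.2 ndL)).2.1
  -- The left scan probes the emptiness structure of the right child: the colors of the points that
  -- it finds there form `O`.
  have specL : ScanSpec R X W Sc length report (probe R query) (leftFull R) (leftHook R) s2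
      (Kept s2 Sc) DL parts.imgL bxL colrL O
      (fun Fs Ks s' => s'.v sub = s2.v sub ∧ LeftInv O raL Fs Ks s') scratch tl tr
      (⌊te⌋₊ + 30) 22 22 := by
    refine scanSpec_of hL (emp := parts.empR) (Ls := LsR) (xs := parts.xsR)
      (by rw [xmin2, xmax2, y12, y22]; exact pR) hRl hRr hRq hRW hR7 hX (by rw [blk2, hblk]) hlay2
      (by omega) (by rw [simg2]; exact hst2.imgL) (by rw [cols2, ← hcolL]; exact hst2.colL)
      (by rw [eimg2]; exact hst2.empR) (by rw [cur2, m2]; exact h1.wordsL) (by omega) (by omega)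
      count2 (by rw [total2]; exact Nat.two_pow_pos w) (by omega) x22
      (by rw [c2 xmin (by simp), c2 xmax (by simp)]; exact rank2) ?_ ?_ ?_
    · intro Fs Ks s s' hs hI
      exact ⟨by rw [hs.v sub (by simp), hI.1], hI.2.congr (Sc := Sc)
        (hs.mono (fun _ h => h) fun a => by simp only [OutsideSub, hI.1]; exact id)⟩
    · intro Fs Ks p s' hp hpre hI hs' hk hpos hnode
      exact (exec_leftFull hAv2 (by omega) htab2 (fun p hp hpos => ⟨rfl, hraL' p hp hpos⟩) hp hpre
        hI.2 hs' hk hpos hnode).mono le_rfl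
        fun s'' h => ⟨⟨by rw [h.2.v sub (by simp), hI.1], h.1⟩, h.2⟩
    · intro Fs Ks κ s' hpre hI hs' hκ hres
      exact (exec_leftHook hAv2 (hpre.sublist.nodup ndKL) hI.2 hs' hκ hres).mono le_rfl
        fun s'' h => ⟨⟨by rw [h.2.v sub (by simp), hI.1], h.1⟩, h.2⟩
  refine Exec.seq_of (t * 54 + Tφ * B + 240) (specL.exec_scan ?_) ?_ fun s3 h3 => ?_
  · exact ⟨rfl, hlay2, ⟨by simp [marked2], by simp, by simp⟩, ⟨by simp [nrows2], by simp; omega,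
      by simp⟩, by simp [common2]⟩
  · have : DL.length * (⌊tl⌋₊ + W * 5 + 22 + X * (⌊tr⌋₊ + W * 5 + (⌊te⌋₊ + 30) + 22 + 30) + 60) ≤
        Tφ * B := by
      refine Nat.mul_le_mul hDL ?_
      have : X * (⌊tr⌋₊ + W * 5 + (⌊te⌋₊ + 30) + 22 + 30) ≤
          X * (⌊tr⌋₊ + W * 5 + ⌊te⌋₊ + 100) := Nat.mul_le_mul_left _ (by omega)
      omega
    have e : 2 * Tφ * B = Tφ * B + Tφ * B := by ring
    omega
  obtain ⟨⟨-, inv3⟩, ag3, total3⟩ := h3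
  rw [total2, sumL, Nat.zero_add] at total3
  set FL := DL.filter fun p => 0 < p.len / X with hFL
  set KL := DL.flatMap (residual X bxL colrL) with hKL
  have vs3 : ∀ x, x ∉ scanVars ++ hookVars → s3.v x = s2.v x := ag3.v
  have base3 := vs3 base (by simp)
  have fp3 := vs3 fp (by simp)
  have ent3 := vs3 entry (by simp)
  have mlt3 : ∀ a, a < s.v fp → s3.m a = s2.m a := fun a ha => ag3.m a (Or.inl (by omega))
  have hst3 : NodeStored (s3.v fp) s3.m (s3.v base) (s3.v entry) parts off := by
    rw [fp3, base3, ent3, base2]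
    exact hst2.congr fun a ha => mlt3 a (by omega)
  refine Exec.seq_of (Tφ * B + 40)
    (exec_scanSetup (p := parts) (off := off) (xs := parts.xsL) (ylo := s.v yl - s.v left)
      (yhi := s.v half - s.v left - 1) (N := DR.length) (c := s.v fp + 2 * n + DL.length * W)
      (t := t) hst3 (by omega) hst3.xsL pL.sorted ?_ ?_ ?_ ?_ ?_ ?_ (by omega) (by omega)
      (by omega)) (by omega) fun s4 h4 => ?_
  · intro s' hv _
    have e1 := hv left (by simp)
    have e2 := hv half (by simp)
    rw [vs3 _ (by simp), vs2 _ (by simp) (by simp)] at e1 e2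
    simp [e1, e2]; omega
  · intro s' hv _
    have e1 := hv left (by simp)
    have e2 := hv yl (by simp)
    rw [vs3 _ (by simp), vs2 _ (by simp) (by simp)] at e1 e2
    simp [e1, e2]; omega
  · intro s' hv _
    have e1 := hv left (by simp)
    have e2 := hv half (by simp)
    rw [vs3 _ (by simp), vs2 _ (by simp) (by simp)] at e1 e2
    simp [e1, e2, hw]; omega
  · intro s' hv _
    have e1 := hv nr (by simp)
    rw [vs3 _ (by simp), nr2] at e1
    simp [e1]
  · intro s' hv _
    have e1 := hv area (by simp)
    have e2 := hv nl (by simp)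
    rw [vs3 _ (by simp)] at e1 e2
    rw [area2] at e1
    rw [nl2] at e2
    simp [e1, e2, hW]; omega
  · simp
  obtain ⟨m4, v4, c4, y14, y24, simg4, cols4, table4, eimg4, matrix4, ncols4, count4, cur4, x24,
    rank4⟩ := h4
  have vs4 : ∀ x, x ∉ setupVars → x ∉ scanVars ++ hookVars → s4.v x = s2.v x :=
    fun x hx hx' => by rw [v4 x hx, vs3 x hx']
  have fp4 := vs4 fp (by simp) (by simp)
  have area4 := vs4 area (by simp) (by simp)
  have rows4 := vs4 rows (by simp) (by simp)
  have sub4 := vs4 sub (by simp) (by simp)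
  have num4 := vs4 num (by simp) (by simp)
  have ent4 := vs4 entry (by simp) (by simp)
  have total4 := v4 total (by simp)
  rw [total3] at total4
  rw [base3, base2] at simg4 cols4 table4 eimg4 matrix4
  have hlay4 : Layout n s4 := hlay2.congr (by simp [num4, area4, fp4, rows4, sub4])
  have hst4 : NodeStored (s4.v fp) s4.m (s.v base) (s4.v entry) parts off := by
    rw [m4, v4 entry (by simp), v4 fp (by simp), ← base2, ← base3]; exact hst3
  have hLn : L.card ≤ n := by simpa using Finset.card_le_univ L
  have hOn : O.card ≤ n := by simpa using Finset.card_le_univ O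
  have htab4 : TableAt X (Kept s4 Sc) DR stR s4 :=
    htabOf s4 DR stR parts.tblR (by rw [table4]; exact hst4.tblR) (by omega) hR.tbl_get
  set c₀ := KL.countP (· ∈ O) with hc₀
  have hfp4 : s4.v fp < 2 ^ w := by omega
  have kept4 : ∀ a, Kept s4 Sc a ↔ Kept s2 Sc a := fun a => by
    simp [Kept, fp4, area4, rows4, sub4]
  have hFL' : ∀ p ∈ FL, p ∈ DL ∧ 0 < p.len / X := fun p hp => by
    rw [hFL, List.mem_filter] at hp
    exact ⟨hp.1, by simpa using hp.2⟩
  -- The right scan reads the marks and the rows that the left scan has left in the work space.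
  have specR : ScanSpec R X W Sc length report (probe R query) (rightFull R) (rightHook R) s4
      (Kept s4 Sc) DR parts.imgR bxR colrR L
      (fun Fs Ks s' => s'.v sub = s4.v sub ∧
        RightInv L c₀ raL (fullCommon X bxL bxR colrL colrR) FL KL Fs Ks s') scratch' tl tr
      (⌊te⌋₊ + 30) (FL.length * 30 + 10) 30 := by
    refine scanSpec_of hR (emp := parts.empL) (Ls := LsL) (xs := parts.xsL)
      (by rw [c4 _ (by simp), c4 xmax (by simp), ag3.c, xmin2, xmax2, y14, y24]; exact pL)
      hRl hRr hRq hRW hR7 hX (by rw [vs4 blk (by simp) (by simp), blk2, hblk]) hlay4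
      (by omega) (by rw [simg4]; exact hst4.imgR) (by rw [cols4, ← hcolR]; exact hst4.colR)
      (by rw [eimg4]; exact hst4.empL) ?_ (by omega) (by omega)
      count4 (by rw [total4]; exact Nat.mod_lt _ (Nat.two_pow_pos w)) (by omega) x24
      (by rw [c4 xmin (by simp), c4 xmax (by simp)]; exact rank4) ?_ ?_ ?_
    · rw [cur4, m4]
      refine h1.wordsR.congr fun i hi => ?_
      rw [length_flatMap_const (k := W) fun p hp => by
        rw [List.length_map, hR.words_length p hp]] at hi
      rw [ag3.m _ (Or.inr (Or.inl ⟨by omega, by omega⟩)), m2]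
    · intro Fs Ks s s' hs hI
      exact ⟨by rw [hs.v sub (by simp), hI.1], hI.2.congr (Sc := Sc)
        (hs.mono (fun _ h => h) fun a => by simp only [OutsideSub, hI.1]; exact id)⟩
    · intro Fs Ks p s' hp hpre hI hs' hk hpos hnode
      refine (exec_rightFull htab4 (fun p hp => hraL' p (hFL' p hp).1 (hFL' p hp).2)
        (fun p hp p' hp' hpos' => ?_) hp hI.2 hs' hk hpos hnode).mono le_rfl
        fun s'' h => ⟨⟨by rw [h.2.v sub (by simp), hI.1], h.1⟩, h.2⟩
      obtain ⟨hp1, hp2⟩ := hFL' p hp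
      have h5 := hmat p hp1 p' hp' hp2 hpos'
      have h6 := (List.getElem?_eq_some_iff.1 h5).1
      have h7 := hst4.mat.le
      have h8 : raL p + (stR p' + (p'.len / X - 1)) = s.v base + off 6 +
          ((stL p + (p.len / X - 1)) * parts.ncol + (stR p' + (p'.len / X - 1))) := by
        simp only [hraL]
        rw [ncols2, hst.ncol, matrix2]
        ring
      rw [h8]
      have h9 := (Nat.add_lt_add_left h6 (s.v base + off 6)).trans_le h7
      exact ⟨Or.inl h9, hst4.mat.stored.get h5, h9.trans hfp4⟩
    · intro Fs Ks κ s' hpre hI hs' hκ hres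
      exact (exec_rightHook hI.2 hκ hres).mono le_rfl
        fun s'' h => ⟨⟨by rw [h.2.v sub (by simp), hI.1], h.1⟩, h.2⟩
  refine Exec.seq_of 10 (specR.exec_scan ?_) ?_ fun s5 h5 => ?_
  · refine ⟨rfl, hlay4, inv3.marks.congr ?_ fun a _ => by rw [m4],
      inv3.rowsAt.congr ?_ fun a _ _ => by rw [m4], ?_⟩
    · simp [v4]
    · simp [v4]
    · rw [v4 _ (by simp), inv3.common_eq]
      simp [hc₀]
  · have : DR.length * (⌊tl⌋₊ + W * 5 + (FL.length * 30 + 10) +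
        X * (⌊tr⌋₊ + W * 5 + (⌊te⌋₊ + 30) + 30 + 30) + 60) ≤ Tφ * B := by
      refine Nat.mul_le_mul hDR ?_
      have h6 : FL.length ≤ DL.length := List.length_filter_le _ _
      have : X * (⌊tr⌋₊ + W * 5 + (⌊te⌋₊ + 30) + 30 + 30) ≤
          X * (⌊tr⌋₊ + W * 5 + ⌊te⌋₊ + 100) := Nat.mul_le_mul_left _ (by omega)
      omega
    omega
  obtain ⟨⟨-, inv5⟩, ag5, total5⟩ := h5
  have hcom := inv5.common_eq
  have hcount := count_common ndL ndR memL memR (fun p => decide (0 < p.len / X))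
    (fun p => decide (0 < p.len / X)) (fun p _ hp => by
      have : p.len / X = 0 := Nat.eq_zero_of_not_pos (of_decide_eq_false hp)
      simp [fullColors, this]) (fun p _ hp => by
      have : p.len / X = 0 := Nat.eq_zero_of_not_pos (of_decide_eq_false hp)
      simp [fullColors, this])
  have hcom' : s5.v common = (L ∩ O).card := by
    rw [hcom]
    -- The counter is modulo `2 ^ w`, and its final value is in range.
    have h6 : (L ∩ O).card < 2 ^ w := by
      have := Finset.card_le_card (Finset.inter_subset_left (s₁ := L) (s₂ := O))
      omega
    rw [← Nat.mod_eq_of_lt h6, ← hcount]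
    simp only [hc₀, hKL, hFL, fullCommon]
  have htot' : s5.v total = L.card + O.card := by
    rw [total5, total4, sumR, Nat.mod_add_mod, Nat.mod_eq_of_lt (by omega)]
  have hunion := Finset.card_union_add_card_inter L O
  have hinter := Finset.card_le_card (Finset.inter_subset_left (s₁ := L) (s₂ := O))
  refine (Exec.block ?_ ⟨?_, fun a ha => ?_⟩).mono (by simp) fun s' hs' => hs'
  · simp [hcom', htot']
    clear * - hinter
    omega
  · simp [hcom', htot']
    clear * - hunion
    omega
  · change s5.m a = _
    have hk : Kept s2 Sc a := by
      rcases ha with ha | ha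
      · exact Or.inl (by omega)
      · exact Or.inr (Or.inr (by omega))
    rw [ag5.m a ((kept4 a).2 hk), m4, ag3.m a hk, m2, h1.m a ha]

end NodeQuery

/-! ### The query program -/

section TopQuery

open Var CVar

variable {w : ℕ}

/-- The time for the query at a node. -/
noncomputable def nodeTime (t W X Tφ : ℕ) (tq tl tr te : ℝ) : ℕ :=
  2 * ⌊tq⌋₊ + t * 108 + (2 * Tφ) * (⌊tl⌋₊ + W * 5 + Tφ * 30 +
    X * (⌊tr⌋₊ + W * 5 + ⌊te⌋₊ + 100) + 100) + 600

/-- The structures of the node `[lo, hi)` with children `[lo, mid)` and `[mid, hi)` work for the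
query `[a, b] × [c, d]`, where `yl, …, yr - 1` are the `y`-ranks of the points between `c` and `d`,
and the node separates these; there are `tot` colors in the rectangle. -/
def NodeSpec (n X W Sc Tφ : ℕ) (locate length report query : Cmd) (tq tl tr te a b c d : ℝ)
    (lo mid hi yl yr : ℕ) (parts : NodeParts w) (tot : ℕ) : Prop :=
  ∃ (NL NR : ℕ) (DL DR : List (LocatedPrefix w)) (bxL : LocatedPrefix w → List (Fin NL))
    (bxR : LocatedPrefix w → List (Fin NR)) (colrL : Fin NL → Fin n) (colrR : Fin NR → Fin n)
    (L O : Finset (Fin n)) (stL stR : LocatedPrefix w → ℕ) (scratch scratch' scratchL scratchR : ℝ)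
    (LsL LsR : List (ℕ × Fin n)),
    SideSpec X W Sc locate length report parts.imgL [-a, b, -c] DL bxL colrL L stL parts.tblL
      scratch tq tl tr ∧
    SideSpec X W Sc locate length report parts.imgR [-a, b, d] DR bxR colrR O stR parts.tblR
      scratch' tq tl tr ∧
    ProbeSpec Sc query parts.empL LsL parts.xsL a b (yl - lo) (mid - lo - 1) L scratchL te ∧
    ProbeSpec Sc query parts.empR LsR parts.xsR a b 0 (yr - 1 - mid) O scratchR te ∧
    (mid - lo = LsL.length ∧ hi - mid = LsR.length) ∧
    parts.colL = (List.ofFn fun i => Cell.word (BitVec.ofNat w (colrL i))) ∧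
    parts.colR = (List.ofFn fun i => Cell.word (BitVec.ofNat w (colrR i))) ∧
    (∀ p ∈ DL, ∀ p' ∈ DR, 0 < p.len / X → 0 < p'.len / X →
      parts.mat[(stL p + (p.len / X - 1)) * parts.ncol + (stR p' + (p'.len / X - 1))]? =
        some (.word (BitVec.ofNat w (fullCommon X bxL bxR colrL colrR p p')))) ∧
    (∀ p ∈ DL, 0 < p.len / X →
      (stL p + (p.len / X - 1)) * parts.ncol ≤ parts.mat.length) ∧
    (DL.length ≤ Tφ ∧ DR.length ≤ Tφ) ∧ tot = (L ∪ O).card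

/-- The part of the image with the sizes and the coordinates of the points by increasing
`y`-coordinate. -/
def header (w : ℕ) {n : ℕ} (X : ℕ) (ys xs : Fin n → ℝ) : List (Cell w) :=
  natCells w [n, X] ++ ((List.ofFn ys).map Cell.coord ++ (List.ofFn xs).map Cell.coord)

theorem length_header {n X : ℕ} {ys xs : Fin n → ℝ} :
    (header w X ys xs).length = 2 * n + 2 := by
  simp [header]; omega

/-- Computes the number of colors in the rectangle given by the coordinate variables. -/
def topBody (R W : ℕ) (locate length report query : Cmd) : Cmd :=
  .seq (Block.code R [.set num (.load base), .set blk (.load (base + 1)), .set total 0])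
  (.seq (rankSearch R (base + 2) num ymin ymax yl yr)
    (ifNonzero R (.bin .lt yl yr)
      (ifNonzero R (.bin .eq (yl + 1) yr)
        (Block.code R [.cload tmp (base + 2 + num + yl),
          .set total (.cle xmin tmp * .cle tmp xmax)])
        (.seq (descend R) (nodeQuery R W locate length report query)))
      (Block.code R [])))

/-- The interval `[yl, yr)` of the ranks of the points between `ymin` and `ymax` is empty, or
consists of one leaf, or is split by an internal node of the tree. -/
theorem exec_topBody [NeZero w] {n R X W Sc Tφ t tot : ℕ} {locate length report query : Cmd}
    {s : Env w} {ys xs : Fin n → ℝ} {parts : ℕ × ℕ → NodeParts w} {off : ℕ → ℕ → ℕ}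
    {tq tl tr te : ℝ}
    (hhead : StoredBelow (s.v fp) s.m (s.v base) (header w X ys xs)) (hys : StrictMono ys)
    (hnodes : ∀ i v, (internalNodes 0 n)[i]? = some v →
      NodeStored (s.v fp) s.m (s.v base) (s.v base + (2 * n + 2) + 12 * i) (parts v) (off i))
    (h0 : (∀ i, ¬ (s.c ymin ≤ ys i ∧ ys i ≤ s.c ymax)) → tot = 0)
    (h1 : ∀ i, (∀ j, s.c ymin ≤ ys j ∧ ys j ≤ s.c ymax ↔ j = i) →
      tot = if s.c xmin ≤ xs i ∧ xs i ≤ s.c xmax then 1 else 0)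
    (h2 : ∀ v ∈ internalNodes 0 n, ∀ yl yr, v.1 ≤ yl → yl < (v.1 + v.2) / 2 →
      (v.1 + v.2) / 2 < yr → yr ≤ v.2 →
      (∀ i : Fin n, yl ≤ i ∧ i < yr ↔ s.c ymin ≤ ys i ∧ ys i ≤ s.c ymax) →
      NodeSpec n X W Sc Tφ locate length report query tq tl tr te (s.c xmin) (s.c xmax) (s.c ymin)
        (s.c ymax) v.1 ((v.1 + v.2) / 2) v.2 yl yr (parts v) tot)
    (hRo : locate.bound ≤ R) (hRl : length.bound ≤ R) (hRr : report.bound ≤ R)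
    (hRq : query.bound ≤ R) (hRW : W + 3 ≤ R) (hR7 : 7 ≤ R)
    (hX : 1 ≤ X) (hXn : X ≤ n) (hSc : 1 ≤ Sc)
    (hfits : s.v fp + (2 * n + 2 * (Tφ * W) + Tφ + Sc) ≤ 2 ^ w) (hW : W < 2 ^ w)
    (ht : n < 2 ^ t) :
    Exec R (topBody R W locate length report query) s
      (t * 93 + nodeTime t W X Tφ tq tl tr te + 250) fun s' =>
      s'.v total = tot ∧
      ∀ a, a < s.v fp ∨ s.v fp + (2 * n + 2 * (Tφ * W) + Tφ + Sc) ≤ a → s'.m a = s.m a := by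
  have hw := NeZero.ne w
  have hle := hhead.le
  rw [length_header] at hle
  have hst := hhead.stored
  rw [header, StoredAt.append_iff, StoredAt.append_iff] at hst
  obtain ⟨st1, st2, st3⟩ := hst
  simp only [List.length_map, List.length_ofFn, List.length_cons, List.length_nil] at st2 st3
  have hn0 : s.m (s.v base) = .word (BitVec.ofNat w n) := by
    simpa using st1.get (i := 0) (u := .word (BitVec.ofNat w n)) (by simp)
  have hX0 : s.m (s.v base + 1) = .word (BitVec.ofNat w X) := by
    simpa using st1.get (i := 1) (u := .word (BitVec.ofNat w X)) (by simp)
  refine Exec.seq_le (t * 93 + nodeTime t W X Tφ tq tl tr te + 235) (Exec.block ?_ ?_)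
    (by simp; omega)
  · simp; omega
  set s1 := Block.run s [.set num (.load base), .set blk (.load (base + 1)), .set total 0] with hs1
  have v1 : ∀ x, x ∉ [num, blk, total] → s1.v x = s.v x := fun x hx => by
    simp only [List.mem_cons, List.not_mem_nil, or_false, not_or] at hx
    simp [hs1, hx]
  have num1 : s1.v num = n := by
    simp [hs1, hn0, Nat.mod_eq_of_lt (show n < 2 ^ w by omega), Cell.toWord]
  have blk1 : s1.v blk = X := by
    simp [hs1, hX0, Nat.mod_eq_of_lt (show X < 2 ^ w by omega), Cell.toWord]
  have tot1 : s1.v total = 0 := by simp [hs1]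
  have base1 := v1 base (by simp)
  have fp1 := v1 fp (by simp)
  have m1 : s1.m = s.m := rfl
  have c1 : s1.c = s.c := rfl
  refine Exec.seq_of (t * 39 + nodeTime t W X Tφ tq tl tr te + 180)
    (exec_rankSearch (L := List.ofFn ys) (t := t) ?_ ?_ ?_ ?_ ?_ ?_ ?_ (by simp) (by simp)
      (by simp) (by simpa)) (by simp; omega) fun s2 hs2 => ?_
  · simp [base1]; omega
  · simp
  · simp [num1]
  · exact (List.pairwise_ofFn.2 fun i j hij => (hys hij).le)
  · simpa [base1, m1] using st2
  · simp [base1]; omega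
  · simp; omega
  obtain ⟨m2, v2, c2, -, hyr, hrank⟩ := hs2
  rw [List.length_ofFn] at hyr
  have hrank' : ∀ i : Fin n, s2.v yl ≤ i ∧ i < s2.v yr ↔ s.c ymin ≤ ys i ∧ ys i ≤ s.c ymax := by
    intro i
    exact hrank i (ys i) (by simp)
  have base2 : s2.v base = s.v base := by rw [v2 _ (by simp), base1]
  have fp2 : s2.v fp = s.v fp := by rw [v2 _ (by simp), fp1]
  have num2 : s2.v num = n := by rw [v2 _ (by simp), num1]
  have blk2 : s2.v blk = X := by rw [v2 _ (by simp), blk1]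
  have tot2 : s2.v total = 0 := by rw [v2 _ (by simp), tot1]
  refine (Exec.ite (t := t * 39 + nodeTime t W X Tφ tq tl tr te + 140) (t' := 1) (by simp)
    (fun hlt => ?_) fun hge => ?_).mono (by simp; omega) fun s' hs' => hs'
  · replace hlt : s2.v yl < s2.v yr := by
      by_contra h; exact hlt (by simp [h])
    refine (Exec.ite (t := 30) (t' := t * 39 + nodeTime t W X Tφ tq tl tr te + 60) ?_
      (fun heq => ?_) fun hne => ?_).mono (by simp; omega) fun s' hs' => hs'
    · simp [hw]; omega
    · replace heq : s2.v yl + 1 = s2.v yr := by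
        by_contra h; exact heq (by simp [h])
      have hl : s2.v yl < n := by omega
      have hx := st3.get (i := s2.v yl) (u := .coord (xs ⟨_, hl⟩)) (by simp [hl])
      have hx' : s2.m (s2.v base + 2 + s2.v num + s2.v yl) = .coord (xs ⟨_, hl⟩) := by
        rw [m2, m1, base2, num2, ← hx]
      refine (Exec.block ?_ ⟨?_, fun a ha => ?_⟩).mono (by simp) fun s' hs' => hs'
      · simp [base2, num2]
        refine ⟨by omega, ?_⟩
        split_ifs <;> simp [hw]
      · have c2' : s2.c xmin = s.c xmin ∧ s2.c xmax = s.c xmax :=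
          ⟨by rw [c2 _ (by simp), c1], by rw [c2 _ (by simp), c1]⟩
        rw [h1 ⟨_, hl⟩ fun j => by rw [← hrank', Fin.ext_iff]; simp only; omega]
        simp only [Block.run, Assign.run, Expr.ev_add, Expr.ev_var, Expr.ev_lit, Expr.ev_mul,
          Expr.ev_cle, hx', Cell.toCoord, Function.update_self, c2',
          Function.update_of_ne (show xmin ≠ tmp by simp),
          Function.update_of_ne (show xmax ≠ tmp by simp)]
        clear * -
        split_ifs <;> tauto
      · change s2.m a = s.m a
        rw [m2, m1]
    · replace hne : s2.v yl + 1 ≠ s2.v yr := fun h => by simp [h] at hne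
      refine Exec.seq_of (nodeTime t W X Tφ tq tl tr te) (exec_descend (t := t) (by omega)
        (by omega) (by omega) (by omega)) (by omega) ?_
      rintro s3 ⟨m3, c3, v3, hnd, hh, hl1, hl2, hl3, hl4⟩
      rw [num2] at hnd
      have base3 : s3.v base = s.v base := by rw [v3 _ (by simp), base2]
      have fp3 : s3.v fp = s.v fp := by rw [v3 _ (by simp), fp2]
      have yl3 : s3.v yl = s2.v yl := v3 _ (by simp)
      have yr3 : s3.v yr = s2.v yr := v3 _ (by simp)
      have m3' : s3.m = s.m := by rw [m3, m2, m1]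
      have hc3 : ∀ x, x ∉ [key, tmp] → s3.c x = s.c x := fun x hx => by rw [c3, c2 x hx, c1]
      obtain ⟨NL, NR, DL, DR, bxL, bxR, colrL, colrR, L, O, stL, stR, sc1, sc2, sc3, sc4, LsL, LsR,
        k1, k2, k3, k4, k5, k6, k7, k8, k9, k10, rfl⟩ := h2 _ (List.mem_of_getElem? hnd) _ _ hl1
          (by rw [← hh]; exact hl2) (by rw [← hh]; exact hl3) hl4 hrank'
      rw [← hh] at k3 k4 k5
      have hst3 := hnodes _ _ hnd
      refine (exec_nodeQuery (n := n) (t := t) (stL := stL) (stR := stR) (L := L) (O := O)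
        (LsL := LsL) (LsR := LsR) (scratch := sc1) (scratch' := sc2) (scratchL := sc3)
        (scratchR := sc4) (by rw [fp3, base3, m3']; exact hst3)
        (by rw [hc3 xmin (by simp), hc3 xmax (by simp), hc3 ymin (by simp)]; exact k1)
        (by rw [hc3 xmin (by simp), hc3 xmax (by simp), hc3 ymax (by simp)]; exact k2)
        (by rw [hc3 xmin (by simp), hc3 xmax (by simp), yl3]; exact k3)
        (by rw [hc3 xmin (by simp), hc3 xmax (by simp), yr3]; exact k4) k5.1 k5.2
        (by rw [yl3, yr3]; exact ⟨hl1, hl2, hl3, hl4⟩) k6 k7 k8 k9 k10.1 k10.2 hRo hRl hRr hRq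
        hRW hR7 hX (by rw [v3 _ (by simp), num2]) (by rw [v3 _ (by simp), blk2]) hSc
        (by rw [fp3]; exact hfits) hW ht).mono le_rfl fun s' hs' => ⟨hs'.1, fun a ha => ?_⟩
      rw [hs'.2 a (by rw [fp3]; exact ha), m3']
  · replace hge : s2.v yr ≤ s2.v yl := by
      by_contra h; simp [not_le.1 h] at hge
    refine (Exec.block trivial ⟨?_, fun a ha => ?_⟩)
    · change s2.v total = tot
      rw [tot2, h0 fun i hi => ?_]
      have := (hrank' i).2 hi
      omega
    · change s2.m a = s.m a
      rw [m2, m1]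

/-- The query program: `topBody` between instructions that fetch the arguments and deliver the
result. -/
def topQuery (R W : ℕ) (locate length report query : Cmd) : Cmd :=
  .seq (.instr (.op .or (vreg R base) 0 0))
  (.seq (.instr (.op .or (vreg R fp) 1 1))
  (.seq (.instr (.cmove (cvreg R xmin) 0))
  (.seq (.instr (.cmove (cvreg R xmax) 1))
  (.seq (.instr (.cmove (cvreg R ymin) 2))
  (.seq (.instr (.cmove (cvreg R ymax) 3))
  (.seq (topBody R W locate length report query)
    (.instr (.op .or 0 (vreg R total) (vreg R total)))))))))

/-- The query program works wherever the image is stored: the arguments arrive in registers below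
`R`, and the result leaves in the register `0`. -/
theorem answers_topQuery [NeZero w] {n R X W Sc Tφ t tot : ℕ} {locate length report query : Cmd}
    {img : List (Cell w)} {a b c d : ℝ}
    {ys xs : Fin n → ℝ} {parts : ℕ × ℕ → NodeParts w} {off : ℕ → ℕ → ℕ}
    {tq tl tr te scratch time : ℝ}
    (himg : ∀ base lim m, StoredBelow lim m base img → lim + Sc ≤ 2 ^ w →
      StoredBelow lim m base (header w X ys xs) ∧
      ∀ i v, (internalNodes 0 n)[i]? = some v →
        NodeStored lim m base (base + (2 * n + 2) + 12 * i) (parts v) (off i))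
    (hys : StrictMono ys)
    (h0 : (∀ i, ¬ (c ≤ ys i ∧ ys i ≤ d)) → tot = 0)
    (h1 : ∀ i, (∀ j, c ≤ ys j ∧ ys j ≤ d ↔ j = i) → tot = if a ≤ xs i ∧ xs i ≤ b then 1 else 0)
    (h2 : ∀ v ∈ internalNodes 0 n, ∀ yl yr, v.1 ≤ yl → yl < (v.1 + v.2) / 2 →
      (v.1 + v.2) / 2 < yr → yr ≤ v.2 → (∀ i : Fin n, yl ≤ i ∧ i < yr ↔ c ≤ ys i ∧ ys i ≤ d) →
      NodeSpec n X W Sc Tφ locate length report query tq tl tr te a b c d v.1 ((v.1 + v.2) / 2)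
        v.2 yl yr (parts v) tot)
    (hRo : locate.bound ≤ R) (hRl : length.bound ≤ R) (hRr : report.bound ≤ R)
    (hRq : query.bound ≤ R) (hRW : W + 3 ≤ R) (hR7 : 7 ≤ R)
    (hX : 1 ≤ X) (hXn : X ≤ n) (hSc : 1 ≤ Sc) (hW : W < 2 ^ w) (ht : n < 2 ^ t)
    (hscratch : ((2 * n + 2 * (Tφ * W) + Tφ + Sc : ℕ) : ℝ) ≤ scratch)
    (htime : ((t * 93 + nodeTime t W X Tφ tq tl tr te + 260 : ℕ) : ℝ) ≤ time) :
    Answers (topQuery R W locate length report query) img [] [a, b, c, d] scratch time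
      fun _ σ => (σ.reg 0).toNat = tot := by
  intro σ base' fp' hσ
  have hfits : fp' + (2 * n + 2 * (Tφ * W) + Tφ + Sc) ≤ 2 ^ w := by
    have := (add_le_add_right hscratch (fp' : ℝ)).trans hσ.scratch_fits
    exact_mod_cast this
  have c0 : σ.creg 0 = a := hσ.cargs_reg 0 (by simp)
  have c1 : σ.creg 1 = b := hσ.cargs_reg 1 (by simp)
  have c2 : σ.creg 2 = c := hσ.cargs_reg 2 (by simp)
  have c3 : σ.creg 3 = d := hσ.cargs_reg 3 (by simp)
  set σ1 : State w := ⟨Function.update (Function.update σ.reg (vreg R base) (σ.reg 0)) (vreg R fp)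
    (σ.reg 1), Function.update (Function.update (Function.update (Function.update σ.creg
      (cvreg R xmin) a) (cvreg R xmax) b) (cvreg R ymin) c) (cvreg R ymax) d, σ.mem⟩ with hσ1
  set s : Env w := ⟨fun x => (σ1.reg (vreg R x)).toNat, fun x => σ1.creg (cvreg R x), σ1.mem⟩
    with hs
  have hrep : Rep R σ1 s := ⟨fun _ => rfl, fun _ => rfl, rfl⟩
  have hne : vreg R base ≠ vreg R fp := fun h => by simpa using vreg_injective R h
  have e1 : s.v base = base' := by
    simp only [hs, hσ1]
    rw [Function.update_of_ne hne, Function.update_self, hσ.base_reg]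
  have e2 : s.v fp = fp' := by
    simp only [hs, hσ1]
    rw [Function.update_self, hσ.fp_reg]
  have e3 : s.c xmin = a ∧ s.c xmax = b ∧ s.c ymin = c ∧ s.c ymax = d := by
    simp only [hs, hσ1, Function.update_apply, (cvreg_injective R).eq_iff]
    simp
  have hbelow : StoredBelow fp' σ.mem base' img := ⟨hσ.img_stored, hσ.img_below⟩
  obtain ⟨k1, k2⟩ := himg _ _ _ hbelow (by omega)
  obtain ⟨σ2, s2, t2, r2, ht2, rep2, q2, f2⟩ := exec_topBody (n := n) (R := R) (X := X) (W := W)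
    (Sc := Sc) (Tφ := Tφ) (t := t) (tot := tot) (s := s) (ys := ys) (xs := xs) (parts := parts)
    (off := off) (tq := tq) (tl := tl) (tr := tr) (te := te) (locate := locate)
    (length := length) (report := report) (query := query)
    (by rw [e1, e2]; exact k1) hys
    (by rw [e1, e2]; exact k2) (by rw [e3.2.2.1, e3.2.2.2]; exact h0)
    (by rw [e3.1, e3.2.1, e3.2.2.1, e3.2.2.2]; exact h1)
    (by rw [e3.1, e3.2.1, e3.2.2.1, e3.2.2.2]; exact h2) hRo hRl hRr hRq hRW hR7 hX hXn hSc
    (by rw [e2]; exact hfits) hW ht σ1 hrep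
  refine ⟨_, _, .seq (.instr _ _) (.seq (.instr _ _) (.seq (.instr _ _) (.seq (.instr _ _)
    (.seq (.instr _ _) (.seq (.instr _ _) (.seq (σ' := σ2) (s := t2) ?_ (.instr _ _))))))), ?_,
    ?_, ?_⟩
  · convert r2 using 1
    have hv0 : 0 ≠ vreg R base ∧ 1 ≠ vreg R base := by constructor <;> unfold vreg <;> omega
    have hcv : ∀ x, cvreg R x ≠ 0 ∧ cvreg R x ≠ 1 ∧ cvreg R x ≠ 2 ∧ cvreg R x ≠ 3 := by
      intro x; unfold cvreg; omega
    simp only [Instr.step, State.setReg, State.setCreg, Op.eval, BitVec.or_self, hσ1]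
    simp only [Function.update_of_ne hv0.2, Function.update_of_ne (hcv _).2.1.symm,
      Function.update_of_ne (hcv _).2.2.1.symm,
      Function.update_of_ne (hcv _).2.2.2.symm, c0, c1, c2, c3]
  · refine le_trans ?_ htime
    exact_mod_cast by omega
  · intro x hx
    change σ2.mem x = σ.mem x
    rw [rep2.m, f2 x ?_]
    rw [e2]
    rcases hx with hx | hx
    · exact Or.inl hx
    · right
      have := (add_le_add_right hscratch (fp' : ℝ)).trans hx
      exact_mod_cast this
  · simp only [Instr.step, State.setReg, Function.update_self, Op.eval, BitVec.or_self]
    rw [rep2.v, q2]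

end TopQuery

/-! ### Partition of a union of dominance regions into canonical boxes -/

theorem CanonicalBox.toSet_nonempty (B : CanonicalBox) : (B.x₁, B.y₁, B.z₁) ∈ B.toSet :=
  ⟨le_rfl, ⟨le_rfl, B.hy⟩, le_rfl, B.hz⟩

/-- The part of a quadrant above a staircase `T` is cut at the steps that it covers.  The steps
that it does not cover are those after `dropWhile`. -/
theorem exists_boxes_above_staircase (x z : ℝ) (T : List (ℝ × ℝ)) :
    ∀ (b : ℝ) (top : WithTop ℝ), T.Pairwise (fun s t => s.1 < t.1 ∧ t.2 < s.2) →
      (∀ t ∈ T, b < t.1) → (∀ t ∈ T, (t.2 : WithTop ℝ) < top) → (z : WithTop ℝ) < top →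
      ∃ L : List CanonicalBox,
        L.length + (T.dropWhile fun t => decide (z < t.2)).length = T.length + 1 ∧
        (∀ B ∈ L, B.x₁ = x) ∧ L.Pairwise (fun B B' => Disjoint B.toSet B'.toSet) ∧
        ∀ q : ℝ × ℝ × ℝ, (∃ B ∈ L, q ∈ B.toSet) ↔
          x ≤ q.1 ∧ b ≤ q.2.1 ∧ z ≤ q.2.2 ∧ (q.2.2 : WithTop ℝ) < top ∧
            ¬ ∃ t ∈ T, t.1 ≤ q.2.1 ∧ t.2 ≤ q.2.2 := by
  induction T with
  | nil =>
    intro b top _ _ _ hz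
    refine ⟨[⟨x, b, z, ⊤, top, WithTop.coe_lt_top b, hz⟩], by simp, by simp, by simp, fun q => ?_⟩
    simp [CanonicalBox.toSet, WithTop.coe_lt_top]
  | cons t T ih =>
    intro b top hT hb ht hz
    rw [List.pairwise_cons] at hT
    simp only [List.mem_cons, forall_eq_or_imp] at hb ht
    have hfar : ∀ q : ℝ × ℝ × ℝ, q.2.1 < t.1 →
        ¬ ∃ t' ∈ t :: T, t'.1 ≤ q.2.1 ∧ t'.2 ≤ q.2.2 := by
      rintro q hq ⟨t', ht', h1, -⟩
      rcases List.mem_cons.1 ht' with rfl | ht'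
      · linarith
      · linarith [(hT.1 t' ht').1]
    by_cases hzt : z < t.2
    · obtain ⟨L, h1, h2, h3, h4⟩ := ih t.1 t.2 hT.2 (fun s hs => (hT.1 s hs).1)
        (fun s hs => WithTop.coe_lt_coe.2 (hT.1 s hs).2) (WithTop.coe_lt_coe.2 hzt)
      -- The new point is below the step `t`: one box ends at `t.1`, and the boxes further on are
      -- below the height `t.2`.
      refine ⟨⟨x, b, z, t.1, top, WithTop.coe_lt_coe.2 hb.1, hz⟩ :: L, ?_, ?_, ?_, fun q => ?_⟩
      · rw [List.dropWhile_cons_of_pos (by simpa using hzt), List.length_cons, List.length_cons]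
        omega
      · simpa using h2
      · refine List.pairwise_cons.2 ⟨fun B hB => Set.disjoint_left.2 fun q hq hq' => ?_, h3⟩
        have h5 := ((h4 q).1 ⟨B, hB, hq'⟩).2.1
        have h6 := WithTop.coe_lt_coe.1 hq.2.1.2
        linarith
      · rw [List.exists_mem_cons_iff, h4]
        constructor
        · rintro (⟨h5, ⟨h6, h7⟩, h8, h9⟩ | ⟨h5, h6, h7, h8, h9⟩)
          · exact ⟨h5, h6, h8, h9, hfar q (WithTop.coe_lt_coe.1 h7)⟩
          · refine ⟨h5, hb.1.le.trans h6, h7, h8.trans ht.1, ?_⟩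
            rw [List.exists_mem_cons_iff]
            rintro (h10 | h10)
            · linarith [WithTop.coe_lt_coe.1 h8, h10.2]
            · exact h9 h10
        · rintro ⟨h5, h6, h7, h8, h9⟩
          rw [List.exists_mem_cons_iff, not_or] at h9
          rcases lt_or_ge q.2.1 t.1 with h10 | h10
          · exact Or.inl ⟨h5, ⟨h6, WithTop.coe_lt_coe.2 h10⟩, h7, h8⟩
          · refine Or.inr ⟨h5, h10, h7, WithTop.coe_lt_coe.2 ?_, h9.2⟩
            by_contra h11
            exact h9.1 ⟨h10, not_lt.1 h11⟩
    -- The step `t` is not above the new point, so the region from `t.1` on has been swept already.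
    · refine ⟨[⟨x, b, z, t.1, top, WithTop.coe_lt_coe.2 hb.1, hz⟩], ?_, by simp, by simp,
        fun q => ?_⟩
      · rw [List.dropWhile_cons_of_neg (by simpa using hzt), List.length_singleton, add_comm]
      · rw [List.exists_mem_cons_iff]
        constructor
        · rintro (⟨h5, ⟨h6, h7⟩, h8, h9⟩ | h)
          · exact ⟨h5, h6, h8, h9, hfar q (WithTop.coe_lt_coe.1 h7)⟩
          · simp at h
        · rintro ⟨h5, h6, h7, h8, h9⟩
          refine Or.inl ⟨h5, ⟨h6, WithTop.coe_lt_coe.2 ?_⟩, h7, h8⟩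
          by_contra h10
          exact h9 ⟨t, by simp, not_lt.1 h10, (not_lt.1 hzt).trans h7⟩

/-- Sweep over the points `(-b, b, z)` by increasing first coordinate.  The staircase `T` bounds
the projection of the region that has been swept; a point pays for one new box and for the step
that it adds to the staircase, and this step pays for the box in which it is removed. -/
theorem exists_boxes_of_points (l : List (ℝ × ℝ))
    (hl : l.Pairwise fun p p' => p.1 < p'.1 ∧ p.2 ≠ p'.2) :
    ∃ (L : List CanonicalBox) (T : List (ℝ × ℝ)), L.length + T.length ≤ 2 * l.length ∧
      T.Pairwise (fun s t => s.1 < t.1 ∧ t.2 < s.2) ∧ (∀ t ∈ T, t ∈ l) ∧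
      (∀ p ∈ l, ∃ t ∈ T, t.1 ≤ p.1 ∧ t.2 ≤ p.2) ∧ (∀ B ∈ L, ∃ p ∈ l, B.x₁ = -p.1) ∧
      L.Pairwise (fun B B' => Disjoint B.toSet B'.toSet) ∧
      ∀ q : ℝ × ℝ × ℝ, (∃ B ∈ L, q ∈ B.toSet) ↔
        ∃ p ∈ l, -p.1 ≤ q.1 ∧ p.1 ≤ q.2.1 ∧ p.2 ≤ q.2.2 := by
  induction l with
  | nil => exact ⟨[], [], by simp⟩
  | cons p l ih =>
    rw [List.pairwise_cons] at hl
    obtain ⟨L, T, h1, h2, h3, h4, h5, h6, h7⟩ := ih hl.2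
    obtain ⟨L', k1, k2, k3, k4⟩ := exists_boxes_above_staircase (-p.1) p.2 T p.1 ⊤ h2
      (fun t ht => (hl.1 t (h3 t ht)).1) (fun t _ => WithTop.coe_lt_top _) (WithTop.coe_lt_top _)
    have hsub := List.dropWhile_sublist (fun t : ℝ × ℝ => decide (p.2 < t.2)) (l := T)
    have hT' := h2.sublist hsub
    -- the steps after `dropWhile` are below the new point
    have hlow : ∀ t ∈ T.dropWhile (fun t => decide (p.2 < t.2)), t.2 < p.2 := by
      intro t ht
      have hne : T.dropWhile (fun t => decide (p.2 < t.2)) ≠ [] := List.ne_nil_of_mem ht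
      have hhead := List.head_dropWhile_not (fun t : ℝ × ℝ => decide (p.2 < t.2)) hne
      obtain ⟨u, T', hu⟩ := List.exists_cons_of_ne_nil hne
      simp only [hu, List.head_cons, decide_eq_false_iff_not, not_lt] at hhead
      have hu' : u ∈ T := hsub.subset (by rw [hu]; simp)
      have hlt : u.2 < p.2 := lt_of_le_of_ne hhead (hl.1 u (h3 u hu')).2.symm
      rw [hu] at ht hT'
      rcases List.mem_cons.1 ht with rfl | ht
      · exact hlt
      · exact ((List.pairwise_cons.1 hT').1 t ht).2.trans hlt
    refine ⟨L' ++ L, p :: T.dropWhile (fun t => decide (p.2 < t.2)), ?_, ?_, ?_, ?_, ?_, ?_,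
      fun q => ?_⟩
    · simp only [List.length_append, List.length_cons]
      omega
    · exact List.pairwise_cons.2
        ⟨fun t ht => ⟨(hl.1 t (h3 t (hsub.subset ht))).1, hlow t ht⟩, hT'⟩
    · simp only [List.mem_cons, forall_eq_or_imp, true_or, true_and]
      exact fun t ht => Or.inr (h3 t (hsub.subset ht))
    · simp only [List.mem_cons, forall_eq_or_imp, exists_eq_or_imp, le_refl, true_and, true_or]
      intro p' hp'
      obtain ⟨t, ht, h8, h9⟩ := h4 p' hp'
      by_cases h10 : t ∈ T.dropWhile (fun t => decide (p.2 < t.2))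
      · exact Or.inr ⟨t, h10, h8, h9⟩
      · left
        rw [← List.takeWhile_append_dropWhile (p := fun t : ℝ × ℝ => decide (p.2 < t.2)) (l := T),
          List.mem_append, or_iff_left h10] at ht
        have := List.mem_takeWhile_imp ht
        exact ⟨(hl.1 p' hp').1.le, (of_decide_eq_true this).le.trans h9⟩
    · intro B hB
      rcases List.mem_append.1 hB with hB | hB
      · exact ⟨p, by simp, k2 B hB⟩
      · obtain ⟨p', hp', h8⟩ := h5 B hB
        exact ⟨p', by simp [hp'], h8⟩
    · refine List.pairwise_append.2 ⟨k3, h6, fun B hB B' hB' =>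
        Set.disjoint_left.2 fun q hq hq' => ?_⟩
      obtain ⟨-, -, -, -, h8⟩ := (k4 q).1 ⟨B, hB, hq⟩
      obtain ⟨p', hp', -, h9, h10⟩ := (h7 q).1 ⟨B', hB', hq'⟩
      obtain ⟨t, ht, h11, h12⟩ := h4 p' hp'
      exact h8 ⟨t, ht, h11.trans h9, h12.trans h10⟩
    · rw [List.exists_mem_cons_iff]
      simp only [List.mem_append, or_and_right, exists_or, k4, h7]
      constructor
      · rintro (⟨h8, h9, h10, -, -⟩ | h)
        · exact Or.inl ⟨h8, h9, h10⟩
        · exact Or.inr h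
      · rintro (⟨h8, h9, h10⟩ | h)
        · by_cases h11 : ∃ t ∈ T, t.1 ≤ q.2.1 ∧ t.2 ≤ q.2.2
          · obtain ⟨t, ht, h12, h13⟩ := h11
            exact Or.inr ⟨t, h3 t ht, by linarith [(hl.1 t (h3 t ht)).1], h12, h13⟩
          · exact Or.inl ⟨h8, h9, h10, WithTop.coe_lt_top _, h11⟩
        · exact Or.inr h

section Decomposes

variable {n : ℕ} {P : Fin n → ℝ × ℝ} {col : Fin n → Fin n}

/-- The boxes are constructed color by color. Boxes of different colors are different, since the
first coordinate of the corner of a box determines the point that it was created for. -/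
theorem exists_decomposes {lift : ℝ × ℝ → ℝ × ℝ × ℝ} {z : Fin n → ℝ}
    (hlift : ∀ i, lift (P i) = (-(P i).1, (P i).1, z i))
    (hx : Function.Injective fun i => (P i).1) (hz : Function.Injective z) (s : Finset (Fin n)) :
    ∃ D : ColoredBoxes n, D.Decomposes P col lift s := by
  have hcolor : ∀ c : Fin n, ∃ L : List CanonicalBox,
      L.length ≤ 2 * (s.filter fun p => col p = c).card ∧
      (∀ B ∈ L, ∃ p ∈ s, col p = c ∧ B.x₁ = -(P p).1) ∧
      L.Pairwise (fun B B' => Disjoint B.toSet B'.toSet) ∧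
      ∀ q : ℝ × ℝ × ℝ, (∃ B ∈ L, q ∈ B.toSet) ↔
        ∃ p ∈ s, col p = c ∧ -(P p).1 ≤ q.1 ∧ (P p).1 ≤ q.2.1 ∧ z p ≤ q.2.2 := by
    intro c
    set l := ((s.filter fun p => col p = c).toList.mergeSort
      fun i j => decide ((P i).1 ≤ (P j).1)) with hl
    have hperm : l.Perm (s.filter fun p => col p = c).toList := List.mergeSort_perm _ _
    have hmem : ∀ p, p ∈ l ↔ p ∈ s ∧ col p = c := fun p => by
      rw [hperm.mem_iff, Finset.mem_toList, Finset.mem_filter]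
    have hsorted : l.Pairwise fun i j => decide ((P i).1 ≤ (P j).1) = true :=
      List.pairwise_mergeSort (fun a b c h h' => by simp at *; linarith)
        (fun a b => by simpa using le_total _ _) _
    have hnd : l.Nodup := hperm.nodup_iff.2 (Finset.nodup_toList _)
    obtain ⟨L, T, h1, -, -, -, h5, h6, h7⟩ := exists_boxes_of_points
      (l.map fun p => ((P p).1, z p)) (List.pairwise_map.2 ((hsorted.and hnd).imp fun h =>
        ⟨lt_of_le_of_ne (by simpa using h.1) fun h' => h.2 (hx h'), fun h' => h.2 (hz h')⟩))
    refine ⟨L, ?_, fun B hB => ?_, h6, fun q => ?_⟩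
    · rw [List.length_map, hperm.length_eq, Finset.length_toList] at h1
      omega
    · obtain ⟨p', hp', h8⟩ := h5 B hB
      obtain ⟨p, hp, rfl⟩ := List.mem_map.1 hp'
      exact ⟨p, ((hmem p).1 hp).1, ((hmem p).1 hp).2, h8⟩
    · rw [h7]
      constructor
      · rintro ⟨p', hp', h8⟩
        obtain ⟨p, hp, rfl⟩ := List.mem_map.1 hp'
        exact ⟨p, ((hmem p).1 hp).1, ((hmem p).1 hp).2, h8⟩
      · rintro ⟨p, hp, hpc, h8⟩
        exact ⟨_, List.mem_map.2 ⟨p, (hmem p).2 ⟨hp, hpc⟩, rfl⟩, h8⟩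
  choose L hlen hfst hdisj hmem using hcolor
  set l : List (CanonicalBox × Fin n) :=
    (List.finRange n).flatMap fun c => (L c).map fun B => (B, c) with hl
  have hml : ∀ B c, (B, c) ∈ l ↔ B ∈ L c := by
    intro B c
    simp only [hl, List.mem_flatMap, List.mem_finRange, true_and, List.mem_map, Prod.mk.injEq]
    exact ⟨fun ⟨c', B', h1, h2, h3⟩ => by subst h2 h3; exact h1, fun h => ⟨c, B, h, rfl, rfl⟩⟩
  have hpair : l.Pairwise fun a a' =>
      a.1 ≠ a'.1 ∧ (a.2 = a'.2 → Disjoint a.1.toSet a'.1.toSet) := by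
    refine List.pairwise_flatMap.2 ⟨fun c _ => List.pairwise_map.2 ((hdisj c).imp fun {B B'} h =>
      ⟨?_, fun _ => h⟩), (List.nodup_finRange n).imp fun {c c'} hne a ha a' ha' => ?_⟩
    · obtain ⟨B, hB, rfl⟩ := List.mem_map.1 ha
      obtain ⟨B', hB', rfl⟩ := List.mem_map.1 ha'
      refine ⟨fun h => ?_, fun h => absurd h hne⟩
      obtain ⟨p, -, hp, h1⟩ := hfst c B hB
      obtain ⟨p', -, hp', h1'⟩ := hfst c' B' hB'
      simp only at h
      rw [h] at h1
      have : p = p' := hx (by simp only; linarith)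
      exact hne (by rw [← hp, ← hp', this])
    · intro h'
      simp only at h'
      subst h'
      exact Set.disjoint_left.1 h B.toSet_nonempty B.toSet_nonempty
  have hij : ∀ i j : Fin l.length, i ≠ j → l[i].1 ≠ l[j].1 ∧
      (l[i].2 = l[j].2 → Disjoint l[i].1.toSet l[j].1.toSet) := by
    intro i j hne
    rcases lt_or_gt_of_ne hne with h | h
    · exact List.pairwise_iff_getElem.1 hpair _ _ i.2 j.2 h
    · obtain ⟨h1, h2⟩ := List.pairwise_iff_getElem.1 hpair _ _ j.2 i.2 h
      exact ⟨h1.symm, fun h => (h2 h.symm).symm⟩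
  refine ⟨⟨l.length, fun i => l[i].1, fun i => l[i].2⟩, ?_, fun i j h => ?_,
    fun i j hne => (hij i j hne).2, fun c => ?_⟩
  · change l.length ≤ _
    rw [Finset.card_eq_sum_card_fiberwise (f := col) (t := Finset.univ) (by simp [Set.MapsTo]),
      Finset.mul_sum, hl, List.length_flatMap]
    simp only [List.length_map]
    rw [← Fin.sum_univ_def]
    exact Finset.sum_le_sum fun c _ => hlen c
  · by_contra hne
    exact (hij i j hne).1 h
  · ext q
    simp only [Set.mem_ofPred_eq, Set.mem_iUnion, exists_prop, hlift, Set.mem_Ici, Prod.le_def]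
    have h1 := hmem c q
    simp only [and_assoc] at h1 ⊢
    rw [← h1]
    constructor
    · rintro ⟨i, hi, hq⟩
      refine ⟨l[i].1, (hml _ _).1 ?_, hq⟩
      rw [← hi]
      exact List.getElem_mem _
    · rintro ⟨B, hB, hq⟩
      obtain ⟨i, hi, h2⟩ := List.mem_iff_getElem.1 ((hml _ _).2 hB)
      exact ⟨⟨i, hi⟩, by simp [h2], by simpa [h2] using hq⟩

theorem exists_decomposes_liftTop (hx : Function.Injective fun i => (P i).1)
    (hy : Function.Injective fun i => (P i).2) (s : Finset (Fin n)) :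
    ∃ D : ColoredBoxes n, D.Decomposes P col liftTop s :=
  exists_decomposes (z := fun i => -(P i).2) (fun _ => rfl) hx (fun _ _ h => hy (neg_injective h)) s

theorem exists_decomposes_liftBot (hx : Function.Injective fun i => (P i).1)
    (hy : Function.Injective fun i => (P i).2) (s : Finset (Fin n)) :
    ∃ D : ColoredBoxes n, D.Decomposes P col liftBot s :=
  exists_decomposes (z := fun i => (P i).2) (fun _ => rfl) hx hy s

/-- A box of a nonempty point set exists, since the region is nonempty. -/
theorem ColoredBoxes.Decomposes.pos {D : ColoredBoxes n} {lift : ℝ × ℝ → ℝ × ℝ × ℝ}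
    {s : Finset (Fin n)} (h : D.Decomposes P col lift s) (hs : s.Nonempty) : 1 ≤ D.N := by
  obtain ⟨p, hp⟩ := hs
  have h1 : lift (P p) ∈ ⋃ p' ∈ {p' | p' ∈ s ∧ col p' = col p}, Set.Ici (lift (P p')) :=
    Set.mem_biUnion (x := p) ⟨hp, rfl⟩ Set.self_mem_Ici
  rw [← h.union (col p)] at h1
  obtain ⟨i, -⟩ := Set.mem_iUnion.1 h1
  exact i.pos

end Decomposes

/-! ### Ranks of the points -/

section Ranks

variable {n : ℕ} {P : Fin n → ℝ × ℝ} {col : Fin n → Fin n}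

theorem yRank_lt (i : Fin n) : yRank P i < n := by
  have h : (Finset.univ.filter fun j => (P j).2 < (P i).2) ⊂ Finset.univ :=
    Finset.filter_ssubset.2 ⟨i, by simp⟩
  simpa [yRank] using Finset.card_lt_card h

theorem yRank_lt_yRank {i j : Fin n} : yRank P i < yRank P j ↔ (P i).2 < (P j).2 := by
  constructor
  · intro h
    by_contra h'
    refine absurd h (not_lt.2 (Finset.card_le_card fun k hk => ?_))
    simp only [Finset.mem_filter, Finset.mem_univ, true_and] at hk ⊢
    exact hk.trans_le (not_lt.1 h')
  · intro h
    refine Finset.card_lt_card ⟨fun k hk => ?_, fun h' => ?_⟩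
    · simp only [Finset.mem_filter, Finset.mem_univ, true_and] at hk ⊢
      exact hk.trans h
    · simpa using h' (x := i) (by simpa using h)

theorem yRank_injective (hy : Function.Injective fun i => (P i).2) :
    Function.Injective (yRank P) := fun i j h => by
  by_contra hne
  rcases lt_or_gt_of_ne fun h' => hne (hy h') with h' | h'
  · exact absurd (yRank_lt_yRank.2 h') (by omega)
  · exact absurd (yRank_lt_yRank.2 h') (by omega)

/-- The point with a given rank. -/
theorem exists_equiv_yRank (hy : Function.Injective fun i => (P i).2) :
    ∃ e : Fin n ≃ Fin n, ∀ k, yRank P (e k) = k := by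
  let f : Fin n → Fin n := fun i => ⟨yRank P i, yRank_lt i⟩
  have hf : Function.Injective f := fun i j h => yRank_injective hy (by simpa [f] using h)
  refine ⟨(Equiv.ofBijective f (Finite.injective_iff_bijective.1 hf)).symm, fun k => ?_⟩
  have h := (Equiv.ofBijective f (Finite.injective_iff_bijective.1 hf)).apply_symm_apply k
  exact congrArg Fin.val h

theorem mem_nodePoints {lo hi : ℕ} {i : Fin n} :
    i ∈ nodePoints P lo hi ↔ lo ≤ yRank P i ∧ yRank P i < hi := by
  simp [nodePoints]

theorem card_nodePoints (hy : Function.Injective fun i => (P i).2) {lo hi : ℕ} (h : hi ≤ n) :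
    (nodePoints P lo hi).card = hi - lo := by
  obtain ⟨e, he⟩ := exists_equiv_yRank hy
  rw [← Finset.card_image_of_injective _ (yRank_injective hy), ← Nat.card_Ico]
  congr 1
  ext k
  simp only [Finset.mem_image, mem_nodePoints, Finset.mem_Ico]
  constructor
  · rintro ⟨i, hi, rfl⟩
    exact hi
  · intro hk
    exact ⟨e ⟨k, by omega⟩, by simpa [he] using hk, he _⟩

variable {key : Fin n → ℝ} {s : Finset (Fin n)}

theorem mem_sortBy {i : Fin n} : i ∈ sortBy key s ↔ i ∈ s := by
  rw [sortBy, (List.mergeSort_perm _ _).mem_iff, Finset.mem_toList]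

theorem length_sortBy : (sortBy key s).length = s.card := by
  rw [sortBy, List.length_mergeSort, Finset.length_toList]

theorem nodup_sortBy : (sortBy key s).Nodup :=
  (List.mergeSort_perm _ _).nodup_iff.2 (Finset.nodup_toList _)

theorem pairwise_sortBy : (sortBy key s).Pairwise fun i j => key i ≤ key j :=
  (List.pairwise_mergeSort (le := fun i j => decide (key i ≤ key j))
    (fun a b c h h' => by simp at *; linarith) (fun a b => by simpa using le_total _ _) _).imp
      fun h => by simpa using h

theorem length_rankSpace (hy : Function.Injective fun i => (P i).2) {lo hi : ℕ} (h : hi ≤ n) :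
    (rankSpace P col lo hi).length = hi - lo := by
  rw [rankSpace, List.length_map, length_sortBy, card_nodePoints hy h]

theorem rankSpace_perm (hy : Function.Injective fun i => (P i).2) {lo hi : ℕ} (h : hi ≤ n) :
    ((rankSpace P col lo hi).map Prod.fst).Perm (List.range (rankSpace P col lo hi).length) := by
  obtain ⟨e, he⟩ := exists_equiv_yRank hy
  rw [length_rankSpace hy h, rankSpace, List.map_map]
  refine (List.perm_ext_iff_of_nodup (List.Nodup.map_on (fun i hi j hj hij => ?_) nodup_sortBy)
    List.nodup_range).2 fun k => ?_
  · rw [mem_sortBy, mem_nodePoints] at hi hj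
    simp only [Function.comp_apply] at hij
    exact yRank_injective hy (by omega)
  · simp only [List.mem_map, mem_sortBy, mem_nodePoints, Function.comp_apply, List.mem_range]
    constructor
    · rintro ⟨i, hi, rfl⟩
      omega
    · intro hk
      exact ⟨e ⟨k + lo, by omega⟩, by simp only [he]; omega, by simp only [he]; omega⟩

end Ranks

/-! ### Blocks and the matrix -/

section Blocks

/-- A position in a concatenation of lists is a list and a position in this list. -/
theorem getElem?_flatMap {α β : Type*} {l : List α} {f : α → List β} {k j : ℕ} {x : α}
    (hk : l[k]? = some x) (hj : j < (f x).length) :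
    (l.flatMap f)[((l.take k).flatMap f).length + j]? = (f x)[j]? := by
  obtain ⟨h1, h2⟩ := List.getElem?_eq_some_iff.1 hk
  have h3 : l = l.take k ++ x :: l.drop (k + 1) := by
    rw [← h2, List.cons_getElem_drop_succ, List.take_append_drop]
  conv_lhs => rw [h3]
  rw [List.flatMap_append, List.flatMap_cons]
  have h4 : (l.take k ++ x :: l.drop (k + 1)).take k = l.take k := by rw [← h3]
  rw [h4, List.getElem?_append_right (by omega), Nat.add_sub_cancel_left,
    List.getElem?_append_left hj]

variable {N : ℕ}

/-- The number of full blocks of the bottom lists before that of `v`. -/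
def firstBlock (X : ℕ) (bottom : ℕ → List (Fin N)) (v : ℕ) : ℕ :=
  ((List.range v).map fun u => (bottom u).length / X).sum

theorem firstBlock_succ (X : ℕ) (bottom : ℕ → List (Fin N)) (v : ℕ) :
    firstBlock X bottom (v + 1) = firstBlock X bottom v + (bottom v).length / X := by
  simp [firstBlock, List.range_succ]

theorem firstBlock_mono (X : ℕ) (bottom : ℕ → List (Fin N)) : Monotone (firstBlock X bottom) :=
  monotone_nat_of_le_succ fun v => by rw [firstBlock_succ]; exact Nat.le_add_right _ _

theorem length_flatMap_blocks (X v : ℕ) (bottom : ℕ → List (Fin N)) :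
    ((List.range v).flatMap fun u =>
      (List.range ((bottom u).length / X)).map fun k => (bottom u).take ((k + 1) * X)).length =
      firstBlock X bottom v := by
  simp [firstBlock, List.length_flatMap]

theorem length_fullPrefixes (X size : ℕ) (bottom : ℕ → List (Fin N)) :
    (fullPrefixes X size bottom).length = firstBlock X bottom size :=
  length_flatMap_blocks X size bottom

/-- The prefix with `k + 1` full blocks of the list `v` comes after those of the lists before `v`
and the `k` shorter ones. -/
theorem getElem?_fullPrefixes {X size v k : ℕ} {bottom : ℕ → List (Fin N)} (hv : v < size)
    (hk : k < (bottom v).length / X) :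
    (fullPrefixes X size bottom)[firstBlock X bottom v + k]? =
      some ((bottom v).take ((k + 1) * X)) := by
  have h := getElem?_flatMap (l := List.range size) (k := v) (j := k) (x := v)
    (f := fun v => (List.range ((bottom v).length / X)).map fun k => (bottom v).take ((k + 1) * X))
    (by simp [hv]) (by simpa using hk)
  rw [List.take_range, min_eq_left hv.le, length_flatMap_blocks] at h
  rw [fullPrefixes, h]
  simp [hk]

variable {w : ℕ → ℕ} {S : StabbingStructure w} {n X : ℕ} {D D' : ColoredBoxes n}

theorem length_matrixCells : (matrixCells S X D D').length =
    (fullPrefixes X (S.image n D.box).length (S.bottom n D.box)).length *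
      (fullPrefixes X (S.image n D'.box).length (S.bottom n D'.box)).length :=
  length_flatMap_const fun _ _ => by rw [List.length_map]

theorem getElem?_matrixCells {i j : ℕ} {s : List (Fin D.N)} {t : List (Fin D'.N)}
    (hi : (fullPrefixes X (S.image n D.box).length (S.bottom n D.box))[i]? = some s)
    (hj : (fullPrefixes X (S.image n D'.box).length (S.bottom n D'.box))[j]? = some t) :
    (matrixCells S X D D')[i *
      (fullPrefixes X (S.image n D'.box).length (S.bottom n D'.box)).length + j]? =
      some (.word (BitVec.ofNat (w n) (commonColors D D' s t))) := by
  have hj' := (List.getElem?_eq_some_iff.1 hj).1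
  have h := getElem?_flatMap (j := j) (f := fun s =>
    (fullPrefixes X (S.image n D'.box).length (S.bottom n D'.box)).map fun t =>
      Cell.word (BitVec.ofNat (w n) (commonColors D D' s t))) hi (by simpa using hj')
  rw [length_flatMap_const (k := (fullPrefixes X (S.image n D'.box).length
    (S.bottom n D'.box)).length) fun _ _ => by rw [List.length_map], List.length_take,
    min_eq_left (List.getElem?_eq_some_iff.1 hi).1.le] at h
  rw [matrixCells, h, List.getElem?_map, hj]
  rfl

end Blocks

/-! ### The structures of a node answer the query -/

section Specs

variable {w : ℕ → ℕ} {S : StabbingStructure w} {n X Sc : ℕ} {P : Fin n → ℝ × ℝ}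
  {col : Fin n → Fin n} {D D' : ColoredBoxes n} {lift : ℝ × ℝ → ℝ × ℝ × ℝ} {s : Finset (Fin n)}
  {δ space φ cst τ scratch : ℝ}

/-- The numbers of the first full blocks of the bottom lists. -/
def blockTable (S : StabbingStructure w) (X : ℕ) (D : ColoredBoxes n) : List ℕ :=
  (List.range (S.image n D.box).length).map (firstBlock X (S.bottom n D.box))

/-- The boxes of the color `κ` cover `q` if and only if `lift (P p) ≤ q` for some `p` of this color.
As the boxes of one color are disjoint, the boxes stabbed by `q` have distinct colors, so that they
count the colors of these points. -/
theorem sideSpec_of_correct (hD : D.Decomposes P col lift s)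
    (hS : S.Correct n D.box δ space φ cst τ scratch) (q : ℝ × ℝ × ℝ) (hscratch : scratch ≤ Sc)
    (hrows : firstBlock X (S.bottom n D.box) (S.image n D.box).length ≤ Sc) (hSc : Sc < 2 ^ w n) :
    ∃ L : List (LocatedPrefix (w n)),
      SideSpec X (S.width + 1) Sc S.locate S.length S.report (S.image n D.box)
        [q.1, q.2.1, q.2.2] L (S.boxes n D.box) D.color
        ((s.filter fun p => lift (P p) ≤ q).image col)
        (fun p => firstBlock X (S.bottom n D.box) p.node) (blockTable S X D) scratch φ cst τ ∧
      L.length ≤ ⌊φ⌋₊ ∧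
      ∀ p ∈ L, p.len ≤ (S.bottom n D.box p.node).length ∧
        (0 < p.len / X → p.node < (S.image n D.box).length) := by
  obtain ⟨L, hL, hlen, hloc, hans⟩ := hS.query q
  have hbox : ∀ p ∈ L, (S.boxes n D.box p).length = p.len := fun p hp => by
    rw [StabbingStructure.boxes, List.length_take, min_eq_left (hL.is_prefix p hp)]
  have hnode : ∀ p ∈ L, 0 < p.len / X → p.node < (S.image n D.box).length := fun p hp hpos => by
    refine hS.node_lt _ fun h => ?_
    have := hL.is_prefix p hp
    rw [h, List.length_nil] at this
    rw [Nat.le_zero.1 this, Nat.zero_div] at hpos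
    exact lt_irrefl _ hpos
  have hmem : ∀ i, i ∈ L.flatMap (S.boxes n D.box) ↔ q ∈ (D.box i).toSet := fun i => by
    rw [List.mem_flatMap, hL.union]
  refine ⟨L, ⟨hscratch, hloc, fun p hp => (hans p hp).1, fun p hp => (hans p hp).2,
    fun p hp => by simp [LocatedPrefix.words, hL.aux_length p hp], hbox, ?_, fun κ => ?_,
    fun p hp hpos => ⟨?_, ?_⟩⟩, Nat.le_floor hlen, fun p hp => ⟨hL.is_prefix p hp, hnode p hp⟩⟩
  · rw [← List.map_flatMap]
    refine List.Nodup.map_on (fun i hi j hj hij => ?_) ?_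
    · by_contra hne
      exact Set.disjoint_left.1 (hD.disjoint i j hne hij) ((hmem i).1 hi) ((hmem j).1 hj)
    · refine List.nodup_flatMap.2 ⟨fun p _ => ?_, hL.disjoint⟩
      exact (hS.nodup _).sublist (List.take_sublist _ _)
  · rw [← List.map_flatMap, List.mem_map]
    simp only [hmem, Finset.mem_image, Finset.mem_filter]
    have h := Set.ext_iff.1 (hD.union κ) q
    simp only [Set.mem_iUnion, Set.mem_ofPred_eq, exists_prop, Set.mem_Ici] at h
    constructor
    · rintro ⟨p, ⟨hp, hle⟩, hκ⟩
      obtain ⟨i, hi, hq⟩ := h.2 ⟨p, ⟨hp, hκ⟩, hle⟩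
      exact ⟨i, hq, hi⟩
    · rintro ⟨i, hq, hi⟩
      obtain ⟨p, ⟨hp, hκ⟩, hle⟩ := h.1 ⟨i, hi, hq⟩
      exact ⟨p, ⟨hp, hle⟩, hκ⟩
  · rw [blockTable, List.getElem?_map, List.getElem?_range (hnode p hp hpos)]
    rfl
  · refine lt_of_le_of_lt ?_ hSc
    refine le_trans ?_ ((firstBlock_mono X _ (Nat.succ_le_of_lt (hnode p hp hpos))).trans hrows)
    rw [Nat.succ_eq_add_one, firstBlock_succ]
    exact Nat.add_le_add_left (Nat.div_le_div_right (hL.is_prefix p hp)) _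

/-- The full blocks of a located prefix form a prefix that belongs to a row (or column) of the
matrix. -/
theorem fullColors_boxes {p : LocatedPrefix (w n)} (hpos : 0 < p.len / X) :
    fullColors X (S.boxes n D.box) D.color p =
      ((S.bottom n D.box p.node).take ((p.len / X - 1 + 1) * X)).map D.color := by
  rw [fullColors, StabbingStructure.boxes, List.take_take, Nat.sub_add_cancel hpos,
    min_eq_left (Nat.div_mul_le_self _ _)]

/-- In rank space, a point has its position by `x` and its `y`-rank relative to the first rank `lo`
at the node. -/
theorem probeSpec_rankSpace {query : Cmd} {img : List (Cell (w n))} {lo hi ylo yhi : ℕ}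
    {a b te : ℝ} (hy : Function.Injective fun i => (P i).2) (hhi : hi ≤ n) (hscratch : scratch ≤ Sc)
    (hans : ∀ (c : Fin n) (x₁ x₂ y₁ y₂ : Fin (rankSpace P col lo hi).length),
      Answers query img [BitVec.ofNat (w n) c, BitVec.ofNat (w n) x₁, BitVec.ofNat (w n) x₂,
        BitVec.ofNat (w n) y₁, BitVec.ofNat (w n) y₂] [] scratch te
        (fun _ σ => (HasColorIn (rankSpace P col lo hi) c x₁ x₂ y₁ y₂ → σ.reg 0 = 1#(w n)) ∧
          (¬ HasColorIn (rankSpace P col lo hi) c x₁ x₂ y₁ y₂ → σ.reg 0 = 0#(w n))))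
    (h1 : ylo < hi - lo) (h2 : yhi < hi - lo) :
    ProbeSpec Sc query img (rankSpace P col lo hi)
      ((sortBy (fun i => (P i).1) (nodePoints P lo hi)).map fun i => (P i).1) a b ylo yhi
      (((nodePoints P lo hi).filter fun i => (a ≤ (P i).1 ∧ (P i).1 ≤ b) ∧
        (lo + ylo ≤ yRank P i ∧ yRank P i ≤ lo + yhi)).image col) scratch te := by
  refine ⟨hscratch, hans, ?_, ?_, ?_, ?_, ?_, fun κ => ?_⟩
  · rw [rankSpace, List.length_map, List.length_map]
  · rw [length_rankSpace hy hhi]; omega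
  · exact List.pairwise_map.2 pairwise_sortBy
  · rwa [length_rankSpace hy hhi]
  · rwa [length_rankSpace hy hhi]
  · simp only [Finset.mem_image, Finset.mem_filter, rankSpace, List.getElem?_map,
      Option.map_eq_some_iff]
    constructor
    · rintro ⟨i, ⟨hi', h3, h4⟩, rfl⟩
      obtain ⟨k, hk⟩ := List.mem_iff_getElem?.1 (mem_sortBy (key := fun i => (P i).1).2 hi')
      rw [mem_nodePoints] at hi'
      exact ⟨k, yRank P i - lo, (P i).1, ⟨i, hk, rfl⟩, ⟨i, hk, rfl⟩, h3, by omega, by omega⟩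
    · rintro ⟨k, y, x, ⟨i, hk, hi'⟩, ⟨j, hk', rfl⟩, h3, h4⟩
      rw [hk] at hk'
      obtain rfl := Option.some.inj hk'
      have h5 := mem_sortBy.1 (List.mem_of_getElem? hk)
      rw [Prod.mk.injEq] at hi'
      refine ⟨i, ⟨h5, h3, ?_⟩, hi'.2⟩
      rw [mem_nodePoints] at h5
      omega

/-- What is stored for the node `[lo, hi)`. -/
noncomputable def nodeParts (P : Fin n → ℝ × ℝ) (col : Fin n → Fin n) (S : StabbingStructure w)
    (E : EmptinessStructure w) (X : ℕ) (D D' : ColoredBoxes n) (lo hi : ℕ) : NodeParts (w n) where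
  imgL := S.image n D.box
  colL := List.ofFn fun i => Cell.word (BitVec.ofNat (w n) (D.color i))
  imgR := S.image n D'.box
  colR := List.ofFn fun i => Cell.word (BitVec.ofNat (w n) (D'.color i))
  empL := E.image n (rankSpace P col lo ((lo + hi) / 2))
  empR := E.image n (rankSpace P col ((lo + hi) / 2) hi)
  mat := matrixCells S X D D'
  ncol := (fullPrefixes X (S.image n D'.box).length (S.bottom n D'.box)).length
  tblL := blockTable S X D
  tblR := blockTable S X D'
  xsL := (sortBy (fun i => (P i).1) (nodePoints P lo ((lo + hi) / 2))).map fun i => (P i).1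
  xsR := (sortBy (fun i => (P i).1) (nodePoints P ((lo + hi) / 2) hi)).map fun i => (P i).1

/-- At a node that separates `c` and `d`, the points of the left child below `d` are all its
points, and those of the right child above `c` are all its points: the two dominance queries find
the colors in the rectangle. -/
theorem nodeSpec_nodeParts {E : EmptinessStructure w} {lo hi yl yr : ℕ} {a b c d : ℝ}
    {space' scratch' te : ℝ} (hy : Function.Injective fun i => (P i).2) (hhi : hi ≤ n)
    (hD : D.Decomposes P col liftTop (nodePoints P lo ((lo + hi) / 2)))
    (hD' : D'.Decomposes P col liftBot (nodePoints P ((lo + hi) / 2) hi))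
    (hS : S.Correct n D.box δ space φ cst τ scratch)
    (hS' : S.Correct n D'.box δ space' φ cst τ scratch')
    (hscratch : scratch ≤ Sc) (hscratch' : scratch' ≤ Sc) (hSc : Sc < 2 ^ w n)
    (hrows : firstBlock X (S.bottom n D.box) (S.image n D.box).length ≤ Sc)
    (hrows' : firstBlock X (S.bottom n D'.box) (S.image n D'.box).length ≤ Sc)
    (hE : ∀ lo' hi' : ℕ, lo' < hi' → hi' ≤ n → ∃ sc : ℝ, sc ≤ Sc ∧
      ∀ (c : Fin n) (x₁ x₂ y₁ y₂ : Fin (rankSpace P col lo' hi').length),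
      Answers E.query (E.image n (rankSpace P col lo' hi')) [BitVec.ofNat (w n) c,
        BitVec.ofNat (w n) x₁, BitVec.ofNat (w n) x₂, BitVec.ofNat (w n) y₁,
        BitVec.ofNat (w n) y₂] [] sc te
        (fun _ σ => (HasColorIn (rankSpace P col lo' hi') c x₁ x₂ y₁ y₂ → σ.reg 0 = 1#(w n)) ∧
          (¬ HasColorIn (rankSpace P col lo' hi') c x₁ x₂ y₁ y₂ → σ.reg 0 = 0#(w n))))
    (h1 : lo ≤ yl) (h2 : yl < (lo + hi) / 2) (h3 : (lo + hi) / 2 < yr) (h4 : yr ≤ hi)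
    (hrank : ∀ i : Fin n, yl ≤ yRank P i ∧ yRank P i < yr ↔ c ≤ (P i).2 ∧ (P i).2 ≤ d) :
    NodeSpec n X (S.width + 1) Sc ⌊φ⌋₊ S.locate S.length S.report E.query φ cst τ te a b c d lo
      ((lo + hi) / 2) hi yl yr (nodeParts P col S E X D D' lo hi) (colorCount P col a b c d) := by
  obtain ⟨e, he⟩ := exists_equiv_yRank hy
  set mid := (lo + hi) / 2 with hmid
  have hlt : ∀ (i : Fin n) (k : ℕ) (hk : k < n), yRank P i < k ↔ (P i).2 < (P (e ⟨k, hk⟩)).2 := by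
    intro i k hk
    rw [← yRank_lt_yRank, he]
  -- On the left of `mid` every point is below the point of rank `mid`, which is at most `d`, so
  -- only `c` matters.
  have hc : ∀ i : Fin n, yRank P i < mid → (c ≤ (P i).2 ↔ yl ≤ yRank P i) := by
    intro i hi'
    have h5 := (hrank (e ⟨mid, by omega⟩)).1 (by simp only [he]; omega)
    have h6 := (hlt i mid (by omega)).1 hi'
    exact ⟨fun h => ((hrank i).2 ⟨h, by linarith⟩).1, fun h => ((hrank i).1 ⟨h, by omega⟩).1⟩
  -- On the right of `mid` only `d` matters.
  have hd : ∀ i : Fin n, mid ≤ yRank P i → ((P i).2 ≤ d ↔ yRank P i < yr) := by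
    intro i hi'
    have h5 := (hrank (e ⟨yl, by omega⟩)).1 (by simp only [he]; omega)
    have h6 : (P (e ⟨yl, by omega⟩)).2 < (P i).2 := yRank_lt_yRank.1 (by rw [he]; simp only; omega)
    exact ⟨fun h => ((hrank i).2 ⟨by linarith, h⟩).2, fun h => ((hrank i).1 ⟨by omega, h⟩).2⟩
  obtain ⟨DL, sL, lenL, preL⟩ := sideSpec_of_correct hD hS (-a, b, -c) hscratch hrows hSc
  obtain ⟨DR, sR, lenR, preR⟩ := sideSpec_of_correct hD' hS' (-a, b, d) hscratch' hrows' hSc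
  obtain ⟨scL, hscL, ansL⟩ := hE lo mid (by omega) (by omega)
  obtain ⟨scR, hscR, ansR⟩ := hE mid hi (by omega) hhi
  have pL := probeSpec_rankSpace (a := a) (b := b) (ylo := yl - lo) (yhi := mid - lo - 1) hy
    (by omega) hscL ansL (by omega) (by omega)
  have pR := probeSpec_rankSpace (a := a) (b := b) (ylo := 0) (yhi := yr - 1 - mid) hy
    hhi hscR ansR (by omega) (by omega)
  have eL : ((nodePoints P lo mid).filter fun i => (a ≤ (P i).1 ∧ (P i).1 ≤ b) ∧
      (lo + (yl - lo) ≤ yRank P i ∧ yRank P i ≤ lo + (mid - lo - 1))) =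
      (nodePoints P lo mid).filter fun i => liftTop (P i) ≤ (-a, b, -c) := by
    refine Finset.filter_congr fun i hi' => ?_
    rw [mem_nodePoints] at hi'
    simp only [liftTop, Prod.mk_le_mk, neg_le_neg_iff, hc i hi'.2, and_assoc]
    refine and_congr_right fun _ => and_congr_right fun _ => ?_
    omega
  have eR : ((nodePoints P mid hi).filter fun i => (a ≤ (P i).1 ∧ (P i).1 ≤ b) ∧
      (mid + 0 ≤ yRank P i ∧ yRank P i ≤ mid + (yr - 1 - mid))) =
      (nodePoints P mid hi).filter fun i => liftBot (P i) ≤ (-a, b, d) := by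
    refine Finset.filter_congr fun i hi' => ?_
    rw [mem_nodePoints] at hi'
    simp only [liftBot, Prod.mk_le_mk, neg_le_neg_iff, hd i hi'.1, and_assoc]
    refine and_congr_right fun _ => and_congr_right fun _ => ?_
    omega
  rw [eL] at pL
  rw [eR] at pR
  refine ⟨D.N, D'.N, DL, DR, _, _, D.color, D'.color, _, _, _, _, _, _, _, _, _, _, sL, sR, pL, pR,
    ⟨(length_rankSpace hy (by omega)).symm, (length_rankSpace hy hhi).symm⟩, rfl, rfl,
    fun p hp p' hp' hpos hpos' => ?_, fun p hp hpos => ?_, ⟨lenL, lenR⟩, ?_⟩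
  · have h5 := getElem?_matrixCells (S := S) (X := X) (D := D) (D' := D')
      (getElem?_fullPrefixes ((preL p hp).2 hpos)
        (lt_of_lt_of_le (Nat.sub_lt hpos one_pos) (Nat.div_le_div_right (preL p hp).1)))
      (getElem?_fullPrefixes ((preR p' hp').2 hpos')
        (lt_of_lt_of_le (Nat.sub_lt hpos' one_pos) (Nat.div_le_div_right (preR p' hp').1)))
    simp only [nodeParts]
    rw [h5, fullCommon, fullColors_boxes hpos, fullColors_boxes hpos', commonColors]
  · simp only [nodeParts]
    rw [length_matrixCells]
    refine Nat.mul_le_mul_right _ ?_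
    have h5 := (List.getElem?_eq_some_iff.1 (getElem?_fullPrefixes ((preL p hp).2 hpos)
      (lt_of_lt_of_le (Nat.sub_lt hpos one_pos) (Nat.div_le_div_right (preL p hp).1)))).1
    exact h5.le
  · rw [colorCount, ← Finset.image_union]
    congr 2
    ext i
    simp only [Finset.mem_filter, Finset.mem_univ, true_and, Finset.mem_union, mem_nodePoints,
      liftTop, liftBot, Prod.mk_le_mk, neg_le_neg_iff, ← hrank]
    constructor
    · rintro ⟨⟨h5, h6⟩, h7, h8⟩
      rcases lt_or_ge (yRank P i) mid with h9 | h9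
      · exact Or.inl ⟨⟨by omega, h9⟩, h5, h6, (hc i h9).2 h7⟩
      · exact Or.inr ⟨⟨h9, by omega⟩, h5, h6, (hd i h9).2 h8⟩
    · rintro (⟨⟨h5, h6⟩, h7, h8, h9⟩ | ⟨⟨h5, h6⟩, h7, h8, h9⟩)
      · exact ⟨⟨h7, h8⟩, (hc i h6).1 h9, by omega⟩
      · exact ⟨⟨h7, h8⟩, by omega, (hd i h5).1 h9⟩

end Specs

/-! ### The memory image -/

section Layout

theorem StoredBelow.append {w lim a : ℕ} {m : ℕ → Cell w} {L L' : List (Cell w)}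
    (h : StoredBelow lim m a (L ++ L')) :
    StoredBelow lim m a L ∧ StoredBelow lim m (a + L.length) L' := by
  obtain ⟨h1, h2⟩ := h
  rw [StoredAt.append_iff] at h1
  rw [List.length_append] at h2
  exact ⟨⟨h1.1, by omega⟩, h1.2, by omega⟩

theorem StoredBelow.flatMap {w lim a : ℕ} {m : ℕ → Cell w} {α : Type*} {l : List α}
    {f : α → List (Cell w)} (h : StoredBelow lim m a (l.flatMap f)) {k : ℕ} {x : α}
    (hk : l[k]? = some x) :
    StoredBelow lim m (a + ((l.take k).flatMap f).length) (f x) := by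
  refine ⟨h.stored.flatMap hk, ?_⟩
  obtain ⟨h1, h2⟩ := List.getElem?_eq_some_iff.1 hk
  have h3 := h.le
  have h4 : l = l.take k ++ x :: l.drop (k + 1) := by
    rw [← h2, List.cons_getElem_drop_succ, List.take_append_drop]
  rw [h4, List.flatMap_append, List.flatMap_cons, List.length_append, List.length_append] at h3
  omega

/-- The position of the list number `k` in the concatenation. -/
def partStart {α : Type*} (l : List (List α)) (k : ℕ) : ℕ := ((l.take k).flatMap id).length

variable {w : ℕ → ℕ} {n : ℕ} (P : Fin n → ℝ × ℝ) (col : Fin n → Fin n) (S : StabbingStructure w)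
  (E : EmptinessStructure w) (X : ℕ) (D D' : ℕ × ℕ → ColoredBoxes n) (ys xs : Fin n → ℝ)

/-- The constituents of `nodeCells`. -/
noncomputable def dataParts (v : ℕ × ℕ) : List (List (Cell (w n))) :=
  let p := nodeParts P col S E X (D v) (D' v) v.1 v.2
  [(sortBy (fun i => (P i).1) (nodePoints P v.1 v.2)).flatMap fun i =>
      [Cell.coord (P i).1, Cell.coord (P i).2, Cell.word (BitVec.ofNat (w n) (col i))],
    (sortBy (fun i => (P i).2) (nodePoints P v.1 v.2)).map fun i => Cell.coord (P i).2,
    p.imgL, p.colL, p.imgR, p.colR, p.empL, p.empR, p.mat]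

theorem nodeCells_eq (v : ℕ × ℕ) : nodeCells P col S E X (D v) (D' v) v.1 v.2 =
    (dataParts P col S E X D D' v).flatMap id := by
  simp [nodeCells, dataParts, nodeParts]

/-- The tables of a node: the numbers of rows and columns of the matrix, and the sorted
`x`-coordinates of the children. -/
noncomputable def tableParts (v : ℕ × ℕ) : List (List (Cell (w n))) :=
  let p := nodeParts P col S E X (D v) (D' v) v.1 v.2
  [natCells (w n) p.tblL, natCells (w n) p.tblR, p.xsL.map Cell.coord, p.xsR.map Cell.coord]

/-- The size of the part of the image before the data of the nodes. -/
noncomputable def auxLength : ℕ :=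
  (2 * n + 2) + 12 * (internalNodes 0 n).length +
    ((internalNodes 0 n).flatMap fun v => (tableParts P col S E X D D' v).flatMap id).length

/-- The offset of the table of number `k` of the node number `i`. -/
noncomputable def tableOffset (i k : ℕ) : ℕ :=
  (2 * n + 2) + 12 * (internalNodes 0 n).length +
    (((internalNodes 0 n).take i).flatMap fun v =>
      (tableParts P col S E X D D' v).flatMap id).length +
    partStart (tableParts P col S E X D D' ((internalNodes 0 n).getD i (0, 0))) k

/-- The offset of the constituent `k` of the data of the node number `i`. -/
noncomputable def dataOffset (i k : ℕ) : ℕ :=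
  auxLength P col S E X D D' +
    (((internalNodes 0 n).take i).flatMap fun v =>
      (dataParts P col S E X D D' v).flatMap id).length +
    partStart (dataParts P col S E X D D' ((internalNodes 0 n).getD i (0, 0))) k

/-- The record of the node number `i`. -/
noncomputable def nodeOffset (i k : ℕ) : ℕ :=
  if k < 7 then dataOffset P col S E X D D' i (k + 2)
  else if k = 7 then (nodeParts P col S E X (D ((internalNodes 0 n).getD i (0, 0)))
    (D' ((internalNodes 0 n).getD i (0, 0))) ((internalNodes 0 n).getD i (0, 0)).1
    ((internalNodes 0 n).getD i (0, 0)).2).ncol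
  else tableOffset P col S E X D D' i (k - 8)

/-- The header, the records of the nodes, and the tables. -/
noncomputable def auxCells : List (Cell (w n)) :=
  header (w n) X ys xs ++
    (((List.range (internalNodes 0 n).length).flatMap fun i => (List.range 12).map fun k =>
      Cell.word (BitVec.ofNat (w n) (nodeOffset P col S E X D D' i k))) ++
    (internalNodes 0 n).flatMap fun v => (tableParts P col S E X D D' v).flatMap id)

/-- The memory image of the framework. -/
noncomputable def frameworkImage : List (Cell (w n)) :=
  auxCells P col S E X D D' ys xs ++
    (internalNodes 0 n).flatMap fun v => nodeCells P col S E X (D v) (D' v) v.1 v.2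

theorem length_records {w m : ℕ} (f : ℕ → ℕ → ℕ) :
    ((List.range m).flatMap fun i => (List.range 12).map fun k =>
      (Cell.word (BitVec.ofNat w (f i k)))).length = 12 * m := by
  rw [length_flatMap_const (k := 12) fun _ _ => by simp, List.length_range, mul_comm]

theorem length_auxCells : (auxCells P col S E X D D' ys xs).length =
    auxLength P col S E X D D' := by
  rw [auxCells, List.length_append, List.length_append, length_header, length_records, auxLength]
  omega

variable {P col S E X D D' ys xs}

/-- The parts of a node are in the image at the offsets in its record. All offsets are below
`2 ^ w n`, since the whole image lies below the address `lim`, so they are not truncated when they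
are stored as words. -/
theorem nodeStored_frameworkImage {lim base Sc i : ℕ} {m : ℕ → Cell (w n)} {v : ℕ × ℕ}
    (h : StoredBelow lim m base (frameworkImage P col S E X D D' ys xs)) (hSc : 1 ≤ Sc)
    (hlim : lim + Sc ≤ 2 ^ w n) (hv : (internalNodes 0 n)[i]? = some v)
    (hcols : (nodeParts P col S E X (D v) (D' v) v.1 v.2).ncol ≤ Sc) :
    NodeStored lim m base (base + (2 * n + 2) + 12 * i)
      (nodeParts P col S E X (D v) (D' v) v.1 v.2) (nodeOffset P col S E X D D' i) := by
  obtain ⟨haux, hdata⟩ := h.append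
  rw [length_auxCells] at hdata
  simp only [nodeCells_eq] at hdata
  have hgetD : (internalNodes 0 n).getD i (0, 0) = v := by
    rw [List.getD_eq_getElem?_getD, hv, Option.getD_some]
  obtain ⟨hhead, haux⟩ := haux.append
  obtain ⟨hrec, htbl⟩ := haux.append
  rw [length_header] at hrec htbl
  rw [length_records] at htbl
  have hd : ∀ k x, (dataParts P col S E X D D' v)[k]? = some x →
      StoredBelow lim m (base + dataOffset P col S E X D D' i k) x := by
    intro k x hk
    have h1 := (hdata.flatMap hv).flatMap hk
    rw [dataOffset, hgetD, ← add_assoc, ← add_assoc]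
    exact h1
  have ht : ∀ k x, (tableParts P col S E X D D' v)[k]? = some x →
      StoredBelow lim m (base + tableOffset P col S E X D D' i k) x := by
    intro k x hk
    have h1 := (htbl.flatMap hv).flatMap hk
    rw [tableOffset, hgetD, ← add_assoc, ← add_assoc, ← add_assoc]
    exact h1
  have hi := (List.getElem?_eq_some_iff.1 hv).1
  have hr := hrec.flatMap (k := i) (x := i) (by simp [hi])
  rw [List.take_range, min_eq_left hi.le, length_records] at hr
  have hle := hr.le
  rw [List.length_map, List.length_range] at hle
  refine ⟨fun k hk => hr.stored.get (by simp [hk]), hle, fun k hk => ?_, hd 2 _ rfl, hd 3 _ rfl,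
    hd 4 _ rfl, hd 5 _ rfl, hd 6 _ rfl, hd 7 _ rfl, hd 8 _ rfl, ?_, ht 0 _ rfl, ht 1 _ rfl,
    ht 2 _ rfl, ht 3 _ rfl⟩
  · unfold nodeOffset
    split_ifs with h1 h2
    · obtain ⟨x, hx⟩ : ∃ x, (dataParts P col S E X D D' v)[k + 2]? = some x :=
        ⟨_, List.getElem?_eq_getElem (by simp [dataParts]; omega)⟩
      have := (hd _ x hx).le
      omega
    · rw [hgetD]
      omega
    · obtain ⟨x, hx⟩ : ∃ x, (tableParts P col S E X D D' v)[k - 8]? = some x :=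
        ⟨_, List.getElem?_eq_getElem (by simp [tableParts]; omega)⟩
      have := (ht _ x hx).le
      omega
  · simp [nodeOffset, hv]

theorem isFramework_frameworkImage (hD : ∀ v ∈ internalNodes 0 n,
      (D v).Decomposes P col liftTop (nodePoints P v.1 ((v.1 + v.2) / 2)) ∧
      (D' v).Decomposes P col liftBot (nodePoints P ((v.1 + v.2) / 2) v.2)) :
    IsFramework P col S E X (frameworkImage P col S E X D D' ys xs) :=
  ⟨_, D, D', hD, rfl⟩

end Layout

/-! ### The space of the framework -/

section Space

variable {w : ℕ → ℕ} {n X : ℕ} {S : StabbingStructure w} {E : EmptinessStructure w}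

/-- Double counting of the pairs of a box and a bottom list that contains it. -/
theorem firstBlock_le {N : ℕ} {B : Fin N → CanonicalBox} {δ space φ cst τ scratch : ℝ}
    (hS : S.Correct n B δ space φ cst τ scratch) (hX : 1 ≤ X) :
    (firstBlock X (S.bottom n B) (S.image n B).length : ℝ) ≤ N * δ / X := by
  have hX' : (0 : ℝ) < X := by exact_mod_cast hX
  rw [le_div_iff₀ hX']
  have h1 : firstBlock X (S.bottom n B) (S.image n B).length * X ≤
      ∑ v ∈ Finset.range (S.image n B).length, (S.bottom n B v).length := by
    have h4 : firstBlock X (S.bottom n B) (S.image n B).length =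
        ∑ v ∈ Finset.range (S.image n B).length, (S.bottom n B v).length / X := rfl
    rw [h4, Finset.sum_mul]
    exact Finset.sum_le_sum fun v _ => Nat.div_mul_le_self _ _
  -- The bottom lists have no repetitions, so they can be counted as sets.
  have h2 : ∑ v ∈ Finset.range (S.image n B).length, (S.bottom n B v).length =
      ∑ i : Fin N, ((Finset.range (S.image n B).length).filter fun v => i ∈ S.bottom n B v).card := by
    have h3 : ∀ v, (S.bottom n B v).length =
        (Finset.univ.filter fun i => i ∈ S.bottom n B v).card := fun v => by
      rw [← List.toFinset_card_of_nodup (hS.nodup v)]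
      congr 1
      ext i
      simp
    simp only [h3, Finset.card_filter]
    exact Finset.sum_comm
  rw [h2] at h1
  calc (firstBlock X (S.bottom n B) (S.image n B).length : ℝ) * X
      ≤ ∑ i : Fin N, (((Finset.range (S.image n B).length).filter
          fun v => i ∈ S.bottom n B v).card : ℝ) := by exact_mod_cast h1
    _ ≤ ∑ _i : Fin N, δ := Finset.sum_le_sum fun i _ => hS.duplication_le i
    _ = N * δ := by simp

variable {P : Fin n → ℝ × ℝ} {col : Fin n → Fin n} {D D' : ℕ × ℕ → ColoredBoxes n}
  {ys xs : Fin n → ℝ}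

theorem length_dataParts_add_tableParts (v : ℕ × ℕ) (hy : Function.Injective fun i => (P i).2)
    (hv : v.1 ≤ v.2) (hvn : v.2 ≤ n) :
    ((dataParts P col S E X D D' v).flatMap id).length +
      ((tableParts P col S E X D D' v).flatMap id).length =
    5 * (v.2 - v.1) + 2 * ((S.image n (D v).box).length + (S.image n (D' v).box).length) +
      ((D v).N + (D' v).N) + ((E.image n (rankSpace P col v.1 ((v.1 + v.2) / 2))).length +
      (E.image n (rankSpace P col ((v.1 + v.2) / 2) v.2)).length) +
      firstBlock X (S.bottom n (D v).box) (S.image n (D v).box).length *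
        firstBlock X (S.bottom n (D' v).box) (S.image n (D' v).box).length := by
  simp only [dataParts, tableParts, nodeParts, List.flatMap_cons, List.flatMap_nil, id,
    List.length_append, List.length_map, List.length_ofFn, length_sortBy, List.length_nil,
    blockTable, List.length_range, length_matrixCells, length_fullPrefixes]
  rw [length_flatMap_const (k := 3) fun _ _ => rfl, length_sortBy, card_nodePoints hy hvn,
    card_nodePoints hy hvn, card_nodePoints hy (by omega)]
  omega

theorem length_frameworkImage :
    (frameworkImage P col S E X D D' ys xs).length = 2 * n + 2 + 12 * (n - 1) +
      ((internalNodes 0 n).map fun v => ((dataParts P col S E X D D' v).flatMap id).length +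
        ((tableParts P col S E X D D' v).flatMap id).length).sum := by
  rw [frameworkImage, List.length_append, length_auxCells, auxLength, length_internalNodes]
  simp only [nodeCells_eq]
  rw [List.length_flatMap, List.length_flatMap, List.sum_map_add]
  omega

/-- Apart from the matrix, the space of a node is linear in its size, with a factor that depends on
the two structures. The matrix has `2 * KS * δ / X` rows (columns) for each point of the left
(right) child. The sum over the nodes is bounded by `sum_internalNodes_le`. -/
theorem length_frameworkImage_le {KS KE δ h f : ℝ} {t : ℕ} {φ cst τ : ℝ}
    {scratch scratch' : ℕ × ℕ → ℝ}
    (hy : Function.Injective fun i => (P i).2) (hKS : 0 ≤ KS) (hKE : 0 ≤ KE) (hδ : 0 ≤ δ)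
    (hh : 0 ≤ h) (hf : 0 ≤ f) (hn : 2 ≤ n) (hX : 1 ≤ X) (ht : n ≤ 2 ^ t)
    (hN : ∀ v ∈ internalNodes 0 n, (D v).N ≤ 2 * ((v.1 + v.2) / 2 - v.1) ∧
      (D' v).N ≤ 2 * (v.2 - (v.1 + v.2) / 2))
    (hS : ∀ v ∈ internalNodes 0 n,
      S.Correct n (D v).box (KS * δ) (KS * ((D v).N * h)) φ cst τ (scratch v) ∧
      S.Correct n (D' v).box (KS * δ) (KS * ((D' v).N * h)) φ cst τ (scratch' v))
    (hE : ∀ lo hi : ℕ, lo < hi → hi ≤ n →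
      ((E.image n (rankSpace P col lo hi)).length : ℝ) ≤ KE * ((hi - lo : ℕ) * f)) :
    ((frameworkImage P col S E X D D' ys xs).length : ℝ) ≤
      14 * n + (7 + 4 * KS * h + KE * f) * (n * t) + (2 * KS * δ / X) ^ 2 * n ^ 2 := by
  have hX' : (0 : ℝ) < X := by exact_mod_cast hX
  have hnode : ∀ v ∈ internalNodes 0 n, ((((dataParts P col S E X D D' v).flatMap id).length +
      ((tableParts P col S E X D D' v).flatMap id).length : ℕ) : ℝ) ≤
      (7 + 4 * KS * h + KE * f) * ((v.2 - v.1 : ℕ) : ℝ) + (2 * KS * δ / X) ^ 2 *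
        (((v.1 + v.2) / 2 - v.1 : ℕ) * ((v.2 - (v.1 + v.2) / 2 : ℕ) : ℝ)) := by
    intro v hv
    obtain ⟨-, h1, h2⟩ := mem_internalNodes hv
    obtain ⟨hN1, hN2⟩ := hN v hv
    obtain ⟨hS1, hS2⟩ := hS v hv
    have hE1 := hE v.1 ((v.1 + v.2) / 2) (by omega) (by omega)
    have hE2 := hE ((v.1 + v.2) / 2) v.2 (by omega) (by omega)
    have hr1 := firstBlock_le hS1 hX
    have hr2 := firstBlock_le hS2 hX
    have hi1 := hS1.space_le
    have hi2 := hS2.space_le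
    rw [length_dataParts_add_tableParts v hy (by omega) h2]
    have hsum : ((v.2 - v.1 : ℕ) : ℝ) =
        ((v.1 + v.2) / 2 - v.1 : ℕ) + (v.2 - (v.1 + v.2) / 2 : ℕ) := by
      rw [← Nat.cast_add]
      congr 1
      omega
    push_cast [-Nat.cast_sub]
    rw [hsum]
    set m1 : ℝ := (((v.1 + v.2) / 2 - v.1 : ℕ) : ℝ) with hm1
    set m2 : ℝ := ((v.2 - (v.1 + v.2) / 2 : ℕ) : ℝ) with hm2
    have hm1' : 0 ≤ m1 := Nat.cast_nonneg _
    have hm2' : 0 ≤ m2 := Nat.cast_nonneg _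
    have hN1' : ((D v).N : ℝ) ≤ 2 * m1 := by rw [hm1]; exact_mod_cast hN1
    have hN2' : ((D' v).N : ℝ) ≤ 2 * m2 := by rw [hm2]; exact_mod_cast hN2
    have hi1' : KS * ((D v).N * h) ≤ KS * (2 * m1 * h) := by gcongr
    have hi2' : KS * ((D' v).N * h) ≤ KS * (2 * m2 * h) := by gcongr
    have hr1' : (D v).N * (KS * δ) / X ≤ 2 * m1 * (KS * δ) / X := by gcongr
    have hr2' : (D' v).N * (KS * δ) / X ≤ 2 * m2 * (KS * δ) / X := by gcongr
    have hprod := mul_le_mul (hr1.trans hr1') (hr2.trans hr2') (Nat.cast_nonneg _)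
      (by positivity)
    have heq : 2 * m1 * (KS * δ) / X * (2 * m2 * (KS * δ) / X) =
        (2 * KS * δ / X) ^ 2 * (m1 * m2) := by ring
    rw [heq] at hprod
    nlinarith [hi1, hi2, hE1, hE2]
  have hsum := List.sum_le_sum hnode
  have hbound := sum_internalNodes_le (lo := 0) (hi := n) (t := t) (by omega)
    (7 + 4 * KS * h + KE * f) ((2 * KS * δ / X) ^ 2) (by positivity) (by positivity)
  rw [length_frameworkImage, Nat.cast_add, Nat.cast_list_sum, List.map_map]
  have h1 : ((2 * n + 2 + 12 * (n - 1) : ℕ) : ℝ) ≤ 14 * n := by exact_mod_cast by omega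
  rw [Nat.sub_zero] at hbound
  exact (add_le_add h1 (hsum.trans hbound)).trans (add_assoc _ _ _).ge

end Space

/-! ### The bounds -/

section Bounds

variable {δ h φ τ f g : ℕ → ℝ} {n X : ℕ}

/-- The terms that the space bound dominates. -/
structure SpaceTerms (δ h f : ℕ → ℝ) (n X : ℕ) (s : ℝ) : Prop where
  sq : (n * δ n / X) ^ 2 ≤ s
  n_log : n * Real.logb 2 n ≤ s
  n_log_h : n * Real.logb 2 n * h n ≤ s
  n_log_f : n * Real.logb 2 n * f n ≤ s
  n_h : n * h n ≤ s
  n_f : n * f n ≤ s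
  n : n ≤ s

/-- The terms that the time bound dominates. -/
structure TimeTerms (φ τ g : ℕ → ℝ) (n X : ℕ) (s : ℝ) : Prop where
  sq : φ n ^ 2 ≤ s
  X_phi : X * φ n ≤ s
  X_phi_tau : X * φ n * τ n ≤ s
  X_phi_g : X * φ n * g n ≤ s
  log : Real.logb 2 n ≤ s
  phi : φ n ≤ s
  tau : τ n ≤ s
  g : g n ≤ s
  one : 1 ≤ s

theorem one_le_logb (hn : 2 ≤ n) : 1 ≤ Real.logb 2 n := by
  rw [Real.le_logb_iff_rpow_le one_lt_two (by positivity)]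
  simpa using (by exact_mod_cast hn : (2 : ℝ) ≤ n)

theorem spaceTerms (hn : 2 ≤ n) (hh : 1 ≤ h n) (hf : 1 ≤ f n) :
    SpaceTerms δ h f n X (spaceBound δ h f n X) := by
  have hl := one_le_logb hn
  have h0 : (0 : ℝ) ≤ n := Nat.cast_nonneg n
  have hsq : 0 ≤ (n * δ n / X) ^ 2 := sq_nonneg _
  have hnl : (n : ℝ) ≤ n * Real.logb 2 n := le_mul_of_one_le_right h0 hl
  have hnl0 := h0.trans hnl
  have h1 : n * Real.logb 2 n ≤ n * Real.logb 2 n * h n := le_mul_of_one_le_right hnl0 hh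
  have h2 : n * Real.logb 2 n ≤ n * Real.logb 2 n * f n := le_mul_of_one_le_right hnl0 hf
  have h3 : n * h n ≤ n * Real.logb 2 n * h n := mul_le_mul_of_nonneg_right hnl (by linarith)
  have h4 : n * f n ≤ n * Real.logb 2 n * f n := mul_le_mul_of_nonneg_right hnl (by linarith)
  have e : spaceBound δ h f n X =
      (n * δ n / X) ^ 2 + (n * Real.logb 2 n * f n + n * Real.logb 2 n * h n) := by
    rw [spaceBound]; ring
  rw [e]
  constructor <;> linarith

theorem timeTerms (hn : 2 ≤ n) (hX : 1 ≤ X) (hφ : 1 ≤ φ n) (hτ : 1 ≤ τ n) (hg : 1 ≤ g n) :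
    TimeTerms φ τ g n X (timeBound φ τ g n X) := by
  have hl := one_le_logb hn
  have hll : 0 ≤ Real.logb 2 (Real.logb 2 n) := Real.logb_nonneg one_lt_two hl
  have hX' : (1 : ℝ) ≤ X := by exact_mod_cast hX
  have hφ2 : φ n ≤ φ n ^ 2 := by nlinarith
  have h1 : 1 ≤ X * φ n := one_le_mul_of_one_le_of_one_le hX' hφ
  have h2 : X * φ n ≤ X * φ n * τ n := le_mul_of_one_le_right (by linarith) hτ
  have h3 : X * φ n ≤ X * φ n * g n := le_mul_of_one_le_right (by linarith) hg
  have h4 : τ n ≤ X * φ n * τ n := le_mul_of_one_le_left (by linarith) h1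
  have h5 : g n ≤ X * φ n * g n := le_mul_of_one_le_left (by linarith) h1
  have h6 : 0 ≤ X * φ n * Real.logb 2 (Real.logb 2 n) := mul_nonneg (by linarith) hll
  have e : timeBound φ τ g n X = φ n ^ 2 + (X * φ n * Real.logb 2 (Real.logb 2 n) +
      X * φ n * g n + X * φ n * τ n) + Real.logb 2 n := by
    rw [timeBound]; ring
  rw [e]
  constructor <;> linarith

/-- The number of the rounds of a binary search, and of the levels of the tree, is `O(lg n)`. -/
theorem clog_succ_le (hn : 2 ≤ n) : ((Nat.clog 2 n + 1 : ℕ) : ℝ) ≤ 3 * Real.logb 2 n := by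
  have hl := one_le_logb hn
  have h := Nat.ceil_lt_add_one (a := Real.logb 2 n) (by linarith)
  rw [← Nat.cast_two, Real.natCeil_logb_natCast] at h
  push_cast at h ⊢
  linarith

/-- The constant of the claim, from the constants of the two structures and the number of words
that describe a prefix. -/
noncomputable def totalConst (KS KE : ℝ) (W : ℕ) : ℝ := 2000 * (1 + KS + KE + W) ^ 2

/-- The work space that is left to the calls of the given structures. -/
noncomputable def callSpace (KS KE : ℝ) (δ h φ τ f g : ℕ → ℝ) (n X : ℕ) : ℕ :=
  ⌈KS * (2 * n * h n + φ n + τ n)⌉₊ + ⌈KE * (n * f n + g n)⌉₊ + ⌈2 * KS * (n * δ n / X)⌉₊ + 1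

variable {KS KE s : ℝ} {W t : ℕ}

/-- The products of constants that occur in the bounds on space, work space and time. -/
theorem totalConst_ge (hKS : 0 ≤ KS) (hKE : 0 ≤ KE) (W : ℕ) :
    2000 + 2000 * KS + 2000 * KE + 2000 * W + 2000 * KS ^ 2 + 2000 * (KS * KE) + 2000 * (KS * W) ≤
      totalConst KS KE W := by
  have hW : (0 : ℝ) ≤ W := Nat.cast_nonneg W
  have h1 := mul_nonneg hKS hKE
  have h2 := mul_nonneg hKS hW
  have h3 := mul_nonneg hKE hW
  rw [totalConst]
  nlinarith [sq_nonneg KE, sq_nonneg (W : ℝ)]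

theorem callSpace_le (hKS : 0 ≤ KS) (hKE : 0 ≤ KE) (hδ : 1 ≤ δ n) (hs : SpaceTerms δ h f n X s)
    (ht : TimeTerms φ τ g n X s) (hτ : 1 ≤ τ n) (hg : 1 ≤ g n) (hφ : 1 ≤ φ n) (hh : 1 ≤ h n)
    (hf : 1 ≤ f n) :
    (callSpace KS KE δ h φ τ f g n X : ℝ) ≤ (8 * KS + 2 * KE + 4) * s := by
  have h0 : (0 : ℝ) ≤ n := Nat.cast_nonneg n
  have h1 : 0 ≤ KS * (2 * n * h n + φ n + τ n) := by positivity
  have h2 : 0 ≤ KE * (n * f n + g n) := by positivity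
  have h3 : 0 ≤ 2 * KS * (n * δ n / X) := by positivity
  have e1 := (Nat.ceil_lt_add_one h1).le
  have e2 := (Nat.ceil_lt_add_one h2).le
  have e3 := (Nat.ceil_lt_add_one h3).le
  have k1 : KS * (2 * n * h n + φ n + τ n) ≤ KS * (4 * s) :=
    mul_le_mul_of_nonneg_left (by linarith [hs.n_h, ht.phi, ht.tau]) hKS
  have k2 : KE * (n * f n + g n) ≤ KE * (2 * s) :=
    mul_le_mul_of_nonneg_left (by linarith [hs.n_f, ht.g]) hKE
  -- The number `n * δ n / X` is at most `1` plus its square.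
  have k3 : 2 * KS * (n * δ n / X) ≤ 2 * KS * (2 * s) :=
    mul_le_mul_of_nonneg_left (by nlinarith [hs.sq, ht.one, sq_nonneg (n * δ n / X - 1)])
      (by positivity)
  have h4 := ht.one
  simp only [callSpace]
  push_cast
  linarith

/-- The work space: the arrays for the marked colors, the located prefixes of both sides, the
addresses of rows, and the work space of the calls. -/
theorem scratch_le (hKS : 0 ≤ KS) (hKE : 0 ≤ KE) (hδ : 1 ≤ δ n) (hs : SpaceTerms δ h f n X s)
    (ht : TimeTerms φ τ g n X s) (hτ : 1 ≤ τ n) (hg : 1 ≤ g n) (hφ : 1 ≤ φ n) (hh : 1 ≤ h n)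
    (hf : 1 ≤ f n) :
    ((2 * n + 2 * (⌊KS * φ n⌋₊ * W) + ⌊KS * φ n⌋₊ + callSpace KS KE δ h φ τ f g n X : ℕ) : ℝ) ≤
      totalConst KS KE W * s := by
  have hfl := Nat.floor_le (show 0 ≤ KS * φ n by positivity)
  have hc := callSpace_le hKS hKE hδ hs ht hτ hg hφ hh hf
  have hW : (0 : ℝ) ≤ W := Nat.cast_nonneg W
  have h1 : KS * φ n ≤ KS * s := mul_le_mul_of_nonneg_left ht.phi hKS
  have h2 : ⌊KS * φ n⌋₊ * (W : ℝ) ≤ KS * s * W := mul_le_mul_of_nonneg_right (hfl.trans h1) hW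
  have hs0 : 0 ≤ s := zero_le_one.trans ht.one
  refine le_trans ?_ (mul_le_mul_of_nonneg_right (totalConst_ge hKS hKE W) hs0)
  have h3 := mul_nonneg hKS hs0
  have h4 := mul_nonneg hKE hs0
  have h5 := mul_nonneg hW hs0
  have h6 := mul_nonneg hKS h3
  have h7 := mul_nonneg hKS h4
  have h8 := mul_nonneg hKS h5
  push_cast
  nlinarith [hs.n]

theorem space_le (hKS : 0 ≤ KS) (hKE : 0 ≤ KE) (hs : SpaceTerms δ h f n X s) (hs1 : 0 ≤ s)
    (hn : 2 ≤ n) (hh : 1 ≤ h n) (hf : 1 ≤ f n) :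
    14 * n + (7 + 4 * KS * h n + KE * f n) * (n * (Nat.clog 2 n + 1 : ℕ)) +
      (2 * KS * δ n / X) ^ 2 * n ^ 2 ≤ totalConst KS KE W * s := by
  have hW : (0 : ℝ) ≤ W := Nat.cast_nonneg W
  have h1 : (7 + 4 * KS * h n + KE * f n) * (n * (Nat.clog 2 n + 1 : ℕ)) ≤
      (7 + 4 * KS * h n + KE * f n) * (n * (3 * Real.logb 2 n)) := by
    gcongr
    exact clog_succ_le hn
  have h2 := mul_le_mul_of_nonneg_left hs.n_log_h hKS
  have h3 := mul_le_mul_of_nonneg_left hs.n_log_f hKE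
  have h4 := mul_le_mul_of_nonneg_left hs.sq (sq_nonneg KS)
  have e : (2 * KS * δ n / X) ^ 2 * n ^ 2 = 4 * (KS ^ 2 * (n * δ n / X) ^ 2) := by ring
  refine le_trans ?_ (mul_le_mul_of_nonneg_right (totalConst_ge hKS hKE W) hs1)
  rw [e]
  have h3' := mul_nonneg hKS hs1
  have h4' := mul_nonneg hKE hs1
  have h5 := mul_nonneg hW hs1
  have h6 := mul_nonneg hKS h3'
  have h7 := mul_nonneg hKS h4'
  have h8 := mul_nonneg hKS h5
  nlinarith [hs.n, hs.n_log]

theorem time_le (hKS : 0 ≤ KS) (hKE : 0 ≤ KE) (ht : TimeTerms φ τ g n X s) (hn : 2 ≤ n)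
    (hτ : 1 ≤ τ n) (hg : 1 ≤ g n) (hφ : 1 ≤ φ n) :
    (((Nat.clog 2 n + 1) * 93 + nodeTime (Nat.clog 2 n + 1) W X ⌊KS * φ n⌋₊ (KS * φ n) KS
      (KS * τ n) (KE * g n) + 260 : ℕ) : ℝ) ≤ totalConst KS KE W * s := by
  have hW : (0 : ℝ) ≤ W := Nat.cast_nonneg W
  have hX : (0 : ℝ) ≤ X := Nat.cast_nonneg X
  have hs0 : 0 ≤ s := zero_le_one.trans ht.one
  have f1 := Nat.floor_le (show 0 ≤ KS * φ n by positivity)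
  have f2 := Nat.floor_le hKS
  have f3 := Nat.floor_le (show 0 ≤ KS * τ n by positivity)
  have f4 := Nat.floor_le (show 0 ≤ KE * g n by positivity)
  have hl := clog_succ_le hn
  have hlog := ht.log
  simp only [nodeTime]
  push_cast at hl ⊢
  have hprod : 2 * (⌊KS * φ n⌋₊ : ℝ) * (⌊KS⌋₊ + W * 5 + ⌊KS * φ n⌋₊ * 30 +
      X * (⌊KS * τ n⌋₊ + W * 5 + ⌊KE * g n⌋₊ + 100) + 100) ≤
      2 * (KS * φ n) * (KS + W * 5 + (KS * φ n) * 30 +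
      X * (KS * τ n + W * 5 + KE * g n + 100) + 100) := by
    gcongr
  have e : 2 * (KS * φ n) * (KS + W * 5 + (KS * φ n) * 30 +
      X * (KS * τ n + W * 5 + KE * g n + 100) + 100) =
      (2 * KS ^ 2 + 10 * (KS * W) + 200 * KS) * φ n + 60 * KS ^ 2 * φ n ^ 2 +
      2 * KS ^ 2 * (X * φ n * τ n) + (10 * (KS * W) + 200 * KS) * (X * φ n) +
      2 * (KS * KE) * (X * φ n * g n) := by ring
  rw [e] at hprod
  have k1 : (2 * KS ^ 2 + 10 * (KS * W) + 200 * KS) * φ n ≤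
      (2 * KS ^ 2 + 10 * (KS * W) + 200 * KS) * s :=
    mul_le_mul_of_nonneg_left ht.phi (by positivity)
  have k2 : 60 * KS ^ 2 * φ n ^ 2 ≤ 60 * KS ^ 2 * s :=
    mul_le_mul_of_nonneg_left ht.sq (by positivity)
  have k3 : 2 * KS ^ 2 * (X * φ n * τ n) ≤ 2 * KS ^ 2 * s :=
    mul_le_mul_of_nonneg_left ht.X_phi_tau (by positivity)
  have k4 : (10 * (KS * W) + 200 * KS) * (X * φ n) ≤ (10 * (KS * W) + 200 * KS) * s :=
    mul_le_mul_of_nonneg_left ht.X_phi (by positivity)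
  have k5 : 2 * (KS * KE) * (X * φ n * g n) ≤ 2 * (KS * KE) * s :=
    mul_le_mul_of_nonneg_left ht.X_phi_g (by positivity)
  have k6 := mul_le_mul_of_nonneg_left ht.phi hKS
  refine le_trans ?_ (mul_le_mul_of_nonneg_right (totalConst_ge hKS hKE W) hs0)
  have h3 := mul_nonneg hKS hs0
  have h4 := mul_nonneg hKE hs0
  have h5 := mul_nonneg hW hs0
  have h6 := mul_nonneg hKS h3
  have h7 := mul_nonneg hKS h4
  have h8 := mul_nonneg hKS h5
  have h9 := ht.one
  linarith

end Bounds

end ColoredRange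

open ColoredRange

theorem mainTheorem5
    (w : ℕ → ℕ)
    (S : ColoredRange.StabbingStructure w)
    (E : ColoredRange.EmptinessStructure w)
    (δ h φ τ f g : ℕ → ℝ)
    (hpos : ∀ n, 2 ≤ n →
      1 ≤ δ n ∧ 1 ≤ h n ∧ 1 ≤ φ n ∧ 1 ≤ τ n ∧ 1 ≤ f n ∧ 1 ≤ g n)
    (hS : S.HasBounds δ h φ τ)
    (hE : E.HasBounds f g) :
    ∃ (query : ColoredRange.Cmd) (K : ℝ), 0 < K ∧
      ∀ n : ℕ, 2 ≤ n → ∀ X : ℕ, 1 ≤ X → X ≤ n →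
      ∀ (P : Fin n → ℝ × ℝ) (col : Fin n → Fin n),
        (Function.Injective fun i => (P i).1) → (Function.Injective fun i => (P i).2) →
        K * (ColoredRange.spaceBound δ h f n X + ColoredRange.timeBound φ τ g n X) ≤ 2 ^ w n →
        ∃ img : List (ColoredRange.Cell (w n)),
          ColoredRange.IsFramework P col S E X img ∧
          (img.length : ℝ) ≤ K * ColoredRange.spaceBound δ h f n X ∧
          ∀ a b c d : ℝ,
            ColoredRange.Answers query img [] [a, b, c, d]
              (K * (ColoredRange.spaceBound δ h f n X + ColoredRange.timeBound φ τ g n X))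
              (K * ColoredRange.timeBound φ τ g n X)
              (fun _ σ => (σ.reg 0).toNat = ColoredRange.colorCount P col a b c d) := by
  obtain ⟨KS, hKS, hS⟩ := hS
  obtain ⟨KE, hKE, hE⟩ := hE
  -- A prefix is described by `S.width + 1` words. The registers from `R` on are beyond those that
  -- the given programs write and those that receive arguments.
  set W := S.width + 1 with hW
  set R := S.locate.bound + S.length.bound + S.report.bound + E.query.bound + W + 7 with hR
  have hK : 0 < totalConst KS KE W := by unfold totalConst; positivity
  refine ⟨topQuery R W S.locate S.length S.report E.query,
    totalConst KS KE W, hK, fun n hn X hX hXn P col hx hy hmem => ?_⟩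
  obtain ⟨hδ, hh, hφ, hτ, hf, hg⟩ := hpos n hn
  have hsT := spaceTerms (δ := δ) (X := X) hn hh hf
  have htT := timeTerms (X := X) hn hX hφ hτ hg
  set SB := spaceBound δ h f n X with hSB
  set TB := timeBound φ τ g n X with hTB
  have hTB1 : 1 ≤ TB := htT.one
  have hSB1 : 0 ≤ SB := (Nat.cast_nonneg n).trans hsT.n
  have hs : SpaceTerms δ h f n X (SB + TB) := by
    obtain ⟨h1, h2, h3, h4, h5, h6, h7⟩ := hsT
    constructor <;> linarith
  have ht : TimeTerms φ τ g n X (SB + TB) := by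
    obtain ⟨h1, h2, h3, h4, h5, h6, h7, h8, h9⟩ := htT
    constructor <;> linarith
  have hs1 : 1 ≤ SB + TB := ht.one
  have hKge := totalConst_ge hKS.le hKE.le W
  have hWnn : (0 : ℝ) ≤ W := Nat.cast_nonneg W
  have hSE := mul_nonneg hKS.le hKE.le
  have hSW := mul_nonneg hKS.le hWnn
  have hmono : ∀ x : ℝ, x ≤ totalConst KS KE W → x * (SB + TB) ≤ 2 ^ w n :=
    fun x h' => (mul_le_mul_of_nonneg_right h' (by linarith)).trans hmem
  have hWlt : W < 2 ^ w n := by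
    have h1 := hmono (W + 1) (by nlinarith [sq_nonneg KS])
    have h2 : (W : ℝ) + 1 ≤ (W + 1) * (SB + TB) := le_mul_of_one_le_right (by positivity) hs1
    have h3 : (W : ℝ) + 1 ≤ 2 ^ w n := h2.trans h1
    exact_mod_cast h3
  have : NeZero (w n) := ⟨fun h0 => by rw [h0] at hWlt; omega⟩
  -- `Sc` bounds the work space of every call. It also bounds the numbers of rows and columns, so
  -- that these fit into words.
  set Sc := callSpace KS KE δ h φ τ f g n X with hSc
  have hSc1 : 1 ≤ Sc := by rw [hSc, callSpace]; omega
  have hscr := scratch_le (W := W) hKS.le hKE.le hδ hs ht hτ hg hφ hh hf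
  have hSclt : Sc < 2 ^ w n := by
    have h1 := hscr.trans hmem
    have h2 : 2 * n + 2 * (⌊KS * φ n⌋₊ * W) + ⌊KS * φ n⌋₊ + Sc ≤ 2 ^ w n := by exact_mod_cast h1
    omega
  have hScR : KS * (2 * n * h n + φ n + τ n) ≤ Sc ∧ KE * (n * f n + g n) ≤ Sc ∧
      2 * KS * (n * δ n / X) ≤ Sc := by
    have h1 := Nat.le_ceil (KS * (2 * n * h n + φ n + τ n))
    have h2 := Nat.le_ceil (KE * (n * f n + g n))
    have h3 := Nat.le_ceil (2 * KS * (n * δ n / X))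
    rw [hSc, callSpace]
    push_cast
    refine ⟨?_, ?_, ?_⟩ <;> linarith [Nat.cast_nonneg (α := ℝ)
      ⌈KS * (2 * n * h n + φ n + τ n)⌉₊, Nat.cast_nonneg (α := ℝ) ⌈KE * (n * f n + g n)⌉₊,
      Nat.cast_nonneg (α := ℝ) ⌈2 * KS * (n * δ n / X)⌉₊]
  have hScW : (Sc : ℝ) ≤ 2 ^ w n := by exact_mod_cast hSclt.le
  have hcard := fun lo hi (h' : hi ≤ n) =>
    card_nodePoints (P := P) hy (lo := lo) (hi := hi) h'
  -- The boxes of a node are chosen from those of `exists_decomposes` for its two children.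
  choose D hD using fun v : ℕ × ℕ => exists_decomposes_liftTop (col := col) hx hy
    (nodePoints P v.1 ((v.1 + v.2) / 2))
  choose D' hD' using fun v : ℕ × ℕ => exists_decomposes_liftBot (col := col) hx hy
    (nodePoints P ((v.1 + v.2) / 2) v.2)
  -- A node has at most `2 * n` boxes on each side, so the given stabbing structure is available
  -- with the bounds for `n`.
  have hcorrect : ∀ (A : ColoredBoxes n) (lift : ℝ × ℝ → ℝ × ℝ × ℝ) (lo hi : ℕ),
      lo < hi → hi ≤ n → A.Decomposes P col lift (nodePoints P lo hi) →
      A.N ≤ 2 * (hi - lo) ∧ KS * (A.N * h n + φ n + τ n) ≤ Sc ∧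
      S.Correct n A.box (KS * δ n) (KS * (A.N * h n)) (KS * φ n) KS (KS * τ n)
        (KS * (A.N * h n + φ n + τ n)) := by
    intro A lift lo hi hlt hhi hA
    have h1 := hA.card_le
    rw [hcard lo hi hhi] at h1
    have h2 : A.N ≤ 2 * n := by omega
    have h3 : KS * (A.N * h n + φ n + τ n) ≤ Sc := by
      refine le_trans ?_ hScR.1
      have : (A.N : ℝ) ≤ 2 * n := by exact_mod_cast h2
      gcongr
    refine ⟨h1, h3, hS n hn A.N (hA.pos ?_) h2 A.box hA.injective (h3.trans hScW)⟩
    rw [← Finset.card_pos, hcard lo hi hhi]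
    omega
  have hempty : ∀ lo hi : ℕ, lo < hi → hi ≤ n → KE * ((hi - lo : ℕ) * f n + g n) ≤ Sc ∧
      ((E.image n (rankSpace P col lo hi)).length : ℝ) ≤
        KE * ((hi - lo : ℕ) * f n) ∧
      ∀ (c : Fin n) (x₁ x₂ y₁ y₂ : Fin (rankSpace P col lo hi).length),
        Answers E.query (E.image n (rankSpace P col lo hi))
          [BitVec.ofNat (w n) c, BitVec.ofNat (w n) x₁, BitVec.ofNat (w n) x₂,
            BitVec.ofNat (w n) y₁, BitVec.ofNat (w n) y₂] []
          (KE * ((hi - lo : ℕ) * f n + g n)) (KE * g n)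
          (fun _ σ => (HasColorIn (rankSpace P col lo hi) c x₁ x₂ y₁ y₂ →
              σ.reg 0 = 1#(w n)) ∧
            (¬ HasColorIn (rankSpace P col lo hi) c x₁ x₂ y₁ y₂ →
              σ.reg 0 = 0#(w n))) := by
    intro lo hi hlt hhi
    have h1 := length_rankSpace (P := P) (col := col) hy (lo := lo) hhi
    have h3 : KE * ((hi - lo : ℕ) * f n + g n) ≤ Sc := by
      refine le_trans ?_ hScR.2.1
      have : ((hi - lo : ℕ) : ℝ) ≤ n := by exact_mod_cast by omega
      gcongr
    have h2 := hE n hn (rankSpace P col lo hi) (by omega) (by omega)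
      (rankSpace_perm hy hhi) (by rw [h1]; exact h3.trans hScW)
    rw [← h1] at h3 ⊢
    exact ⟨h3, h2⟩
  have hblocks : ∀ (A : ColoredBoxes n) (lift : ℝ × ℝ → ℝ × ℝ × ℝ) (lo hi : ℕ),
      lo < hi → hi ≤ n → A.Decomposes P col lift (nodePoints P lo hi) →
      firstBlock X (S.bottom n A.box) (S.image n A.box).length ≤ Sc := by
    intro A lift lo hi hlt hhi hA
    obtain ⟨h1, -, h2⟩ := hcorrect A lift lo hi hlt hhi hA
    have h3 : ((firstBlock X (S.bottom n A.box) (S.image n A.box).length : ℕ) : ℝ) ≤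
        Sc := by
      refine (firstBlock_le h2 hX).trans (le_trans ?_ hScR.2.2)
      have h4 : (A.N : ℝ) ≤ 2 * n := by exact_mod_cast by omega
      have e : 2 * KS * (n * δ n / X) = 2 * n * (KS * δ n) / X := by ring
      rw [e]
      gcongr
    exact_mod_cast h3
  -- The point `e k` has the rank `k`.
  obtain ⟨e, he⟩ := exists_equiv_yRank hy
  have he' : ∀ p, yRank P p = e.symm p := fun p => by
    rw [← he, Equiv.apply_symm_apply]
  have hclog : n < 2 ^ (Nat.clog 2 n + 1) :=
    (Nat.le_pow_clog one_lt_two n).trans_lt (Nat.pow_lt_pow_right one_lt_two (Nat.lt_succ_self _))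
  refine ⟨frameworkImage P col S E X D D' (fun k => (P (e k)).2) fun k => (P (e k)).1,
    isFramework_frameworkImage fun v _ => ⟨hD v, hD' v⟩, ?_, fun a b c d => ?_⟩
  · refine (length_frameworkImage_le (δ := δ n) (h := h n) (f := f n)
      (φ := KS * φ n) (cst := KS) (τ := KS * τ n)
      (scratch := fun v => KS * ((D v).N * h n + φ n + τ n))
      (scratch' := fun v => KS * ((D' v).N * h n + φ n + τ n)) hy hKS.le hKE.le
      (by linarith) (by linarith) (by linarith) hn hX hclog.le (fun v hv => ?_)
      (fun v hv => ?_) fun lo hi hlt hhi => (hempty lo hi hlt hhi).2.1).trans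
        (space_le hKS.le hKE.le hsT hSB1 hn hh hf)
    · obtain ⟨-, h1, h2⟩ := mem_internalNodes hv
      exact ⟨(hcorrect _ _ _ _ (by omega) (by omega) (hD v)).1,
        (hcorrect _ _ _ _ (by omega) (by omega) (hD' v)).1⟩
    · obtain ⟨-, h1, h2⟩ := mem_internalNodes hv
      exact ⟨(hcorrect _ _ _ _ (by omega) (by omega) (hD v)).2.2,
        (hcorrect _ _ _ _ (by omega) (by omega) (hD' v)).2.2⟩
  · refine answers_topQuery (n := n) (X := X) (Sc := Sc) (Tφ := ⌊KS * φ n⌋₊)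
      (t := Nat.clog 2 n + 1) (ys := fun k => (P (e k)).2) (xs := fun k => (P (e k)).1)
      (parts := fun v => nodeParts P col S E X (D v) (D' v) v.1 v.2)
      (off := nodeOffset P col S E X D D') (tq := KS * φ n) (tl := KS)
      (tr := KS * τ n) (te := KE * g n) (fun base lim m hm hlim => ⟨?_, fun i v hv => ?_⟩)
      (fun i j hij => yRank_lt_yRank.1 (by rw [he, he]; exact hij)) (fun h0 => ?_)
      (fun i hi => ?_) (fun v hv yl yr h1 h2 h3 h4 hrank => ?_) (by omega) (by omega) (by omega)
      (by omega) (by omega) (by omega) hX hXn hSc1 hWlt hclog hscr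
      (time_le hKS.le hKE.le htT hn hτ hg hφ)
    · exact (hm.append.1).append.1
    · obtain ⟨-, h1, h2⟩ := mem_internalNodes (List.mem_of_getElem? hv)
      refine nodeStored_frameworkImage hm hSc1 hlim hv ?_
      simp only [nodeParts]
      rw [length_fullPrefixes]
      exact hblocks _ _ _ _ (by omega) (by omega) (hD' v)
    · rw [colorCount, Finset.filter_false_of_mem fun p _ hp => ?_]
      · rfl
      · exact h0 (e.symm p) (by simpa using hp.2)
    · have hfil : (Finset.univ.filter fun p => (a ≤ (P p).1 ∧ (P p).1 ≤ b) ∧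
          (c ≤ (P p).2 ∧ (P p).2 ≤ d)) =
          if a ≤ (P (e i)).1 ∧ (P (e i)).1 ≤ b then {e i} else ∅ := by
        ext p
        have hp := hi (e.symm p)
        rw [Equiv.apply_symm_apply, Equiv.symm_apply_eq] at hp
        rw [Finset.mem_filter, hp]
        split_ifs with h1
        · simp only [Finset.mem_univ, true_and, Finset.mem_singleton]
          exact ⟨fun h => h.2, fun h => ⟨h ▸ h1, h⟩⟩
        · simp only [Finset.mem_univ, true_and, Finset.notMem_empty, iff_false]
          rintro ⟨h2, rfl⟩
          exact h1 h2
      rw [colorCount, hfil]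
      split_ifs <;> simp
    · obtain ⟨-, h5, h6⟩ := mem_internalNodes hv
      obtain ⟨-, k1, k2⟩ := hcorrect _ _ _ _ (by omega) (by omega) (hD v)
      obtain ⟨-, k3, k4⟩ := hcorrect _ _ _ _ (by omega) (by omega) (hD' v)
      refine nodeSpec_nodeParts hy h6 (hD v) (hD' v) k2 k4 k1 k3 hSclt
        (hblocks _ _ _ _ (by omega) (by omega) (hD v))
        (hblocks _ _ _ _ (by omega) (by omega) (hD' v))
        (fun lo hi hlt hhi => ⟨_, (hempty lo hi hlt hhi).1, (hempty lo hi hlt hhi).2.2⟩) h1 h2 h3 h4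
        fun p => ?_
      have := hrank (e.symm p)
      rw [Equiv.apply_symm_apply] at this
      rw [he', this]
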